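/- Let $d\ge 2$, $m\ge 3$ be integers, let $\frac{2m-3}{2m-2}<\alpha<1$ and $\frac1{2\alpha}<\gamma<1$. For integers $n\ge 1$ put $R_n=\frac{2}{d-1}\log n$ and $\omega_n=\log\log R_n$ (for the finitely many $n$ with $R_n\le 1$, where this is undefined or infinite, set $\omega_n=0$). Let $\mathcal B_d=\{x\in\mathbb R^d:\|x\|<1\}$ be the Poincaré ball with the metric $4|dx|^2/(1-\|x\|^2)^2$, whose distance is $d_H(x,y)=\operatorname{arcosh}\big(1+\frac{2\|x-y\|^2}{(1-\|x\|^2)(1-\|y\|^2)}\big)$, and let $o$ be its origin. A point $x$ is described by its radial coordinate $R_n-d_H(o,x)$ and its direction in the unit sphere of $\mathbb R^d$; write $x=(u,\theta)$. Let $\mathcal P_n=\{X_1,\dots,X_{N_n}\}$ be the Poisson point process with $N_n$ Poisson distributed with mean $n$ and, independently, $X_1,X_2,\dots$ i.i.d. with independent radial coordinate, of density $\bar\rho_{n,\alpha}(t)=\sinh^{d-1}(\alpha(R_n-t))\big/\int_0^{R_n}\sinh^{d-1}(\alpha s)\,ds$ on $[0,R_n]$, and direction, uniform on the unit sphere. For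 $p=(u,\theta)$ with $0<u<R_n$ let $\nu_{m,n}(u)$ be the expected number of $(m-1)$-tuples $(Y_1,\dots,Y_{m-1})$ of distinct points of $\mathcal P_n$ such that $d_H(Y_i,Y_j)\le R_n$ and $d_H(Y_i,p)\le R_n$ for all $i,j$, and $V_1\le\dots\le V_{m-1}\le u$, where $V_i=R_n-d_H(o,Y_i)$. (It does not depend on $\theta$; the bounds below are meant for every $\theta$, with the same constants and error terms.) For $u\in\mathbb R$ let $$\ell(u)=\int_{0\le t_1\le\dots\le t_{m-1}\le u}e^{\frac12(d-1)(1-2\alpha)t_1}\prod_{i=2}^{m-1}e^{-\alpha(d-1)t_i}\int_{(\mathbb R^{d-1})^{m-2}}\mathbf 1\Big\{\|w_i\|\le 2e^{\frac12(t_1+t_i)},\ \|w_i-w_j\|\le 2e^{\frac12(t_i+t_j)},\ 2\le i,j\le m-1\Big\}\,dw\,dt ,$$ $\ell(\infty)=\lim_{u\to\infty}\ell(u)$, $K=2^{d-1}\xi_{d-1}\big(s_{d-1}^{-1}\alpha(d-1)\big)^{m-1}$ and $C_{m,\alpha}=K\,\ell(\infty)$, where $\xi_{d-1}$ is the volume of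 the unit ball of $\mathbb R^{d-1}$ and $s_{d-1}$ is the surface area of the unit ball of $\mathbb R^d$. For a parameter $\delta$ with $\frac{(d-1)(m-4\alpha)_+}{(d-1)(m-4\alpha)_++1}<\delta<1$ let $$\ell'(u)=e^{-\frac{\delta u}{4}}+e^{\frac12((d-1)(m-4\alpha)_+(1-\delta)-\delta)u}+e^{\frac12(d-1)(2m-3-(2m-2)\alpha)(1-\delta)u}$$ (the prime does not denote a derivative). Then $\ell(\infty)<\infty$, and the following hold. (i) There is a sequence $\varepsilon_n\to0$ such that for all $n\ge1$ and all $u\in(0,\gamma R_n)$ $$\nu_{m,n}(u)\le(1+\varepsilon_n)\,C_{m,\alpha}\,e^{\frac12(d-1)u}.$$ (ii) For every such $\delta$ there are $C\in(0,\infty)$ and a sequence $\varepsilon_n\to0$ such that for all $n\ge1$ and all $u\in(0,\gamma R_n)$ $$\nu_{m,n}(u)\ge\big\{(1+\varepsilon_n)\,K\,\ell(u)-C\,\ell'(u)\big\}_+\,e^{\frac12(d-1)u}.$$ (iii) There are $C,c_0\in(0,\infty)$ such that for all $n\ge1$ and all $u\in(0,R_n)$ $$\nu_{m,n}(u)\le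 C\,e^{c_0\omega_n}\,e^{\frac12(d-1)u}.$$ -/

import Mathlib

open MeasureTheory Filter Topology Set
open scoped ENNReal NNReal

noncomputable section

namespace HRGG

/-- Euclidean space `ℝ^d`. -/
abbrev E (d : ℕ) : Type := EuclideanSpace ℝ (Fin d)

/-- The unit sphere of `ℝ^d`; it carries the angular components. -/
abbrev Sph (d : ℕ) : Type := Metric.sphere (0 : E d) 1

/-- The hyperbolic radius `R_n = 2 / (d - 1) * log n`. -/
def radius (d n : ℕ) : ℝ := 2 / ((d : ℝ) - 1) * Real.log n

/-- `ω_n = log (log R_n)`, which makes sense when `R_n > 1`; for the finitely many `n` with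
`R_n ≤ 1` the value is set to `0`. -/
def omega (d n : ℕ) : ℝ :=
  if 1 < radius d n then Real.log (Real.log (radius d n)) else 0

/-- The distance on the Poincaré ball `{x : ‖x‖ < 1}` that belongs to the Riemannian metric
`4 |dx|^2 / (1 - |x|^2)^2`. -/
def dH {d : ℕ} (x y : E d) : ℝ :=
  Real.arcosh (1 + 2 * ‖x - y‖ ^ 2 / ((1 - ‖x‖ ^ 2) * (1 - ‖y‖ ^ 2)))

/-- The radial coordinate of `x`, measured from the boundary of the hyperbolic ball of radius
`R_n` around the origin. -/
def height (d n : ℕ) (x : E d) : ℝ := radius d n - dH 0 x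

/-- The point of the Poincaré ball with radial coordinate `u` (measured from the boundary of the
ball of radius `R_n`) and direction `θ`: its hyperbolic distance to the origin is `R_n - u`, so
its Euclidean norm is `tanh ((R_n - u) / 2)`. -/
def point (d n : ℕ) (u : ℝ) (θ : Sph d) : E d :=
  Real.tanh ((radius d n - u) / 2) • (θ : E d)

/-- The density of the radial coordinate on `[0, R_n]`. -/
def radialDensity (d : ℕ) (α : ℝ) (n : ℕ) (t : ℝ) : ℝ :=
  Real.sinh (α * (radius d n - t)) ^ (d - 1) /
    ∫ s in (0 : ℝ)..(radius d n), Real.sinh (α * s) ^ (d - 1)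

/-- The law of the radial coordinate. -/
def radialLaw (d : ℕ) (α : ℝ) (n : ℕ) : Measure ℝ :=
  (volume.restrict (Icc 0 (radius d n))).withDensity
    fun t => ENNReal.ofReal (radialDensity d α n t)

/-- The uniform probability measure on the unit sphere of `ℝ^d`: normalized surface measure. -/
def angularLaw (d : ℕ) : Measure (Sph d) :=
  ((volume : Measure (E d)).toSphere univ)⁻¹ • (volume : Measure (E d)).toSphere

/-- The law of one vertex: radial coordinate and direction are independent. -/
def pointLaw (d : ℕ) (α : ℝ) (n : ℕ) : Measure (E d) :=
  ((radialLaw d α n).prod (angularLaw d)).map fun q => point d n q.1 q.2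

/-- The expectation of `f 𝒫_n`, where `𝒫_n = {X_1, …, X_N}` is the Poisson point process with
intensity measure `n • pointLaw d α n`: `N` is Poisson with mean `n`, and given `N = k` the points
`X_1, …, X_k` are independent with law `pointLaw d α n`. -/
def poissonExpectation (d : ℕ) (α : ℝ) (n : ℕ) (f : Set (E d) → ℝ≥0∞) : ℝ≥0∞ :=
  ∫⁻ k, (∫⁻ x : Fin k → E d, f (range x) ∂(Measure.pi fun _ => pointLaw d α n))
    ∂(ProbabilityTheory.poissonMeasure (n : ℝ≥0))

/-- The number of `m`-cliques consisting of `p` and `m - 1` points of `S`, in which `p` is the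
vertex closest to the origin. The `m - 1` points are distinct and listed by radial coordinate. -/
def cliqueCount (d m n : ℕ) (S : Set (E d)) (p : E d) : ℕ∞ :=
  Set.encard {Y : Fin (m - 1) → E d |
    Function.Injective Y ∧ (∀ i, Y i ∈ S) ∧
    (∀ i j, dH (Y i) (Y j) ≤ radius d n) ∧
    (∀ i, dH (Y i) p ≤ radius d n) ∧
    Monotone (fun i => height d n (Y i)) ∧
    ∀ i, height d n (Y i) ≤ height d n p}

/-- The expected number `ν_{m,n}(u)` of rooted `m`-cliques at the point with radial coordinate
`u` and direction `θ`. -/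
def nu (d m : ℕ) (α : ℝ) (n : ℕ) (u : ℝ) (θ : Sph d) : ℝ≥0∞ :=
  poissonExpectation d α n fun S => (cliqueCount d m n S (point d n u θ) : ℝ≥0∞)

/-- The volume of the unit ball of `ℝ^(d-1)`. -/
def xi (d : ℕ) : ℝ := (volume : Measure (E (d - 1))).real (Metric.ball 0 1)

/-- The surface area of the unit ball of `ℝ^d`. -/
def sphereArea (d : ℕ) : ℝ := (volume : Measure (E d)).toSphere.real univ

/-- The integrand of `ell` at `t = (t_1, …, t_{m-1})`, where `t 0` stands for `t_1` and
`t i.succ`, `w i` with `i : Fin (m - 2)` for `t_{i+2}`, `w_{i+2}`. -/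
def ellIntegrand (d m : ℕ) (α : ℝ) (t : Fin (m - 2 + 1) → ℝ) : ℝ≥0∞ :=
  ENNReal.ofReal (Real.exp (((d : ℝ) - 1) * (1 - 2 * α) * t 0 / 2) *
      ∏ i : Fin (m - 2), Real.exp (-(α * ((d : ℝ) - 1) * t i.succ))) *
    (volume : Measure (Fin (m - 2) → E (d - 1)))
      {w | (∀ i, ‖w i‖ ≤ 2 * Real.exp ((t 0 + t i.succ) / 2)) ∧
        ∀ i j, ‖w i - w j‖ ≤ 2 * Real.exp ((t i.succ + t j.succ) / 2)}

/-- The function `ℓ(u)`: the integral over `0 ≤ t_1 ≤ … ≤ t_{m-1} ≤ u`. -/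
def ell (d m : ℕ) (α u : ℝ) : ℝ≥0∞ :=
  ∫⁻ t in {t : Fin (m - 2 + 1) → ℝ | Monotone t ∧ ∀ i, t i ∈ Icc 0 u}, ellIntegrand d m α t

/-- `ℓ(∞)`, the supremum and hence (see `tendsto_ell`) the limit of the increasing function
`ℓ`. -/
def ellInf (d m : ℕ) (α : ℝ) : ℝ≥0∞ := ⨆ u : ℝ, ell d m α u

theorem tendsto_ell (d m : ℕ) (α : ℝ) :
    Tendsto (ell d m α) atTop (𝓝 (ellInf d m α)) := by
  refine tendsto_atTop_iSup fun u v huv => ?_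
  exact lintegral_mono_set fun t ht => ⟨ht.1, fun i => ⟨(ht.2 i).1, (ht.2 i).2.trans huv⟩⟩

/-- The constant `2^(d-1) ξ_{d-1} (s_{d-1}⁻¹ α (d-1))^(m-1)`. -/
def K (d m : ℕ) (α : ℝ) : ℝ :=
  2 ^ (d - 1) * xi d * ((sphereArea d)⁻¹ * α * ((d : ℝ) - 1)) ^ (m - 1)

/-- The constant `C_{m,α}`. -/
def cliqueConst (d m : ℕ) (α : ℝ) : ℝ := K d m α * (ellInf d m α).toReal

/-- The function `ℓ'(u)` (the prime is not a derivative), with its parameter `δ`. -/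
def ellPrime (d m : ℕ) (α δ u : ℝ) : ℝ :=
  Real.exp (-(δ * u / 4)) +
    Real.exp ((((d : ℝ) - 1) * max ((m : ℝ) - 4 * α) 0 * (1 - δ) - δ) * u / 2) +
    Real.exp (((d : ℝ) - 1) * (2 * (m : ℝ) - 3 - (2 * (m : ℝ) - 2) * α) * (1 - δ) * u / 2)

end HRGG

end

/-!
By the Mecke formula for a Poisson process (with `N` Poisson distributed and i.i.d. points this is
the computation of its factorial moments), `ν` is `n ^ (m - 1)` times the probability that `m - 1`
independent vertices form an ordered clique with the root. Conditioning on the radial coordinates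
`t` turns it into an integral over the simplex `0 ≤ t_1 ≤ … ≤ t_{m-1} ≤ u` of the radial densities
times an angular probability (`nu_eq`).

* *Geometry.* Two points with radial coordinates `s`, `t` are within distance `R` iff their
  directions are within Euclidean distance `chord R s t` (`dH_point_le_iff`), and this chord is
  about `2 e^{(s+t-R)/2}`: uniformly so for `s, t ≤ γ R`, and up to a constant always, if it is
  capped at the diameter `2` of the sphere (`le_chord`, `chord_le_of_le`, `min_chord_two_le`).
* *Angles.* In the gnomonic chart around a direction, the uniform law on a small cap is close to
  normalized Lebesgue measure on `ℝ^{d-1}`, and distances are nearly preserved. So the directions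
  of the points after the first one, relative to that of the first, contribute the volume of the
  set of `w` in the definition of `ℓ`, scaled by `e^{-(d-1)R/2} = 1/n` for each point
  (`pi_angularLaw_starSet_le`, `le_pi_angularLaw_starSet`), and the direction of the first point
  contributes the area of a cap around the root.
* *Tails.* If the constraints between the points after the first one are dropped, the integrand
  becomes a product of exponentials, `starKernel`. Its integral over the tuples with a coordinate
  above `T` decays like `e^{(d-1)(2m-3-(2m-2)α)T/2}` (`exists_lintegral_starKernel_le`); this is
  where the lower bound on `α` enters. It gives `ℓ(∞) < ∞` and the crude bound `ν ≤ C e^{(d-1)u/2}`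
  (`exists_nu_le`), which is stronger than (iii) as `e^{ω_n}` is bounded below.
* *Sharp bounds.* Fix `T`. For radial coordinates at most `T` all approximations hold with an
  arbitrarily small relative error once `n` is large (`Approx`), and the integrand is at most
  `(1 + η) K e^{(d-1)u/2}` times that of `ℓ` (`integrand_le`); the tail above `T` is small, which
  gives (i). For (ii) the coordinates are moreover restricted to `t_i ≤ (1 - δ) u`. Then the points
  after the first one are, up to `e^{-δu/2}` relative to the admissible distance, at the same place
  as the first one when seen from the root, so that by the triangle inequality their constraints
  with the root hold as soon as the first point lies in a slightly smaller cap (`le_integrand`).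
  This costs a multiple of `e^{-δu/2}`, and replacing `ℓ(u)` by `ℓ((1 - δ) u)` costs the last term
  of `ℓ'(u)`.
-/

namespace HRGG

/-! ### Finite products of measures -/

theorem measure_pi_mono {ι : Type*} [Fintype ι] {β : ι → Type*} [∀ i, MeasurableSpace (β i)]
    {μ ν : ∀ i, Measure (β i)} (h : ∀ i, μ i ≤ ν i) : Measure.pi μ ≤ Measure.pi ν := by
  have key : OuterMeasure.pi (fun i => (μ i).toOuterMeasure) ≤
      OuterMeasure.pi (fun i => (ν i).toOuterMeasure) := by
    rw [OuterMeasure.le_pi]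
    intro s _
    refine (OuterMeasure.pi_pi_le _ s).trans ?_
    exact Finset.prod_le_prod' fun i _ => h i (s i)
  refine Measure.le_iff.2 fun s hs => ?_
  simp only [Measure.pi]
  rw [toMeasure_apply _ _ hs, toMeasure_apply _ _ hs]
  exact key s

theorem measure_pi_const_smul {ι β : Type*} [Fintype ι] [MeasurableSpace β] (μ : Measure β)
    [SigmaFinite μ] (c : ℝ≥0∞) (hc : c ≠ ∞) :
    Measure.pi (fun _ : ι => c • μ) = c ^ Fintype.card ι • Measure.pi (fun _ : ι => μ) := by
  have : SigmaFinite (c • μ) := by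
    lift c to ℝ≥0 using hc
    exact inferInstanceAs (SigmaFinite (c • μ))
  refine Measure.pi_eq fun s _ => ?_
  simp [Finset.prod_mul_distrib, Measure.pi_pi]

theorem lintegral_pi_fin_prod {β : Type*} [MeasurableSpace β] (n : ℕ) (μ : Fin n → Measure β)
    [∀ i, SigmaFinite (μ i)] (f : Fin n → β → ℝ≥0∞) (hf : ∀ i, Measurable (f i)) :
    ∫⁻ t, ∏ i, f i (t i) ∂(Measure.pi μ) = ∏ i, ∫⁻ x, f i x ∂(μ i) := by
  induction n with
  | zero => simp
  | succ n ih =>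
    rw [← ((measurePreserving_piFinSuccAbove μ 0).symm).lintegral_comp]
    · simp only [MeasurableEquiv.piFinSuccAbove_symm_apply, Fin.prod_univ_succ, Fin.zero_succAbove,
        Fin.insertNthEquiv_zero, Fin.consEquiv_apply, Fin.cons_zero, Fin.cons_succ]
      rw [lintegral_prod_mul (f := fun x => f 0 x)
        (g := fun t : Fin n → β => ∏ i, f i.succ (t i)) (hf 0).aemeasurable, ih]
      · exact fun i => hf i.succ
      · exact (Finset.measurable_fun_prod _
          fun i _ => (hf i.succ).comp (measurable_pi_apply i)).aemeasurable
    · exact Finset.measurable_fun_prod _ fun i _ => (hf i).comp (measurable_pi_apply i)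

theorem pi_withDensity_fin {β : Type*} [MeasurableSpace β] (n : ℕ) (μ : Measure β)
    [SigmaFinite μ] (f : β → ℝ≥0∞) (hf : Measurable f) [SigmaFinite (μ.withDensity f)] :
    Measure.pi (fun _ : Fin n => μ.withDensity f) =
      (Measure.pi fun _ : Fin n => μ).withDensity fun t => ∏ i, f (t i) := by
  refine Measure.pi_eq fun s hs => ?_
  rw [withDensity_apply _ (MeasurableSet.univ_pi hs), Measure.restrict_pi_pi,
    lintegral_pi_fin_prod n _ (fun _ => f) fun _ => hf]
  exact Finset.prod_congr rfl fun i _ => (withDensity_apply _ (hs i)).symm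

/-- Selecting coordinates along an injection pushes the power of a probability measure forward
to the power over the smaller index set. -/
theorem measurePreserving_comp_injective {β ι κ : Type*} [MeasurableSpace β] [Fintype ι]
    [Fintype κ] (μ : Measure β) [IsProbabilityMeasure μ] (σ : ι → κ)
    (hσ : Function.Injective σ) :
    MeasurePreserving (fun x : κ → β => x ∘ σ) (Measure.pi fun _ => μ)
      (Measure.pi fun _ => μ) := by
  have hm : Measurable (fun x : κ → β => x ∘ σ) :=
    measurable_pi_lambda _ fun i => measurable_pi_apply (σ i)
  refine ⟨hm, (Measure.pi_eq fun s hs => ?_).symm⟩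
  rw [Measure.map_apply hm (MeasurableSet.univ_pi hs)]
  have : (fun x : κ → β => x ∘ σ) ⁻¹' (univ.pi s) =
      univ.pi (Function.extend σ s fun _ => univ) := by
    ext x
    simp only [mem_preimage, Set.mem_pi, mem_univ, true_implies, Function.comp]
    constructor
    · intro h j
      by_cases hj : ∃ i, σ i = j
      · obtain ⟨i, rfl⟩ := hj
        rw [hσ.extend_apply]
        exact h i
      · rw [Function.extend_apply' _ _ _ hj]
        exact mem_univ _
    · intro h i
      have := h (σ i)
      rwa [hσ.extend_apply] at this
  rw [this, Measure.pi_pi]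
  symm
  refine Fintype.prod_of_injective σ hσ _ _ ?_ ?_
  · intro j hj
    rw [Function.extend_apply' _ _ _ hj, measure_univ]
  · intro i
    rw [hσ.extend_apply]

theorem ae_injective_pi {β ι : Type*} [MeasurableSpace β] [MeasurableEq β] [Fintype ι]
    (μ : Measure β) [IsProbabilityMeasure μ] [NullSingletonClass μ] :
    ∀ᵐ x ∂(Measure.pi fun _ : ι => μ), Function.Injective x := by
  have h2 : ∀ i j : ι, i ≠ j → ∀ᵐ x ∂(Measure.pi fun _ : ι => μ), x i ≠ x j := by
    intro i j hij
    have hσ : Function.Injective ![i, j] := by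
      intro a b
      fin_cases a <;> fin_cases b <;> simp [hij, hij.symm]
    have h3 : ∀ᵐ y ∂(Measure.pi fun _ : Fin 2 => μ), y 0 ≠ y 1 := by
      have h4 : ∀ᵐ z ∂(μ.prod μ), z.1 ≠ z.2 := by
        have hm : MeasurableSet {z : β × β | z.1 ≠ z.2} :=
          (measurableSet_eq_fun measurable_fst measurable_snd).compl
        rw [Measure.ae_prod_iff_ae_ae hm]
        refine Eventually.of_forall fun a => ?_
        have : ∀ᵐ b ∂μ, b ≠ a := by simp [ae_iff]
        exact this.mono fun b hb => hb.symm
      exact (measurePreserving_finTwoArrow μ).quasiMeasurePreserving.ae h4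
    have := (measurePreserving_comp_injective μ ![i, j] hσ).quasiMeasurePreserving.ae h3
    simpa using this
  have h3 : ∀ᵐ x ∂(Measure.pi fun _ : ι => μ), ∀ i j, i ≠ j → x i ≠ x j := by
    rw [ae_all_iff]; intro i
    rw [ae_all_iff]; intro j
    by_cases hij : i = j
    · simp [hij]
    · simpa [hij] using h2 i j hij
  filter_upwards [h3] with x hx i j hij
  by_contra hne
  exact hx i j hne hij

/-- The power of the law of `f (X, Y)` with `X`, `Y` independent, as an iterated integral. -/
theorem pi_map_prod_apply {β γ δ : Type*} [MeasurableSpace β] [MeasurableSpace γ]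
    [MeasurableSpace δ] {q : ℕ} (μ : Measure β) [IsProbabilityMeasure μ] (ν : Measure γ)
    [IsProbabilityMeasure ν] {f : β × γ → δ} (hf : Measurable f) {A : Set (Fin q → δ)}
    (hA : MeasurableSet A) :
    (Measure.pi (fun _ : Fin q => (μ.prod ν).map f) A =
      ∫⁻ t, Measure.pi (fun _ : Fin q => ν) {φ | (fun i => f (t i, φ i)) ∈ A}
        ∂(Measure.pi fun _ : Fin q => μ)) ∧
    Measurable fun t : Fin q → β =>
      Measure.pi (fun _ : Fin q => ν) {φ | (fun i => f (t i, φ i)) ∈ A} := by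
  have hm1 : Measurable fun (x : Fin q → β × γ) i => f (x i) :=
    measurable_pi_lambda _ fun i => hf.comp (measurable_pi_apply i)
  have hm2 : Measurable fun (z : (Fin q → β) × (Fin q → γ)) i => f (z.1 i, z.2 i) :=
    measurable_pi_lambda _ fun i => hf.comp
      (((measurable_pi_apply i).comp measurable_fst).prodMk
        ((measurable_pi_apply i).comp measurable_snd))
  have hp := Measure.isProbabilityMeasure_map (μ := μ.prod ν) hf.aemeasurable
  have h1 : (Measure.pi fun _ : Fin q => μ.prod ν).map (fun x i => f (x i)) =
      Measure.pi fun _ : Fin q => (μ.prod ν).map f :=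
    Measure.pi_map_pi fun _ => hf.aemeasurable
  have hBm : MeasurableSet ((fun (z : (Fin q → β) × (Fin q → γ)) i => f (z.1 i, z.2 i)) ⁻¹' A) :=
    hm2 hA
  have h2 := (measurePreserving_arrowProdEquivProdArrow β γ (Fin q)
    (fun _ => μ) fun _ => ν).measure_preimage hBm.nullMeasurableSet
  refine ⟨?_, measurable_measure_prodMk_left hBm⟩
  rw [← h1, Measure.map_apply hm1 hA]
  refine h2.trans ?_
  rw [Measure.prod_apply hBm]
  rfl

theorem pi_succ_apply {γ : Type*} [MeasurableSpace γ] {r : ℕ} (ν : Measure γ) [SigmaFinite ν]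
    {A : Set (γ × (Fin r → γ))} (hA : MeasurableSet A) :
    Measure.pi (fun _ : Fin (r + 1) => ν) {φ | (φ 0, fun i : Fin r => φ i.succ) ∈ A} =
      ∫⁻ e, Measure.pi (fun _ : Fin r => ν) (Prod.mk e ⁻¹' A) ∂ν := by
  have h := (measurePreserving_piFinSuccAbove (fun _ : Fin (r + 1) => ν)
    0).measure_preimage hA.nullMeasurableSet
  exact h.trans (Measure.prod_apply hA)

/-! ### The multivariate Mecke formula for a Poisson number of independent points -/

/-- The factorial moments of the Poisson distribution. -/
theorem lintegral_descFactorial_poissonMeasure (r : ℝ≥0) (q : ℕ) :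
    ∫⁻ k, (k.descFactorial q : ℝ≥0∞) ∂(ProbabilityTheory.poissonMeasure r) = (r : ℝ≥0∞) ^ q := by
  rw [ProbabilityTheory.poissonMeasure, lintegral_sum_measure]
  simp only [lintegral_smul_measure, lintegral_dirac, smul_eq_mul]
  have h1 : ∀ k : ℕ, ENNReal.ofReal (Real.exp (-r) * r ^ k / (k.factorial : ℝ)) *
      (k.descFactorial q : ℝ≥0∞) =
      ENNReal.ofReal (Real.exp (-r) * r ^ k / (k.factorial : ℝ) * k.descFactorial q) := by
    intro k
    rw [ENNReal.ofReal_mul (by positivity), ENNReal.ofReal_natCast]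
  simp only [h1]
  have hs := (ProbabilityTheory.hasSum_one_poissonMeasure r).mul_left ((r : ℝ) ^ q)
  have h2 : HasSum (fun k : ℕ => Real.exp (-r) * r ^ k / (k.factorial : ℝ) * k.descFactorial q)
      ((r : ℝ) ^ q) := by
    rw [← hasSum_nat_add_iff' q]
    have h0 : ∑ i ∈ Finset.range q, Real.exp (-r) * (r : ℝ) ^ i / (i.factorial : ℝ) *
        (i.descFactorial q : ℝ) = 0 := by
      refine Finset.sum_eq_zero fun i hi => ?_
      rw [Nat.descFactorial_of_lt (Finset.mem_range.1 hi)]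
      simp
    rw [h0, sub_zero]
    rw [mul_one] at hs
    refine Eq.mpr (congrArg (fun f => HasSum f _) (funext fun k => ?_)) hs
    have h3 : (k.factorial : ℝ) * ((k + q).descFactorial q : ℝ) = ((k + q).factorial : ℝ) := by
      have := Nat.factorial_mul_descFactorial (Nat.le_add_left q k)
      rw [Nat.add_sub_cancel] at this
      exact_mod_cast this
    have h4 : (k.factorial : ℝ) ≠ 0 := by positivity
    have h5 : ((k + q).factorial : ℝ) ≠ 0 := by positivity
    rw [pow_add]
    field_simp
    rw [← h3]
    ring
  rw [← ENNReal.ofReal_tsum_of_nonneg (fun k => by positivity) h2.summable, h2.tsum_eq,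
    ENNReal.ofReal_pow (NNReal.coe_nonneg r), ENNReal.ofReal_coe_nnreal]

/-- For an injective sample `x`, the injective tuples with entries in the range of `x` are
the selections `x ∘ σ` along injections `σ` of the index sets. -/
theorem encard_injective_tuples {β ι κ : Type*} [Fintype ι] [Fintype κ] (A : Set (ι → β))
    (x : κ → β) (hx : Function.Injective x) :
    ((({Y : ι → β | Function.Injective Y ∧ (∀ i, Y i ∈ range x) ∧ Y ∈ A}).encard : ℕ∞) : ℝ≥0∞) =
      ∑ σ : ι ↪ κ, A.indicator 1 (x ∘ σ) := by
  classical
  have h1 : {Y : ι → β | Function.Injective Y ∧ (∀ i, Y i ∈ range x) ∧ Y ∈ A} =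
      (fun σ : ι ↪ κ => x ∘ σ) '' {σ | x ∘ σ ∈ A} := by
    ext Y
    constructor
    · rintro ⟨hY, hr, hA⟩
      choose s hs using hr
      have hs' : x ∘ s = Y := funext hs
      have hinj : Function.Injective s := by
        intro a b hab
        apply hY
        rw [← hs a, ← hs b, hab]
      refine ⟨⟨s, hinj⟩, ?_, hs'⟩
      change x ∘ s ∈ A
      rwa [hs']
    · rintro ⟨σ, hσ, rfl⟩
      exact ⟨hx.comp σ.injective, fun i => ⟨σ i, rfl⟩, hσ⟩
  have hinj : Function.Injective (fun σ : ι ↪ κ => x ∘ σ) := by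
    intro σ τ h
    ext i
    exact hx (congrFun h i)
  rw [h1, hinj.encard_image, ← Finset.coe_filter_univ, Set.encard_coe_eq_coe_finsetCard]
  simp only [ENat.toENNReal_coe, Set.indicator_apply, Pi.one_apply, Finset.sum_boole]

/-- Multivariate Mecke formula: the expected number of injective `q`-tuples of points in `A`. -/
theorem lintegral_poisson_encard {β : Type*} [MeasurableSpace β] [MeasurableEq β]
    (μ : Measure β) [IsProbabilityMeasure μ] [NullSingletonClass μ] (r : ℝ≥0) (q : ℕ)
    (A : Set (Fin q → β)) (hA : MeasurableSet A) :
    ∫⁻ k, (∫⁻ x : Fin k → β,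
      ((({Y : Fin q → β | Function.Injective Y ∧ (∀ i, Y i ∈ range x) ∧ Y ∈ A}).encard : ℕ∞) :
        ℝ≥0∞) ∂(Measure.pi fun _ => μ)) ∂(ProbabilityTheory.poissonMeasure r) =
      (r : ℝ≥0∞) ^ q * Measure.pi (fun _ => μ) A := by
  have h1 : ∀ k : ℕ, ∫⁻ x : Fin k → β,
      ((({Y : Fin q → β | Function.Injective Y ∧ (∀ i, Y i ∈ range x) ∧ Y ∈ A}).encard : ℕ∞) :
        ℝ≥0∞) ∂(Measure.pi fun _ => μ) =
      (k.descFactorial q : ℝ≥0∞) * Measure.pi (fun _ => μ) A := by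
    intro k
    have hm : Measurable (A.indicator (1 : (Fin q → β) → ℝ≥0∞)) := measurable_one.indicator hA
    calc _ = ∫⁻ x : Fin k → β, ∑ σ : Fin q ↪ Fin k, A.indicator 1 (x ∘ σ)
            ∂(Measure.pi fun _ => μ) := by
          refine lintegral_congr_ae ?_
          filter_upwards [ae_injective_pi μ] with x hx
          exact encard_injective_tuples A x hx
      _ = ∑ σ : Fin q ↪ Fin k, ∫⁻ x : Fin k → β, A.indicator 1 (x ∘ σ)
            ∂(Measure.pi fun _ => μ) := by
          refine lintegral_finsetSum _ fun σ _ => ?_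
          exact hm.comp (measurePreserving_comp_injective μ σ σ.injective).measurable
      _ = ∑ σ : Fin q ↪ Fin k, Measure.pi (fun _ => μ) A := by
          refine Finset.sum_congr rfl fun σ _ => ?_
          rw [(measurePreserving_comp_injective μ σ σ.injective).lintegral_comp hm,
            lintegral_indicator_one hA]
      _ = _ := by
          rw [Finset.sum_const, Finset.card_univ, Fintype.card_embedding_eq, nsmul_eq_mul]
          simp
  simp only [h1]
  rw [lintegral_mul_const _ (measurable_of_countable _), lintegral_descFactorial_poissonMeasure]

/-! ### Distances in polar coordinates -/

theorem one_sub_tanh_sq (a : ℝ) : 1 - Real.tanh a ^ 2 = (Real.cosh a ^ 2)⁻¹ := by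
  have h := Real.cosh_pos a
  rw [Real.tanh_eq_sinh_div_cosh]
  field_simp
  linarith [Real.cosh_sq a]

theorem norm_tanh_smul_sub_sq {d : ℕ} (a b : ℝ) (θ θ' : Sph d) :
    ‖a • (θ : E d) - b • (θ' : E d)‖ ^ 2 = (a - b) ^ 2 + a * b * ‖(θ : E d) - θ'‖ ^ 2 := by
  have h1 : ‖(θ : E d)‖ = 1 := by simp
  have h2 : ‖(θ' : E d)‖ = 1 := by simp
  rw [norm_sub_sq_real, norm_sub_sq_real, norm_smul, norm_smul, real_inner_smul_left,
    real_inner_smul_right, h1, h2]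
  simp only [Real.norm_eq_abs, mul_one, sq_abs]
  ring

theorem norm_point_sq {d n : ℕ} (s : ℝ) (θ : Sph d) :
    ‖point d n s θ‖ ^ 2 = Real.tanh ((radius d n - s) / 2) ^ 2 := by
  rw [point, norm_smul]
  simp

/-- The hyperbolic law of cosines, with the angle expressed through the chord `‖θ - θ'‖`. -/
theorem dH_point {d n : ℕ} (s t : ℝ) (θ θ' : Sph d) :
    dH (point d n s θ) (point d n t θ') =
      Real.arcosh (Real.cosh (s - t) +
        Real.sinh (radius d n - s) * Real.sinh (radius d n - t) * ‖(θ : E d) - θ'‖ ^ 2 / 2) := by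
  rw [dH, norm_point_sq, norm_point_sq, one_sub_tanh_sq, one_sub_tanh_sq, point, point,
    norm_tanh_smul_sub_sq]
  congr 1
  set a := (radius d n - s) / 2
  set b := (radius d n - t) / 2
  have ha : radius d n - s = 2 * a := by simp only [a]; ring
  have hb : radius d n - t = 2 * b := by simp only [b]; ring
  have hst : s - t = 2 * (b - a) := by simp only [a, b]; ring
  rw [ha, hb, hst, Real.sinh_two_mul, Real.sinh_two_mul, Real.cosh_two_mul, Real.cosh_sub,
    Real.sinh_sub, Real.tanh_eq_sinh_div_cosh, Real.tanh_eq_sinh_div_cosh]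
  have h1 := Real.cosh_pos a
  have h2 := Real.cosh_pos b
  have h3 := Real.cosh_sq a
  have h4 := Real.cosh_sq b
  field_simp
  have h5 : Real.cosh a ^ 2 * Real.cosh b ^ 2 = (Real.sinh a ^ 2 + 1) * Real.cosh b ^ 2 := by
    rw [h3]
  nlinarith [h3, h4, h5]

theorem dH_zero_point {d n : ℕ} {s : ℝ} (hs : s ≤ radius d n) (θ : Sph d) :
    dH 0 (point d n s θ) = radius d n - s := by
  rw [dH, zero_sub, norm_neg, norm_point_sq, one_sub_tanh_sq]
  refine Eq.trans ?_ (Real.arcosh_cosh (sub_nonneg.2 hs))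
  congr 1
  set a := (radius d n - s) / 2
  have ha : radius d n - s = 2 * a := by simp only [a]; ring
  rw [ha, Real.cosh_two_mul, Real.tanh_eq_sinh_div_cosh]
  have h1 := Real.cosh_pos a
  have h3 := Real.cosh_sq a
  simp only [norm_zero]
  field_simp
  linarith

theorem height_point {d n : ℕ} {s : ℝ} (hs : s ≤ radius d n) (θ : Sph d) :
    height d n (point d n s θ) = s := by
  rw [height, dH_zero_point hs]
  ring

/-- The largest chord between the directions of two points with radial coordinates `s` and `t`
whose hyperbolic distance is at most `R`. The radicand is nonnegative for `s, t ∈ [0, R)`; the value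
may exceed the diameter `2` of the sphere, in which case there is no constraint. -/
noncomputable def chord (R s t : ℝ) : ℝ :=
  √(2 * (Real.cosh R - Real.cosh (s - t)) / (Real.sinh (R - s) * Real.sinh (R - t)))

theorem dH_point_le_iff {d n : ℕ} {s t : ℝ} (hs : s ∈ Ico 0 (radius d n))
    (ht : t ∈ Ico 0 (radius d n)) (θ θ' : Sph d) :
    dH (point d n s θ) (point d n t θ') ≤ radius d n ↔
      ‖(θ : E d) - θ'‖ ≤ chord (radius d n) s t := by
  set R := radius d n
  have hR : 0 ≤ R := hs.1.trans hs.2.le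
  have h1 : 0 < Real.sinh (R - s) := Real.sinh_pos_iff.2 (sub_pos.2 hs.2)
  have h2 : 0 < Real.sinh (R - t) := Real.sinh_pos_iff.2 (sub_pos.2 ht.2)
  have h3 : 0 < Real.sinh (R - s) * Real.sinh (R - t) := mul_pos h1 h2
  have h4 : Real.arcosh (Real.cosh R) = R := Real.arcosh_cosh hR
  have h5 : 0 < Real.cosh (s - t) +
      Real.sinh (R - s) * Real.sinh (R - t) * ‖(θ : E d) - θ'‖ ^ 2 / 2 := by
    have := Real.cosh_pos (s - t)
    positivity
  rw [dH_point]
  conv_lhs => rw [← h4]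
  rw [Real.arcosh_le_arcosh h5 (Real.cosh_pos _), chord, Real.le_sqrt (norm_nonneg _),
    le_div_iff₀ h3]
  · constructor <;> intro h <;> linarith
  · have h6 : Real.cosh (s - t) ≤ Real.cosh R := by
      rw [Real.cosh_le_cosh, abs_of_nonneg hR, abs_le]
      constructor <;> linarith [hs.1, hs.2, ht.1, ht.2]
    have := sub_nonneg.2 h6
    positivity

theorem chord_comm (R s t : ℝ) : chord R s t = chord R t s := by
  rw [chord, chord, ← Real.cosh_neg (s - t), neg_sub, mul_comm (Real.sinh (R - s))]

theorem chord_nonneg (R s t : ℝ) : 0 ≤ chord R s t := Real.sqrt_nonneg _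

theorem two_sinh_eq (x : ℝ) : 2 * Real.sinh x = Real.exp x * (1 - Real.exp (-(2 * x))) := by
  have h : Real.exp x * Real.exp (-(2 * x)) = Real.exp (-x) := by
    rw [← Real.exp_add]; congr 1; ring
  rw [Real.sinh_eq, mul_sub, h]; ring

/-- The chord in terms of its leading exponential term. -/
theorem chord_eq (R s t : ℝ) :
    chord R s t = 2 * Real.exp ((s + t - R) / 2) *
      √((1 + Real.exp (-(2 * R)) - Real.exp (s - t - R) - Real.exp (t - s - R)) /
        ((1 - Real.exp (-(2 * (R - s)))) * (1 - Real.exp (-(2 * (R - t)))))) := by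
  have h0 : (2 * Real.exp ((s + t - R) / 2)) = √(4 * Real.exp (s + t - R)) := by
    rw [show (4 : ℝ) * Real.exp (s + t - R) = (2 * Real.exp ((s + t - R) / 2)) ^ 2 by
      rw [mul_pow, ← Real.exp_nat_mul]; norm_num; ring]
    rw [Real.sqrt_sq (by positivity)]
  rw [h0, ← Real.sqrt_mul (by positivity), chord]
  congr 1
  have h1 : Real.sinh (R - s) * Real.sinh (R - t) =
      Real.exp (R - s) * Real.exp (R - t) *
        ((1 - Real.exp (-(2 * (R - s)))) * (1 - Real.exp (-(2 * (R - t))))) / 4 := by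
    have e1 := two_sinh_eq (R - s)
    have e2 := two_sinh_eq (R - t)
    calc Real.sinh (R - s) * Real.sinh (R - t) =
        (2 * Real.sinh (R - s)) * (2 * Real.sinh (R - t)) / 4 := by ring
      _ = _ := by rw [e1, e2]; ring
  have h2 : 2 * (Real.cosh R - Real.cosh (s - t)) = Real.exp R *
      (1 + Real.exp (-(2 * R)) - Real.exp (s - t - R) - Real.exp (t - s - R)) := by
    have e1 : Real.exp R * Real.exp (-(2 * R)) = Real.exp (-R) := by
      rw [← Real.exp_add]; congr 1; ring
    have e2 : Real.exp R * Real.exp (s - t - R) = Real.exp (s - t) := by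
      rw [← Real.exp_add]; congr 1; ring
    have e3 : Real.exp R * Real.exp (t - s - R) = Real.exp (-(s - t)) := by
      rw [← Real.exp_add]; congr 1; ring
    rw [mul_sub (Real.exp R), mul_sub (Real.exp R), mul_add (Real.exp R), e1, e2, e3,
      Real.cosh_eq, Real.cosh_eq]
    ring
  rw [h1, h2]
  have h3 : Real.exp R = Real.exp (s + t - R) * (Real.exp (R - s) * Real.exp (R - t)) := by
    rw [← Real.exp_add, ← Real.exp_add]; congr 1; ring
  rw [h3]
  have p1 := Real.exp_pos (R - s)
  have p2 := Real.exp_pos (R - t)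
  field_simp

theorem chord_le_of_le {R s t D : ℝ} (hD : 0 < D) (hs : s ∈ Icc 0 R) (ht : t ∈ Icc 0 R)
    (h1 : D ≤ 1 - Real.exp (-(2 * (R - s)))) (h2 : D ≤ 1 - Real.exp (-(2 * (R - t)))) :
    chord R s t ≤ 2 * Real.exp ((s + t - R) / 2) / D := by
  rw [chord_eq]
  have h : √((1 + Real.exp (-(2 * R)) - Real.exp (s - t - R) - Real.exp (t - s - R)) /
        ((1 - Real.exp (-(2 * (R - s)))) * (1 - Real.exp (-(2 * (R - t)))))) ≤ 1 / D := by
    rw [Real.sqrt_le_left (by positivity), div_pow, one_pow]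
    have h3 : Real.exp (-(2 * R)) ≤ Real.exp (s - t - R) :=
      Real.exp_le_exp.2 (by linarith [hs.1, ht.2])
    have h4 := Real.exp_pos (t - s - R)
    have h5 : D ^ 2 ≤ (1 - Real.exp (-(2 * (R - s)))) * (1 - Real.exp (-(2 * (R - t)))) := by
      rw [sq]; exact mul_le_mul h1 h2 hD.le (hD.le.trans h1)
    exact div_le_div₀ zero_le_one (by linarith) (by positivity) h5
  calc _ ≤ 2 * Real.exp ((s + t - R) / 2) * (1 / D) := by gcongr
    _ = _ := by ring

theorem le_chord {R s t : ℝ} {c : ℝ} (hs : s ∈ Ico 0 R) (ht : t ∈ Ico 0 R)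
    (h1 : s - t - R ≤ -c) (h2 : t - s - R ≤ -c) :
    (1 - 2 * Real.exp (-c)) * (2 * Real.exp ((s + t - R) / 2)) ≤ chord R s t := by
  rw [chord_eq, mul_comm]
  refine mul_le_mul_of_nonneg_left ?_ (by positivity)
  set N := 1 + Real.exp (-(2 * R)) - Real.exp (s - t - R) - Real.exp (t - s - R)
  have hN : 1 - 2 * Real.exp (-c) ≤ N := by
    have := Real.exp_le_exp.2 h1
    have := Real.exp_le_exp.2 h2
    have := Real.exp_pos (-(2 * R))
    simp only [N]; linarith
  have hN1 : N ≤ 1 := by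
    have h3 : Real.exp (-(2 * R)) ≤ Real.exp (s - t - R) :=
      Real.exp_le_exp.2 (by linarith [hs.1, ht.2])
    have h4 := Real.exp_pos (t - s - R)
    simp only [N]; linarith
  rcases le_or_gt (1 - 2 * Real.exp (-c)) 0 with h | h
  · exact h.trans (Real.sqrt_nonneg _)
  · refine hN.trans ?_
    have hN0 : 0 < N := h.trans_le hN
    have e1 : Real.exp (-(2 * (R - s))) < 1 := Real.exp_lt_one_iff.2 (by linarith [hs.2])
    have e2 : Real.exp (-(2 * (R - t))) < 1 := Real.exp_lt_one_iff.2 (by linarith [ht.2])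
    have e3 := Real.exp_pos (-(2 * (R - s)))
    have e4 := Real.exp_pos (-(2 * (R - t)))
    have e5 : (1 - Real.exp (-(2 * (R - s)))) * (1 - Real.exp (-(2 * (R - t)))) ≤ 1 :=
      mul_le_one₀ (by linarith) (by linarith) (by linarith)
    have e6 : 0 < (1 - Real.exp (-(2 * (R - s)))) * (1 - Real.exp (-(2 * (R - t)))) :=
      mul_pos (by linarith) (by linarith)
    refine Real.le_sqrt_of_sq_le ?_
    calc N ^ 2 ≤ N := by nlinarith
      _ ≤ _ := by rw [le_div_iff₀ e6]; nlinarith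

/-- A bound on chords without restriction on the radial coordinates: when one of the points is
within distance `1` of the origin, the right-hand side exceeds the diameter of the sphere. -/
theorem min_chord_two_le {R s t : ℝ} (hs : s ∈ Ico 0 R) (ht : t ∈ Ico 0 R) :
    min (chord R s t) 2 ≤ 4 * Real.exp ((s + t - R) / 2) := by
  have e2 : Real.exp (-1) ≤ 1 / 2 := by
    have := Real.exp_neg_one_lt_half; linarith
  have e3 : (1 : ℝ) / 2 ≤ Real.exp (-(1 / 2)) := by
    have := Real.add_one_le_exp (-(1 / 2) : ℝ); linarith
  by_cases h : s ≤ R - 1 ∧ t ≤ R - 1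
  · refine (min_le_left _ _).trans ?_
    have hb : ∀ x, x ≤ R - 1 → (1 : ℝ) / 2 ≤ 1 - Real.exp (-(2 * (R - x))) := by
      intro x hx
      have : Real.exp (-(2 * (R - x))) ≤ Real.exp (-1) := Real.exp_le_exp.2 (by linarith)
      linarith
    have := chord_le_of_le (by norm_num : (0 : ℝ) < 1 / 2) ⟨hs.1, hs.2.le⟩ ⟨ht.1, ht.2.le⟩
      (hb s h.1) (hb t h.2)
    refine this.trans (le_of_eq (by ring))
  · refine (min_le_right _ _).trans ?_
    have : -(1 / 2) ≤ (s + t - R) / 2 := by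
      by_contra hc
      push Not at hc
      exact h ⟨by linarith [ht.1], by linarith [hs.1]⟩
    have := Real.exp_le_exp.2 this
    linarith

/-! ### Gnomonic charts of the sphere -/

/-- Linear coordinates `(h, y)` on `ℝ^(k+1)` in which a prescribed unit vector is the first basis
vector. -/
structure Frame {k : ℕ} (e : Sph (k + 1)) where
  /-- The coordinate isomorphism. -/
  M : (ℝ × E k) ≃ₗ[ℝ] E (k + 1)
  inner_M : ∀ p q, inner ℝ (M p) (M q) = p.1 * q.1 + inner ℝ p.2 q.2
  M_one : M (1, 0) = e
  mp : MeasurePreserving M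

theorem nonempty_frame {k : ℕ} (e : Sph (k + 1)) : Nonempty (Frame e) := by
  obtain ⟨b, hb⟩ := Orthonormal.exists_orthonormalBasis_extension_of_card_eq
    (ι := Fin (k + 1)) (𝕜 := ℝ) (E := E (k + 1)) (by simp) (v := fun _ => (e : E (k + 1)))
    (s := {0}) (by
      rw [orthonormal_iff_ite]
      rintro ⟨i, hi⟩ ⟨j, hj⟩
      simp only [mem_singleton_iff] at hi hj
      subst hi hj
      simp)
  have hb0 : b 0 = e := hb 0 rfl
  let M : (ℝ × E k) ≃ₗ[ℝ] E (k + 1) :=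
    ((LinearEquiv.refl ℝ ℝ).prodCongr (WithLp.linearEquiv 2 ℝ (Fin k → ℝ))) ≪≫ₗ
      (Fin.consLinearEquiv ℝ (fun _ : Fin (k + 1) => ℝ)) ≪≫ₗ
      (WithLp.linearEquiv 2 ℝ (Fin (k + 1) → ℝ)).symm ≪≫ₗ b.repr.symm.toLinearEquiv
  have hM : ∀ p, M p = b.repr.symm (WithLp.toLp 2 (Fin.cons p.1 p.2.ofLp : Fin (k + 1) → ℝ)) :=
    fun p => rfl
  refine ⟨⟨M, ?_, ?_, ?_⟩⟩
  · intro p q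
    rw [hM, hM, LinearIsometryEquiv.inner_map_map, PiLp.inner_apply, Fin.sum_univ_succ,
      PiLp.inner_apply]
    simp [mul_comm]
  · rw [hM, ← hb0, ← b.repr_symm_single]
    congr 1
    ext i
    refine Fin.cases ?_ (fun j => ?_) i <;> simp
  · have h1 : MeasurePreserving (Prod.map id WithLp.ofLp : ℝ × E k → ℝ × (Fin k → ℝ)) :=
      (MeasurePreserving.id volume).prod (PiLp.volume_preserving_ofLp (Fin k))
    have h2 := (volume_preserving_piFinSuccAbove (fun _ : Fin (k + 1) => ℝ) 0).symm
    have h3 := PiLp.volume_preserving_toLp (Fin (k + 1))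
    have h4 := b.repr.symm.measurePreserving
    have h5 := h4.comp (h3.comp (h2.comp h1))
    convert h5 using 1
    ext1 p
    rw [hM]
    simp only [Function.comp, MeasurableEquiv.piFinSuccAbove_symm_apply, Fin.insertNthEquiv_zero]
    rfl

namespace Frame

variable {k : ℕ} {e : Sph (k + 1)} (F : Frame e)

theorem norm_M_sq (p : ℝ × E k) : ‖F.M p‖ ^ 2 = p.1 ^ 2 + ‖p.2‖ ^ 2 := by
  rw [← real_inner_self_eq_norm_sq, F.inner_M, real_inner_self_eq_norm_sq, sq, sq]

theorem inner_e (p : ℝ × E k) : inner ℝ (e : E (k + 1)) (F.M p) = p.1 := by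
  rw [← F.M_one, F.inner_M]
  simp

theorem one_le_norm (w : E k) : 1 ≤ ‖F.M (1, w)‖ := by
  have h := F.norm_M_sq (1, w)
  simp only at h
  nlinarith [norm_nonneg (F.M (1, w)), sq_nonneg ‖w‖]

theorem norm_le (w : E k) : ‖F.M (1, w)‖ ≤ 1 + ‖w‖ := by
  have h := F.norm_M_sq (1, w)
  simp only at h
  nlinarith [norm_nonneg (F.M (1, w)), norm_nonneg w]

/-- The inverse of the central projection of a hemisphere onto the tangent space at its
pole. -/
noncomputable def psi (w : E k) : Sph (k + 1) :=
  ⟨(‖F.M (1, w)‖)⁻¹ • F.M (1, w), by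
    have := F.one_le_norm w
    rw [mem_sphere_zero_iff_norm, norm_smul, norm_inv, norm_norm, inv_mul_cancel₀ (by linarith)]⟩

theorem coe_psi (w : E k) : (F.psi w : E (k + 1)) = (‖F.M (1, w)‖)⁻¹ • F.M (1, w) := rfl

theorem smul_psi (w : E k) : ‖F.M (1, w)‖ • (F.psi w : E (k + 1)) = F.M (1, w) := by
  have := F.one_le_norm w
  rw [coe_psi, smul_smul, mul_inv_cancel₀ (by linarith), one_smul]

theorem continuous_psi : Continuous F.psi := by
  have h1 : Continuous (fun w : E k => F.M (1, w)) :=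
    (F.M : (ℝ × E k) →ₗ[ℝ] E (k + 1)).continuous_of_finiteDimensional.comp (by fun_prop)
  refine Continuous.subtype_mk (Continuous.smul (Continuous.inv₀ h1.norm ?_) h1) _
  intro w
  have := F.one_le_norm w
  linarith

theorem psi_zero : F.psi 0 = e := by
  ext1
  rw [coe_psi, F.M_one]
  simp

/-- Radial projection onto the unit sphere is a contraction outside the unit ball. -/
theorem norm_psi_sub_le (w w' : E k) :
    ‖(F.psi w : E (k + 1)) - F.psi w'‖ ≤ ‖w - w'‖ := by
  have h1 : ‖w - w'‖ = ‖F.M (1, w) - F.M (1, w')‖ := by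
    rw [← sq_eq_sq₀ (norm_nonneg _) (norm_nonneg _), ← map_sub, F.norm_M_sq]
    simp
  rw [h1]
  have ha := F.one_le_norm w
  have hb := F.one_le_norm w'
  have hx := F.smul_psi w
  have hy := F.smul_psi w'
  set a := ‖F.M (1, w)‖
  set b := ‖F.M (1, w')‖
  rw [← hx, ← hy]
  refine (sq_le_sq₀ (norm_nonneg _) (norm_nonneg _)).1 ?_
  have hab : 1 ≤ a * b := by nlinarith
  have hc : inner ℝ (F.psi w : E (k + 1)) (F.psi w') ≤ 1 := by
    have := real_inner_le_norm (F.psi w : E (k + 1)) (F.psi w')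
    simpa using this
  rw [norm_tanh_smul_sub_sq]
  have h2 := norm_sub_sq_real (F.psi w : E (k + 1)) (F.psi w')
  have h3 : ‖(F.psi w : E (k + 1))‖ = 1 := by simp
  have h4 : ‖(F.psi w' : E (k + 1))‖ = 1 := by simp
  nlinarith [sq_nonneg (a - b), sq_nonneg ‖(F.psi w : E (k + 1)) - F.psi w'‖]

/-- Every point of the open hemisphere is in the range of the chart. -/
theorem exists_of_inner_pos (θ : Sph (k + 1)) (hθ : 0 < inner ℝ (e : E (k + 1)) (θ : E (k + 1))) :
    ∃ y : E k, F.M (inner ℝ (e : E (k + 1)) (θ : E (k + 1)), y) = θ ∧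
      F.psi ((inner ℝ (e : E (k + 1)) (θ : E (k + 1)))⁻¹ • y) = θ := by
  set a := inner ℝ (e : E (k + 1)) (θ : E (k + 1)) with ha
  obtain ⟨p, hp⟩ := F.M.surjective (θ : E (k + 1))
  have hp1 : a = p.1 := by rw [ha, ← hp, F.inner_e]
  refine ⟨p.2, by rw [hp1, ← hp], ?_⟩
  have h1 : F.M (1, a⁻¹ • p.2) = a⁻¹ • (θ : E (k + 1)) := by
    rw [← hp, ← map_smul]
    congr 1
    ext1
    · simp [← hp1, hθ.ne']
    · rfl
  ext1
  rw [coe_psi, h1, norm_smul, smul_smul]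
  have : ‖(θ : E (k + 1))‖ = 1 := by simp
  rw [this, mul_one, norm_inv, Real.norm_of_nonneg hθ.le, inv_inv, mul_inv_cancel₀ hθ.ne',
    one_smul]

theorem inner_eq (θ : Sph (k + 1)) :
    inner ℝ (e : E (k + 1)) (θ : E (k + 1)) = 1 - ‖(θ : E (k + 1)) - e‖ ^ 2 / 2 := by
  have h2 := norm_sub_sq_real (θ : E (k + 1)) e
  have h3 : ‖(θ : E (k + 1))‖ = 1 := by simp
  have h4 : ‖(e : E (k + 1))‖ = 1 := by simp
  rw [real_inner_comm, h2, h3, h4]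
  ring

theorem inner_psi (w : E k) :
    inner ℝ (e : E (k + 1)) (F.psi w : E (k + 1)) = (‖F.M (1, w)‖)⁻¹ := by
  rw [coe_psi, real_inner_smul_right, F.inner_e, mul_one]

/-- The chart distorts distances in a cap of radius `ρ` by at most the factor `(1 - ρ)⁻²`. -/
theorem norm_sub_le {ρ : ℝ} (hρ : ρ < 1) {w w' : E k}
    (h : ‖(F.psi w : E (k + 1)) - e‖ ≤ ρ) (h' : ‖(F.psi w' : E (k + 1)) - e‖ ≤ ρ) :
    ‖w - w'‖ ≤ ((1 - ρ) ^ 2)⁻¹ * ‖(F.psi w : E (k + 1)) - F.psi w'‖ := by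
  have hρ0 : 0 ≤ ρ := (norm_nonneg _).trans h
  have h1 : ‖w - w'‖ = ‖F.M (1, w) - F.M (1, w')‖ := by
    rw [← sq_eq_sq₀ (norm_nonneg _) (norm_nonneg _), ← map_sub, F.norm_M_sq]
    simp
  have hx := F.smul_psi w
  have hy := F.smul_psi w'
  have ia := F.inner_psi w
  have ib := F.inner_psi w'
  have ha1 := F.one_le_norm w
  have hb1 := F.one_le_norm w'
  rw [inner_eq] at ia ib
  rw [h1, ← hx, ← hy]
  generalize ‖F.M (1, w)‖ = a at *
  generalize ‖F.M (1, w')‖ = b at *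
  generalize F.psi w = θ at *
  generalize F.psi w' = θ' at *
  set x := ‖(θ : E (k + 1)) - e‖ with hx'
  set y := ‖(θ' : E (k + 1)) - e‖ with hy'
  have hx0 : 0 ≤ x := norm_nonneg _
  have hy0 : 0 ≤ y := norm_nonneg _
  have hxy : |x - y| ≤ ‖(θ : E (k + 1)) - θ'‖ := by
    have := abs_norm_sub_norm_le ((θ : E (k + 1)) - e) (θ' - e)
    simpa using this
  set z := ‖(θ : E (k + 1)) - θ'‖ with hz
  have hz0 : 0 ≤ z := norm_nonneg _
  have hρ1 : 0 < 1 - ρ := by linarith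
  have hainv : 1 - ρ ≤ a⁻¹ := by rw [← ia]; nlinarith
  have hbinv : 1 - ρ ≤ b⁻¹ := by rw [← ib]; nlinarith
  have ha : a ≤ (1 - ρ)⁻¹ := by
    rw [le_inv_comm₀ (by linarith) hρ1]; exact hainv
  have hb : b ≤ (1 - ρ)⁻¹ := by
    rw [le_inv_comm₀ (by linarith) hρ1]; exact hbinv
  have hab : |a - b| ≤ (1 - ρ)⁻¹ * (1 - ρ)⁻¹ * (z * ρ) := by
    have e1 : a - b = a * b * (b⁻¹ - a⁻¹) := by field_simp
    have e2 : |b⁻¹ - a⁻¹| ≤ z * ρ := by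
      rw [← ia, ← ib]
      have : (1 - y ^ 2 / 2 - (1 - x ^ 2 / 2)) = (x - y) * ((x + y) / 2) := by ring
      rw [this, abs_mul, abs_of_nonneg (by positivity : 0 ≤ (x + y) / 2)]
      exact mul_le_mul hxy (by linarith) (by positivity) hz0
    rw [e1, abs_mul, abs_of_nonneg (by positivity : 0 ≤ a * b)]
    gcongr
  calc ‖a • (θ : E (k + 1)) - b • (θ' : E (k + 1))‖
      = ‖a • ((θ : E (k + 1)) - θ') + (a - b) • (θ' : E (k + 1))‖ := by
        congr 1; rw [smul_sub, sub_smul]; abel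
    _ ≤ ‖a • ((θ : E (k + 1)) - θ')‖ + ‖(a - b) • (θ' : E (k + 1))‖ := norm_add_le _ _
    _ = a * z + |a - b| := by
        rw [norm_smul, norm_smul, Real.norm_of_nonneg (by linarith)]
        simp [hz]
    _ ≤ (1 - ρ)⁻¹ * z + (1 - ρ)⁻¹ * (1 - ρ)⁻¹ * (z * ρ) := by gcongr
    _ = ((1 - ρ) ^ 2)⁻¹ * z := by
        field_simp
        ring

theorem volume_cone {W : Set (E k)} (hW : MeasurableSet W) {c : ℝ} (hc : 0 ≤ c) :
    volume {p : ℝ × E k | p.1 ∈ Ioo 0 c ∧ p.1⁻¹ • p.2 ∈ W} =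
      ENNReal.ofReal (c ^ (k + 1) / (k + 1)) * volume W := by
  have hm : MeasurableSet {p : ℝ × E k | p.1 ∈ Ioo 0 c ∧ p.1⁻¹ • p.2 ∈ W} := by
    refine (measurable_fst measurableSet_Ioo).inter ?_
    have : Measurable (fun p : ℝ × E k => p.1⁻¹ • p.2) := by fun_prop
    exact this hW
  rw [Measure.volume_eq_prod, Measure.prod_apply hm]
  have h1 : ∀ h : ℝ, volume (Prod.mk h ⁻¹' {p : ℝ × E k | p.1 ∈ Ioo 0 c ∧ p.1⁻¹ • p.2 ∈ W}) =
      (Ioo 0 c).indicator (fun h => ENNReal.ofReal (h ^ k) * volume W) h := by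
    intro h
    by_cases hh : h ∈ Ioo 0 c
    · rw [indicator_of_mem hh]
      have : Prod.mk h ⁻¹' {p : ℝ × E k | p.1 ∈ Ioo 0 c ∧ p.1⁻¹ • p.2 ∈ W} =
          (fun y => h⁻¹ • y) ⁻¹' W := by
        ext y; simp [hh.1, hh.2]
      rw [this, Measure.addHaar_preimage_smul _ (inv_ne_zero hh.1.ne')]
      congr 2
      simp [abs_of_pos hh.1]
    · rw [indicator_of_notMem hh]
      have : Prod.mk h ⁻¹' {p : ℝ × E k | p.1 ∈ Ioo 0 c ∧ p.1⁻¹ • p.2 ∈ W} = ∅ := by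
        ext y
        simp only [mem_preimage, mem_ofPred_eq, mem_empty_iff_false, iff_false]
        exact fun hy => hh hy.1
      rw [this, measure_empty]
  simp only [h1]
  rw [lintegral_indicator measurableSet_Ioo, lintegral_mul_const _ (by fun_prop)]
  congr 1
  rw [Measure.restrict_congr_set Ioo_ae_eq_Ioc, ← ofReal_integral_eq_lintegral_ofReal,
    ← intervalIntegral.integral_of_le hc]
  · simp
  · exact (intervalIntegral.intervalIntegrable_pow k).1
  · filter_upwards [ae_restrict_mem measurableSet_Ioc] with y hy
    exact pow_nonneg hy.1.le _

theorem measurableEmbedding_M : MeasurableEmbedding F.M :=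
  F.M.toContinuousLinearEquiv.toHomeomorph.measurableEmbedding

open scoped Pointwise in
/-- The chart does not decrease volume: the cone over `S` truncated at the unit sphere is
contained in the cone truncated at the tangent space. -/
theorem toSphere_le {S : Set (Sph (k + 1))} (hS : MeasurableSet S)
    (hS' : ∀ θ ∈ S, 0 < inner ℝ (e : E (k + 1)) (θ : E (k + 1))) :
    (volume : Measure (E (k + 1))).toSphere S ≤ volume (F.psi ⁻¹' S) := by
  have hW : MeasurableSet (F.psi ⁻¹' S) := F.continuous_psi.measurable hS
  have hsub : F.M ⁻¹' (Ioo (0 : ℝ) 1 • (Subtype.val '' S)) ⊆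
      {p : ℝ × E k | p.1 ∈ Ioo 0 1 ∧ p.1⁻¹ • p.2 ∈ F.psi ⁻¹' S} := by
    rintro p ⟨r, hr, _, ⟨θ, hθ, rfl⟩, hp⟩
    have ha := hS' θ hθ
    obtain ⟨y, hy1, hy2⟩ := F.exists_of_inner_pos θ ha
    have ha1 : inner ℝ (e : E (k + 1)) (θ : E (k + 1)) ≤ 1 := by
      have := real_inner_le_norm (e : E (k + 1)) θ
      simpa using this
    set a := inner ℝ (e : E (k + 1)) (θ : E (k + 1))
    have hp' : p = r • (a, y) := by
      apply F.M.injective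
      rw [map_smul, hy1]
      exact hp.symm
    subst hp'
    refine ⟨⟨?_, ?_⟩, ?_⟩
    · simpa using mul_pos hr.1 ha
    · have : r * a < 1 := by nlinarith [hr.1, hr.2]
      simpa using this
    · change F.psi ((r * a)⁻¹ • r • y) ∈ S
      rw [smul_smul, mul_inv_rev, mul_assoc, inv_mul_cancel₀ hr.1.ne', mul_one, hy2]
      exact hθ
  rw [Measure.toSphere_apply' _ hS, ← F.mp.measure_preimage_emb F.measurableEmbedding_M]
  calc _ ≤ (Module.finrank ℝ (E (k + 1)) : ℝ≥0∞) *
        volume {p : ℝ × E k | p.1 ∈ Ioo 0 1 ∧ p.1⁻¹ • p.2 ∈ F.psi ⁻¹' S} := by gcongr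
    _ = ENNReal.ofReal ((k + 1 : ℝ) * (1 / (k + 1))) * volume (F.psi ⁻¹' S) := by
        rw [volume_cone hW zero_le_one, ← mul_assoc, ENNReal.ofReal_mul (by positivity)]
        congr 2
        · rw [finrank_euclideanSpace_fin, ← Nat.cast_succ, ENNReal.ofReal_natCast]
        · simp
    _ = _ := by
        rw [mul_one_div_cancel (by positivity)]
        simp

open scoped Pointwise in
/-- The cone over `S` truncated at height `(1 + ρ)⁻¹` lies in the unit ball, if `S` is in the image
of the ball of radius `ρ`. -/
theorem le_toSphere {S : Set (Sph (k + 1))} (hS : MeasurableSet S) {ρ : ℝ} (hρ : 0 ≤ ρ) :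
    ENNReal.ofReal (((1 + ρ)⁻¹) ^ (k + 1)) * volume (F.psi ⁻¹' S ∩ Metric.closedBall 0 ρ) ≤
      (volume : Measure (E (k + 1))).toSphere S := by
  have hW : MeasurableSet (F.psi ⁻¹' S ∩ Metric.closedBall 0 ρ) :=
    (F.continuous_psi.measurable hS).inter measurableSet_closedBall
  have hsub : {p : ℝ × E k | p.1 ∈ Ioo 0 ((1 + ρ)⁻¹) ∧
      p.1⁻¹ • p.2 ∈ F.psi ⁻¹' S ∩ Metric.closedBall 0 ρ} ⊆
      F.M ⁻¹' (Ioo (0 : ℝ) 1 • (Subtype.val '' S)) := by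
    rintro ⟨h, y⟩ ⟨hh, hy, hyρ⟩
    simp only at hh hy hyρ
    have h1 := F.one_le_norm (h⁻¹ • y)
    have h2 := F.norm_le (h⁻¹ • y)
    rw [mem_closedBall_zero_iff] at hyρ
    refine ⟨h * ‖F.M (1, h⁻¹ • y)‖, ⟨mul_pos hh.1 (by linarith), ?_⟩, _, ⟨_, hy, rfl⟩, ?_⟩
    · calc h * ‖F.M (1, h⁻¹ • y)‖ ≤ h * (1 + ρ) := by
            have := hh.1
            gcongr
            linarith
        _ < (1 + ρ)⁻¹ * (1 + ρ) := by
            have := hh.2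
            gcongr
        _ = 1 := inv_mul_cancel₀ (by positivity)
    · change (h * ‖F.M (1, h⁻¹ • y)‖) • (F.psi (h⁻¹ • y) : E (k + 1)) = F.M (h, y)
      rw [mul_smul, F.smul_psi, ← map_smul]
      congr 1
      ext1
      · simp
      · simp [smul_smul, mul_inv_cancel₀ hh.1.ne']
  rw [Measure.toSphere_apply' _ hS, ← F.mp.measure_preimage_emb F.measurableEmbedding_M]
  calc _ = (Module.finrank ℝ (E (k + 1)) : ℝ≥0∞) *
        volume {p : ℝ × E k | p.1 ∈ Ioo 0 ((1 + ρ)⁻¹) ∧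
          p.1⁻¹ • p.2 ∈ F.psi ⁻¹' S ∩ Metric.closedBall 0 ρ} := by
        rw [volume_cone hW (by positivity), ← mul_assoc, finrank_euclideanSpace_fin,
          ← ENNReal.ofReal_natCast, ← ENNReal.ofReal_mul (by positivity)]
        congr 2
        push_cast
        field_simp
    _ ≤ _ := by gcongr

end Frame

theorem sphereArea_pos (k : ℕ) : 0 < sphereArea (k + 1) := by
  rw [sphereArea, Measure.toSphere_real_apply_univ, finrank_euclideanSpace_fin]
  have : 0 < (volume : Measure (E (k + 1))).real (Metric.ball 0 1) :=
    ENNReal.toReal_pos (Metric.measure_ball_pos _ _ one_pos).ne' measure_ball_lt_top.ne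
  positivity

theorem angularLaw_eq (k : ℕ) : angularLaw (k + 1) =
    ENNReal.ofReal ((sphereArea (k + 1))⁻¹) • (volume : Measure (E (k + 1))).toSphere := by
  rw [angularLaw, ENNReal.ofReal_inv_of_pos (sphereArea_pos k), sphereArea, measureReal_def,
    ENNReal.ofReal_toReal (measure_ne_top _ _)]

instance isProbabilityMeasure_angularLaw (k : ℕ) : IsProbabilityMeasure (angularLaw (k + 1)) := by
  refine ⟨?_⟩
  rw [angularLaw, Measure.smul_apply, smul_eq_mul]
  refine ENNReal.inv_mul_cancel ?_ (measure_ne_top _ _)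
  have := sphereArea_pos k
  rw [sphereArea, measureReal_def] at this
  exact (ENNReal.toReal_pos_iff.1 this).1.ne'

theorem pi_angularLaw (k r : ℕ) : Measure.pi (fun _ : Fin r => angularLaw (k + 1)) =
    ENNReal.ofReal ((sphereArea (k + 1))⁻¹) ^ r •
      Measure.pi (fun _ : Fin r => (volume : Measure (E (k + 1))).toSphere) := by
  simp only [angularLaw_eq]
  rw [measure_pi_const_smul _ _ ENNReal.ofReal_ne_top, Fintype.card_fin]

/-- The directions `θ i` within distance `a i` of `e`, with mutual distances at most `b i j`. -/
def starSet {F ι : Type*} [SeminormedAddCommGroup F] (e : F) (a : ι → ℝ) (b : ι → ι → ℝ) :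
    Set (ι → F) :=
  {w | (∀ i, ‖w i - e‖ ≤ a i) ∧ ∀ i j, ‖w i - w j‖ ≤ b i j}

theorem measurableSet_starSet {k r : ℕ} (e : E k) (a : Fin r → ℝ) (b : Fin r → Fin r → ℝ) :
    MeasurableSet (starSet e a b) := by
  have : IsClosed (starSet e a b) := by
    have : starSet e a b = (⋂ i, {w | ‖w i - e‖ ≤ a i}) ∩ ⋂ i, ⋂ j, {w | ‖w i - w j‖ ≤ b i j} := by
      ext w; simp [starSet]
    rw [this]
    refine (isClosed_iInter fun i => ?_).inter (isClosed_iInter fun i => isClosed_iInter fun j => ?_)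
    · exact isClosed_le (by fun_prop) continuous_const
    · exact isClosed_le (by fun_prop) continuous_const
  exact this.measurableSet

theorem measurable_coe_pi (k r : ℕ) :
    Measurable (fun (θ : Fin r → Sph (k + 1)) i => (θ i : E (k + 1))) :=
  measurable_pi_lambda _ fun i => measurable_subtype_coe.comp (measurable_pi_apply i)

/-- Joint angular constraints in a small cap, bounded above by the constraints in the tangent
space. -/
theorem pi_angularLaw_starSet_le {k r : ℕ} (e : Sph (k + 1)) {ρ : ℝ} (hρ0 : 0 ≤ ρ) (hρ : ρ < 1)
    (a : Fin r → ℝ) (b : Fin r → Fin r → ℝ) (ha : ∀ i, a i ≤ ρ) :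
    Measure.pi (fun _ : Fin r => angularLaw (k + 1))
        {θ | (fun i => (θ i : E (k + 1))) ∈ starSet (e : E (k + 1)) a b} ≤
      ENNReal.ofReal ((sphereArea (k + 1))⁻¹) ^ r *
        volume (starSet (0 : E k) (fun i => ((1 - ρ) ^ 2)⁻¹ * a i)
          fun i j => ((1 - ρ) ^ 2)⁻¹ * b i j) := by
  obtain ⟨F⟩ := nonempty_frame e
  set κ := ((1 - ρ) ^ 2)⁻¹ with hκ
  have hκ0 : 0 < κ := inv_pos.2 (pow_pos (by linarith) 2)
  set U : Set (Sph (k + 1)) := {θ | ‖(θ : E (k + 1)) - e‖ ≤ ρ} with hU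
  have hUm : MeasurableSet U :=
    (isClosed_le (by fun_prop) continuous_const).measurableSet
  set B : Set (E k) := Metric.closedBall 0 (κ * ρ)
  have hle : (volume : Measure (E (k + 1))).toSphere.restrict U ≤
      ((volume : Measure (E k)).restrict B).map F.psi := by
    refine Measure.le_iff.2 fun S hS => ?_
    rw [Measure.restrict_apply hS, Measure.map_apply F.continuous_psi.measurable hS,
      Measure.restrict_apply (F.continuous_psi.measurable hS)]
    refine (F.toSphere_le (hS.inter hUm) ?_).trans (measure_mono ?_)
    · rintro θ ⟨-, hθ⟩
      rw [Frame.inner_eq]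
      have : ‖(θ : E (k + 1)) - e‖ ≤ ρ := hθ
      nlinarith [norm_nonneg ((θ : E (k + 1)) - e)]
    · rintro w ⟨hw1, hw2⟩
      refine ⟨hw1, ?_⟩
      have h0 : F.psi 0 = e := F.psi_zero
      have := F.norm_sub_le (w' := 0) hρ hw2 (by rw [h0]; simpa using hρ0)
      rw [h0, sub_zero] at this
      rw [mem_closedBall_zero_iff]
      refine this.trans ?_
      gcongr
      exact hw2
  set A := {θ : Fin r → Sph (k + 1) | (fun i => (θ i : E (k + 1))) ∈ starSet (e : E (k + 1)) a b}
  have hA : MeasurableSet A := measurable_coe_pi k r (measurableSet_starSet _ _ _)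
  rw [pi_angularLaw, Measure.smul_apply, smul_eq_mul]
  refine mul_le_mul_right ?_ _
  have hAU : A ⊆ univ.pi fun _ => U := fun θ hθ i _ => (hθ.1 i).trans (ha i)
  have hmap : (Measure.pi fun _ : Fin r => (volume : Measure (E k)).restrict B).map
      (fun w i => F.psi (w i)) =
      Measure.pi fun _ : Fin r => ((volume : Measure (E k)).restrict B).map F.psi :=  by
    have : IsFiniteMeasure ((volume : Measure (E k)).restrict B) :=
      ⟨by rw [Measure.restrict_apply_univ]; exact measure_closedBall_lt_top⟩
    exact Measure.pi_map_pi fun _ => F.continuous_psi.measurable.aemeasurable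
  have hpsi : Measurable (fun (w : Fin r → E k) i => F.psi (w i)) :=
    measurable_pi_lambda _ fun i => F.continuous_psi.measurable.comp (measurable_pi_apply i)
  calc Measure.pi (fun _ : Fin r => (volume : Measure (E (k + 1))).toSphere) A
      = Measure.pi (fun _ : Fin r => (volume : Measure (E (k + 1))).toSphere.restrict U) A := by
        rw [← Measure.restrict_pi_pi, Measure.restrict_apply hA, inter_eq_left.2 hAU]
    _ ≤ Measure.pi (fun _ : Fin r => ((volume : Measure (E k)).restrict B).map F.psi) A :=
        measure_pi_mono (fun _ => hle) A
    _ = Measure.pi (fun _ : Fin r => (volume : Measure (E k)).restrict B)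
          ((fun w i => F.psi (w i)) ⁻¹' A) := by
        rw [← hmap, Measure.map_apply hpsi hA]
    _ ≤ volume ((fun (w : Fin r → E k) i => F.psi (w i)) ⁻¹' A) :=
        measure_pi_mono (fun _ => Measure.restrict_le_self) _
    _ ≤ _ := by
        refine measure_mono fun w hw => ?_
        have h0 : F.psi 0 = e := F.psi_zero
        have hw1 : ∀ i, ‖(F.psi (w i) : E (k + 1)) - e‖ ≤ a i := hw.1
        refine ⟨fun i => ?_, fun i j => ?_⟩
        · have := F.norm_sub_le (w' := 0) hρ ((hw1 i).trans (ha i)) (by rw [h0]; simpa using hρ0)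
          rw [h0] at this
          exact this.trans (mul_le_mul_of_nonneg_left (hw1 i) hκ0.le)
        · have := F.norm_sub_le hρ ((hw1 i).trans (ha i)) ((hw1 j).trans (ha j))
          exact this.trans (mul_le_mul_of_nonneg_left (hw.2 i j) hκ0.le)

/-- Joint angular constraints in a small cap, bounded below by the constraints in the tangent
space. -/
theorem le_pi_angularLaw_starSet {k r : ℕ} (e : Sph (k + 1)) {ρ : ℝ} (hρ0 : 0 ≤ ρ)
    (a : Fin r → ℝ) (b : Fin r → Fin r → ℝ) (ha : ∀ i, a i ≤ ρ) :
    ENNReal.ofReal ((sphereArea (k + 1))⁻¹ * ((1 + ρ)⁻¹) ^ (k + 1)) ^ r *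
        volume (starSet (0 : E k) a b) ≤
      Measure.pi (fun _ : Fin r => angularLaw (k + 1))
        {θ | (fun i => (θ i : E (k + 1))) ∈ starSet (e : E (k + 1)) a b} := by
  obtain ⟨F⟩ := nonempty_frame e
  set B : Set (E k) := Metric.closedBall 0 ρ
  set c := ENNReal.ofReal (((1 + ρ)⁻¹) ^ (k + 1))
  have hle : c • ((volume : Measure (E k)).restrict B).map F.psi ≤
      (volume : Measure (E (k + 1))).toSphere := by
    refine Measure.le_iff.2 fun S hS => ?_
    rw [Measure.smul_apply, Measure.map_apply F.continuous_psi.measurable hS,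
      Measure.restrict_apply (F.continuous_psi.measurable hS)]
    exact F.le_toSphere hS hρ0
  set A := {θ : Fin r → Sph (k + 1) | (fun i => (θ i : E (k + 1))) ∈ starSet (e : E (k + 1)) a b}
  have hA : MeasurableSet A := measurable_coe_pi k r (measurableSet_starSet _ _ _)
  rw [pi_angularLaw, Measure.smul_apply, smul_eq_mul, ENNReal.ofReal_mul
    (inv_nonneg.2 (sphereArea_pos k).le), mul_pow, mul_assoc]
  refine mul_le_mul_right ?_ _
  have : IsFiniteMeasure ((volume : Measure (E k)).restrict B) :=
    ⟨by rw [Measure.restrict_apply_univ]; exact measure_closedBall_lt_top⟩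
  have hmap : (Measure.pi fun _ : Fin r => (volume : Measure (E k)).restrict B).map
      (fun w i => F.psi (w i)) =
      Measure.pi fun _ : Fin r => ((volume : Measure (E k)).restrict B).map F.psi :=
    Measure.pi_map_pi fun _ => F.continuous_psi.measurable.aemeasurable
  have hpsi : Measurable (fun (w : Fin r → E k) i => F.psi (w i)) :=
    measurable_pi_lambda _ fun i => F.continuous_psi.measurable.comp (measurable_pi_apply i)
  have hsub : starSet (0 : E k) a b ⊆ univ.pi fun _ => B := by
    intro w hw i _
    have := (hw.1 i).trans (ha i)
    rw [sub_zero] at this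
    exact mem_closedBall_zero_iff.2 this
  calc c ^ r * volume (starSet (0 : E k) a b)
      = c ^ r * Measure.pi (fun _ : Fin r => (volume : Measure (E k)).restrict B)
          (starSet (0 : E k) a b) := by
        rw [← Measure.restrict_pi_pi, Measure.restrict_apply (measurableSet_starSet _ _ _),
          inter_eq_left.2 hsub]
        rfl
    _ ≤ c ^ r * Measure.pi (fun _ : Fin r => (volume : Measure (E k)).restrict B)
          ((fun w i => F.psi (w i)) ⁻¹' A) := by
        refine mul_le_mul_right (measure_mono fun w hw => ?_) _
        constructor
        · intro i
          have := F.norm_psi_sub_le (w i) 0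
          rw [F.psi_zero] at this
          exact this.trans (hw.1 i)
        · intro i j
          exact (F.norm_psi_sub_le (w i) (w j)).trans (hw.2 i j)
    _ = Measure.pi (fun _ : Fin r => c • ((volume : Measure (E k)).restrict B).map F.psi) A := by
        rw [measure_pi_const_smul _ _ ENNReal.ofReal_ne_top, Fintype.card_fin, Measure.smul_apply,
          smul_eq_mul, ← hmap, Measure.map_apply hpsi hA]
    _ ≤ _ := measure_pi_mono (fun _ => hle) A

/-! ### Areas of spherical caps -/

theorem xi_eq (k : ℕ) : xi (k + 1) = (volume : Measure (E k)).real (Metric.ball 0 1) := rfl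

theorem xi_pos (k : ℕ) : 0 < xi (k + 1) := by
  rw [xi_eq]
  exact ENNReal.toReal_pos (Metric.measure_ball_pos _ _ one_pos).ne' measure_ball_lt_top.ne

theorem volume_closedBall_eq (k : ℕ) (x : E k) {a : ℝ} (ha : 0 ≤ a) :
    volume (Metric.closedBall x a) = ENNReal.ofReal (xi (k + 1) * a ^ k) := by
  rw [Measure.addHaar_closedBall _ _ ha, finrank_euclideanSpace_fin, mul_comm,
    ENNReal.ofReal_mul (xi_pos k).le, xi_eq, measureReal_def,
    ENNReal.ofReal_toReal measure_ball_lt_top.ne]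

/-- The spherical cap of chord radius `a` around `e`. -/
def cap {k : ℕ} (e : Sph (k + 1)) (a : ℝ) : Set (Sph (k + 1)) :=
  {θ | ‖(θ : E (k + 1)) - e‖ ≤ a}

theorem measurableSet_cap {k : ℕ} (e : Sph (k + 1)) (a : ℝ) : MeasurableSet (cap e a) :=
  (isClosed_le (by fun_prop) continuous_const).measurableSet

theorem angularLaw_cap_le {k : ℕ} (e : Sph (k + 1)) {a ρ : ℝ} (ha : 0 ≤ a) (haρ : a ≤ ρ)
    (hρ : ρ < 1) :
    angularLaw (k + 1) (cap e a) ≤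
      ENNReal.ofReal ((sphereArea (k + 1))⁻¹ * (xi (k + 1) * (((1 - ρ) ^ 2)⁻¹ * a) ^ k)) := by
  obtain ⟨F⟩ := nonempty_frame e
  have hκ0 : 0 ≤ ((1 - ρ) ^ 2)⁻¹ := by positivity
  rw [angularLaw_eq, Measure.smul_apply, smul_eq_mul,
    ENNReal.ofReal_mul (inv_nonneg.2 (sphereArea_pos k).le),
    ← volume_closedBall_eq k 0 (by positivity)]
  refine mul_le_mul_right ((F.toSphere_le (measurableSet_cap _ _) ?_).trans (measure_mono ?_)) _
  · intro θ hθ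
    rw [Frame.inner_eq]
    have : ‖(θ : E (k + 1)) - e‖ ≤ a := hθ
    nlinarith [norm_nonneg ((θ : E (k + 1)) - e)]
  · intro w hw
    have h0 : F.psi 0 = e := F.psi_zero
    have hw' : ‖(F.psi w : E (k + 1)) - e‖ ≤ a := hw
    have := F.norm_sub_le (w' := 0) hρ (hw'.trans haρ) (by rw [h0]; simpa using ha.trans haρ)
    rw [h0, sub_zero] at this
    rw [mem_closedBall_zero_iff]
    exact this.trans (mul_le_mul_of_nonneg_left hw' hκ0)

theorem le_angularLaw_cap {k : ℕ} (e : Sph (k + 1)) {a ρ : ℝ} (ha : 0 ≤ a) (haρ : a ≤ ρ) :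
    ENNReal.ofReal ((sphereArea (k + 1))⁻¹ * (((1 + ρ)⁻¹) ^ (k + 1) * (xi (k + 1) * a ^ k))) ≤
      angularLaw (k + 1) (cap e a) := by
  obtain ⟨F⟩ := nonempty_frame e
  have hρ : 0 ≤ ρ := ha.trans haρ
  rw [angularLaw_eq, Measure.smul_apply, smul_eq_mul,
    ENNReal.ofReal_mul (inv_nonneg.2 (sphereArea_pos k).le), ENNReal.ofReal_mul (by positivity),
    ← volume_closedBall_eq k 0 (by positivity)]
  refine mul_le_mul_right (le_trans ?_ (F.le_toSphere (measurableSet_cap e a) hρ)) _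
  have hsub : Metric.closedBall (0 : E k) a ⊆
      F.psi ⁻¹' cap e a ∩ Metric.closedBall 0 ρ := by
    intro w hw
    refine ⟨?_, Metric.closedBall_subset_closedBall haρ hw⟩
    have := F.norm_psi_sub_le w 0
    rw [F.psi_zero, sub_zero] at this
    exact this.trans (mem_closedBall_zero_iff.1 hw)
  exact mul_le_mul_right (measure_mono hsub) _

theorem exists_angularLaw_cap_le (k : ℕ) : ∃ C : ℝ, 0 < C ∧ ∀ (e : Sph (k + 1)) (a : ℝ), 0 ≤ a →
    angularLaw (k + 1) (cap e a) ≤ ENNReal.ofReal (C * a ^ k) := by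
  refine ⟨(sphereArea (k + 1))⁻¹ * (xi (k + 1) * 4 ^ k) + 2 ^ k, ?_, fun e a ha => ?_⟩
  · have := sphereArea_pos k
    have := xi_pos k
    positivity
  · have h1 := sphereArea_pos k
    have h2 := xi_pos k
    rcases le_or_gt a (1 / 2) with h | h
    · refine (angularLaw_cap_le e ha h (by norm_num)).trans (ENNReal.ofReal_le_ofReal ?_)
      have : ((1 - (1 / 2 : ℝ)) ^ 2)⁻¹ = 4 := by norm_num
      rw [this, mul_pow, add_mul]
      have : (sphereArea (k + 1))⁻¹ * (xi (k + 1) * (4 ^ k * a ^ k)) =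
        (sphereArea (k + 1))⁻¹ * (xi (k + 1) * 4 ^ k) * a ^ k := by ring
      rw [this]
      have : 0 ≤ (2 : ℝ) ^ k * a ^ k := by positivity
      linarith
    · refine prob_le_one.trans ?_
      rw [← ENNReal.ofReal_one]
      refine ENNReal.ofReal_le_ofReal ?_
      have h3 : (1 : ℝ) ≤ 2 ^ k * a ^ k := by
        rw [← mul_pow]; exact one_le_pow₀ (by linarith)
      have h4 : 0 ≤ (sphereArea (k + 1))⁻¹ * (xi (k + 1) * 4 ^ k) * a ^ k := by positivity
      rw [add_mul]
      linarith

/-! ### The radial density -/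

theorem sinh_eq_exp_mul (x : ℝ) :
    Real.sinh x = Real.exp x * (1 - Real.exp (-(2 * x))) / 2 := by
  rw [← two_sinh_eq]; ring

theorem sinh_nonneg_le {x : ℝ} (hx : 0 ≤ x) : 0 ≤ Real.sinh x ∧ Real.sinh x ≤ Real.exp x / 2 := by
  refine ⟨Real.sinh_nonneg_iff.2 hx, ?_⟩
  rw [sinh_eq_exp_mul]
  nlinarith [mul_pos (Real.exp_pos x) (Real.exp_pos (-(2 * x)))]

theorem integral_exp_mul_interval {c : ℝ} (hc : c ≠ 0) (x y : ℝ) :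
    ∫ s in x..y, Real.exp (c * s) = (Real.exp (c * y) - Real.exp (c * x)) / c := by
  rw [intervalIntegral.integral_comp_mul_left (fun s => Real.exp s) hc, integral_exp]
  rw [smul_eq_mul, inv_mul_eq_div]

theorem integral_sinh_pow_le {k : ℕ} (hk : 1 ≤ k) {α R : ℝ} (hα : 0 < α) (hR : 0 ≤ R) :
    ∫ s in (0 : ℝ)..R, Real.sinh (α * s) ^ k ≤ Real.exp (α * k * R) / (2 ^ k * (α * k)) := by
  have hk0 : (0 : ℝ) < k := by exact_mod_cast hk
  have h1 : ∫ s in (0 : ℝ)..R, Real.sinh (α * s) ^ k ≤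
      ∫ s in (0 : ℝ)..R, (1 / 2 ^ k) * Real.exp ((α * k) * s) := by
    refine intervalIntegral.integral_mono_on hR ?_ ?_ ?_
    · exact Continuous.intervalIntegrable (by fun_prop) _ _
    · exact Continuous.intervalIntegrable (by fun_prop) _ _
    · intro s hs
      have := sinh_nonneg_le (mul_nonneg hα.le hs.1)
      calc _ ≤ (Real.exp (α * s) / 2) ^ k := pow_le_pow_left₀ this.1 this.2 k
        _ = _ := by
          rw [div_pow, ← Real.exp_nat_mul]
          rw [show (k : ℝ) * (α * s) = α * k * s by ring]
          ring
  refine h1.trans ?_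
  rw [intervalIntegral.integral_const_mul, integral_exp_mul_interval (by positivity)]
  have : (1 : ℝ) / 2 ^ k * ((Real.exp (α * k * R) - Real.exp (α * k * 0)) / (α * k)) =
    (Real.exp (α * k * R) - 1) / (2 ^ k * (α * k)) := by
    rw [mul_zero, Real.exp_zero]; field_simp
  rw [this]
  gcongr
  linarith

/-- The ratio of a lower bound for `∫₀ᴿ sinh(α s)^k ds`, the normalization of the radial density, to
its leading term. The bound comes from `s ≥ R / 2` only. -/
noncomputable def normFactor (k : ℕ) (α R : ℝ) : ℝ :=
  (1 - Real.exp (-(α * R))) ^ k * (1 - Real.exp (-(α * k * R / 2)))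

theorem normFactor_pos {k : ℕ} (hk : 1 ≤ k) {α R : ℝ} (hα : 0 < α) (hR : 0 < R) :
    0 < normFactor k α R := by
  have hk0 : (0 : ℝ) < k := by exact_mod_cast hk
  have h1 : Real.exp (-(α * R)) < 1 := Real.exp_lt_one_iff.2 (neg_lt_zero.2 (by positivity))
  have h2 : Real.exp (-(α * k * R / 2)) < 1 := Real.exp_lt_one_iff.2 (neg_lt_zero.2 (by positivity))
  exact mul_pos (pow_pos (by linarith) _) (by linarith)

theorem normFactor_mono {k : ℕ} {α R R' : ℝ} (hα : 0 < α) (hR : 0 ≤ R) (h : R ≤ R') :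
    normFactor k α R ≤ normFactor k α R' := by
  have h1 : Real.exp (-(α * R)) ≤ 1 := Real.exp_le_one_iff.2 (neg_nonpos.2 (by positivity))
  have h2 : Real.exp (-(α * k * R / 2)) ≤ 1 := Real.exp_le_one_iff.2 (neg_nonpos.2 (by positivity))
  have hR' : 0 ≤ R' := hR.trans h
  have h3 : Real.exp (-(α * R')) ≤ 1 := Real.exp_le_one_iff.2 (neg_nonpos.2 (by positivity))
  have e1 : Real.exp (-(α * R')) ≤ Real.exp (-(α * R)) := by gcongr
  have e2 : Real.exp (-(α * k * R' / 2)) ≤ Real.exp (-(α * k * R / 2)) := by gcongr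
  rw [normFactor, normFactor]
  refine mul_le_mul (pow_le_pow_left₀ (by linarith) (by linarith) k) (by linarith) (by linarith)
    (pow_nonneg (by linarith) _)

theorem tendsto_normFactor {k : ℕ} (hk : 1 ≤ k) {α : ℝ} (hα : 0 < α) :
    Tendsto (normFactor k α) atTop (𝓝 1) := by
  have hk0 : (0 : ℝ) < k := by exact_mod_cast hk
  have h : ∀ c : ℝ, 0 < c → Tendsto (fun R : ℝ => Real.exp (-(c * R))) atTop (𝓝 0) := fun c hc =>
    Real.tendsto_exp_neg_atTop_nhds_zero.comp (tendsto_id.const_mul_atTop hc)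
  have h1 := h α hα
  have h2 := h (α * k / 2) (by positivity)
  have h3 := ((h1.const_sub 1).pow k).mul (h2.const_sub 1)
  simp only [sub_zero, one_pow, mul_one] at h3
  refine h3.congr fun R => ?_
  rw [normFactor]
  congr 4
  ring

theorem le_integral_sinh_pow {k : ℕ} (hk : 1 ≤ k) {α R : ℝ} (hα : 0 < α) (hR : 0 ≤ R) :
    normFactor k α R * (Real.exp (α * k * R) / (2 ^ k * (α * k))) ≤
      ∫ s in (0 : ℝ)..R, Real.sinh (α * s) ^ k := by
  have hk0 : (0 : ℝ) < k := by exact_mod_cast hk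
  have hint : ∀ x y : ℝ, IntervalIntegrable (fun s => Real.sinh (α * s) ^ k) volume x y :=
    fun x y => Continuous.intervalIntegrable (by fun_prop) _ _
  rw [← intervalIntegral.integral_add_adjacent_intervals (hint 0 (R / 2)) (hint (R / 2) R)]
  have h0 : 0 ≤ ∫ s in (0 : ℝ)..(R / 2), Real.sinh (α * s) ^ k :=
    intervalIntegral.integral_nonneg (by positivity) fun s hs =>
      pow_nonneg (sinh_nonneg_le (mul_nonneg hα.le hs.1)).1 k
  set c := ((1 - Real.exp (-(α * R))) / 2) ^ k with hc
  have h1 : ∫ s in (R / 2)..R, c * Real.exp ((α * k) * s) ≤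
      ∫ s in (R / 2)..R, Real.sinh (α * s) ^ k := by
    refine intervalIntegral.integral_mono_on (by linarith) ?_ (hint _ _) ?_
    · exact Continuous.intervalIntegrable (by fun_prop) _ _
    · intro s hs
      rw [hc, show (α * k) * s = (k : ℝ) * (α * s) by ring, Real.exp_nat_mul, ← mul_pow,
        sinh_eq_exp_mul]
      have h2 : Real.exp (-(2 * (α * s))) ≤ Real.exp (-(α * R)) :=
        Real.exp_le_exp.2 (by nlinarith [hs.1])
      have h3 : Real.exp (-(α * R)) ≤ 1 := Real.exp_le_one_iff.2 (neg_nonpos.2 (by positivity))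
      have h4 := Real.exp_pos (α * s)
      refine pow_le_pow_left₀ (mul_nonneg (by linarith) h4.le) ?_ k
      nlinarith
  rw [intervalIntegral.integral_const_mul, integral_exp_mul_interval (by positivity)] at h1
  have h2 : c * ((Real.exp (α * k * R) - Real.exp (α * k * (R / 2))) / (α * k)) =
      normFactor k α R * (Real.exp (α * k * R) / (2 ^ k * (α * k))) := by
    have : Real.exp (α * k * (R / 2)) = Real.exp (α * k * R) * Real.exp (-(α * k * R / 2)) := by
      rw [← Real.exp_add]; congr 1; ring
    rw [this, normFactor, hc, div_pow]
    field_simp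
  linarith

theorem radialDensity_nonneg {k n : ℕ} {α t : ℝ} (hα : 0 < α) (hR : 0 ≤ radius (k + 1) n)
    (ht : t ≤ radius (k + 1) n) : 0 ≤ radialDensity (k + 1) α n t := by
  rw [radialDensity]
  refine div_nonneg (pow_nonneg (sinh_nonneg_le (mul_nonneg hα.le (by linarith))).1 _) ?_
  exact intervalIntegral.integral_nonneg hR fun s hs =>
    pow_nonneg (sinh_nonneg_le (mul_nonneg hα.le hs.1)).1 _

theorem integral_sinh_pow_pos {k : ℕ} (hk : 1 ≤ k) {α R : ℝ} (hα : 0 < α) (hR : 0 < R) :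
    0 < ∫ s in (0 : ℝ)..R, Real.sinh (α * s) ^ k := by
  have hk0 : (0 : ℝ) < k := by exact_mod_cast hk
  refine lt_of_lt_of_le ?_ (le_integral_sinh_pow hk hα hR.le)
  have := normFactor_pos hk hα hR
  positivity

theorem radialDensity_le {k n : ℕ} (hk : 1 ≤ k) {α t : ℝ} (hα : 0 < α)
    (hR : 0 < radius (k + 1) n) (ht : t ≤ radius (k + 1) n) :
    radialDensity (k + 1) α n t ≤
      (normFactor k α (radius (k + 1) n))⁻¹ * (α * k * Real.exp (-(α * k * t))) := by
  have hk0 : (0 : ℝ) < k := by exact_mod_cast hk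
  rw [radialDensity, Nat.add_sub_cancel]
  generalize radius (k + 1) n = R at *
  have h1 := normFactor_pos hk hα hR
  have h2 := le_integral_sinh_pow hk hα hR.le
  have h3 := sinh_nonneg_le (mul_nonneg hα.le (sub_nonneg.2 ht))
  have h4 := pow_le_pow_left₀ h3.1 h3.2 k
  rw [div_le_iff₀ (integral_sinh_pow_pos hk hα hR)]
  refine h4.trans ?_
  have h5 : (Real.exp (α * (R - t)) / 2) ^ k =
      (normFactor k α R)⁻¹ * (α * k * Real.exp (-(α * k * t))) *
        (normFactor k α R * (Real.exp (α * k * R) / (2 ^ k * (α * k)))) := by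
    rw [div_pow, ← Real.exp_nat_mul,
      show (k : ℝ) * (α * (R - t)) = α * k * R + -(α * k * t) by ring, Real.exp_add]
    field_simp
  rw [h5]
  exact mul_le_mul_of_nonneg_left h2 (by positivity)

theorem le_radialDensity {k n : ℕ} (hk : 1 ≤ k) {α t : ℝ} (hα : 0 < α)
    (hR : 0 < radius (k + 1) n) (ht : t ≤ radius (k + 1) n) :
    (1 - Real.exp (-(2 * (α * (radius (k + 1) n - t))))) ^ k *
        (α * k * Real.exp (-(α * k * t))) ≤ radialDensity (k + 1) α n t := by
  have hk0 : (0 : ℝ) < k := by exact_mod_cast hk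
  rw [radialDensity, Nat.add_sub_cancel]
  generalize radius (k + 1) n = R at *
  rw [le_div_iff₀ (integral_sinh_pow_pos hk hα hR), sinh_eq_exp_mul]
  have h1 : Real.exp (-(2 * (α * (R - t)))) ≤ 1 := by
    have := mul_nonneg hα.le (sub_nonneg.2 ht)
    exact Real.exp_le_one_iff.2 (by linarith)
  have h2 : 0 ≤ (1 - Real.exp (-(2 * (α * (R - t))))) ^ k := pow_nonneg (by linarith) _
  calc _ ≤ (1 - Real.exp (-(2 * (α * (R - t))))) ^ k * (α * k * Real.exp (-(α * k * t))) *
        (Real.exp (α * k * R) / (2 ^ k * (α * k))) :=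
        mul_le_mul_of_nonneg_left (integral_sinh_pow_le hk hα hR.le) (by positivity)
    _ = _ := by
      rw [div_pow, mul_pow, ← Real.exp_nat_mul,
        show (k : ℝ) * (α * (R - t)) = α * k * R + -(α * k * t) by ring, Real.exp_add]
      field_simp

theorem measurable_radialDensity (d : ℕ) (α : ℝ) (n : ℕ) : Measurable (radialDensity d α n) := by
  have : Continuous (radialDensity d α n) := by
    unfold radialDensity
    fun_prop
  exact this.measurable

theorem isProbabilityMeasure_radialLaw {k n : ℕ} (hk : 1 ≤ k) {α : ℝ} (hα : 0 < α)
    (hR : 0 < radius (k + 1) n) : IsProbabilityMeasure (radialLaw (k + 1) α n) := by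
  refine ⟨?_⟩
  rw [radialLaw, withDensity_apply _ MeasurableSet.univ, Measure.restrict_univ,
    ← ofReal_integral_eq_lintegral_ofReal]
  · rw [integral_Icc_eq_integral_Ioc, ← intervalIntegral.integral_of_le hR.le]
    simp only [radialDensity]
    rw [intervalIntegral.integral_div, Nat.add_sub_cancel,
      intervalIntegral.integral_comp_sub_left (fun s => Real.sinh (α * s) ^ k), sub_self, sub_zero,
      div_self (integral_sinh_pow_pos hk hα hR).ne', ENNReal.ofReal_one]
  · have : Continuous (radialDensity (k + 1) α n) := by
      unfold radialDensity
      fun_prop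
    exact this.integrableOn_Icc
  · filter_upwards [ae_restrict_mem measurableSet_Icc] with t ht
    exact radialDensity_nonneg hα hR.le ht.2

/-! ### The expected clique count as an integral -/

theorem measurable_tanh : Measurable Real.tanh := by
  have : Real.tanh = fun x => Real.sinh x / Real.cosh x := funext Real.tanh_eq_sinh_div_cosh
  rw [this]
  exact Real.measurable_sinh.div Real.measurable_cosh

theorem measurable_point (d n : ℕ) : Measurable fun q : ℝ × Sph d => point d n q.1 q.2 := by
  unfold point
  refine Measurable.smul (measurable_tanh.comp (by fun_prop)) ?_
  exact measurable_subtype_coe.comp measurable_snd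

theorem measurable_dH {β : Type*} [MeasurableSpace β] {d : ℕ} {f g : β → E d}
    (hf : Measurable f) (hg : Measurable g) : Measurable fun x => dH (f x) (g x) := by
  unfold dH Real.arcosh
  fun_prop

theorem measurable_height (d n : ℕ) : Measurable (height d n) := by
  unfold height
  exact measurable_const.sub (measurable_dH measurable_const measurable_id)

theorem isProbabilityMeasure_pointLaw {k n : ℕ} (hk : 1 ≤ k) {α : ℝ} (hα : 0 < α)
    (hR : 0 < radius (k + 1) n) : IsProbabilityMeasure (pointLaw (k + 1) α n) := by
  have := isProbabilityMeasure_radialLaw hk hα hR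
  exact Measure.isProbabilityMeasure_map (measurable_point _ _).aemeasurable

theorem nullSingletonClass_pointLaw {k n : ℕ} (hk : 1 ≤ k) {α : ℝ} (hα : 0 < α)
    (hR : 0 < radius (k + 1) n) : NullSingletonClass (pointLaw (k + 1) α n) := by
  have := isProbabilityMeasure_radialLaw hk hα hR
  refine ⟨fun x => ?_⟩
  rw [pointLaw, Measure.map_apply (measurable_point _ _) (measurableSet_singleton x)]
  -- Outside the null set `t ∉ [0, R]`, a point determines its radial coordinate.
  have hsub : (fun q : ℝ × Sph (k + 1) => point (k + 1) n q.1 q.2) ⁻¹' {x} ⊆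
      ({height (k + 1) n x} ∪ (Icc 0 (radius (k + 1) n))ᶜ) ×ˢ univ := by
    rintro ⟨t, θ⟩ hq
    refine ⟨?_, mem_univ _⟩
    by_cases ht : t ∈ Icc 0 (radius (k + 1) n)
    · left
      have hq' : point (k + 1) n t θ = x := hq
      rw [mem_singleton_iff, ← hq', height_point ht.2]
    · right; exact ht
  refine measure_mono_null hsub ?_
  rw [Measure.prod_prod]
  have h1 : radialLaw (k + 1) α n ({height (k + 1) n x} ∪ (Icc 0 (radius (k + 1) n))ᶜ) = 0 := by
    refine (withDensity_absolutelyContinuous _ _) ?_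
    rw [measure_union_null_iff]
    refine ⟨?_, ?_⟩
    · exact measure_singleton _
    · rw [Measure.restrict_apply measurableSet_Icc.compl]
      simp
  rw [h1, zero_mul]

/-- Increasing tuples of radial coordinates between `0` and `u`. -/
def simplex (r : ℕ) (u : ℝ) : Set (Fin (r + 1) → ℝ) :=
  {t | Monotone t ∧ ∀ i, t i ∈ Icc 0 u}

theorem measurableSet_monotone {β ι : Type*} [Finite ι] [Preorder ι] [MeasurableSpace β]
    {f : β → ℝ} (hf : Measurable f) :
    MeasurableSet {Y : ι → β | Monotone fun i => f (Y i)} := by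
  have : {Y : ι → β | Monotone fun i => f (Y i)} =
      ⋂ i, ⋂ j, ⋂ _ : i ≤ j, {Y : ι → β | f (Y i) ≤ f (Y j)} := by
    ext Y
    simp only [mem_ofPred_eq, mem_iInter]
    exact ⟨fun h i j hij => h hij, fun h i j hij => h i j hij⟩
  rw [this]
  refine MeasurableSet.iInter fun i => MeasurableSet.iInter fun j => MeasurableSet.iInter fun _ => ?_
  exact measurableSet_le (hf.comp (measurable_pi_apply i)) (hf.comp (measurable_pi_apply j))

theorem measurableSet_simplex (r : ℕ) (u : ℝ) : MeasurableSet (simplex r u) := by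
  have : simplex r u = {t | Monotone fun i => id (t i)} ∩ univ.pi fun _ => Icc 0 u := by
    ext t
    simp only [simplex, mem_ofPred_eq, mem_inter_iff, Set.mem_pi, mem_univ, true_implies, id]
  rw [this]
  exact (measurableSet_monotone measurable_id).inter
    (MeasurableSet.univ_pi fun _ => measurableSet_Icc)

/-- The tuples that form a clique together with `p`, in which `p` is closest to the origin. -/
def cliqueSet (d q n : ℕ) (p : E d) : Set (Fin q → E d) :=
  {Y | (∀ i j, dH (Y i) (Y j) ≤ radius d n) ∧ (∀ i, dH (Y i) p ≤ radius d n) ∧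
    Monotone (fun i => height d n (Y i)) ∧ ∀ i, height d n (Y i) ≤ height d n p}

theorem measurableSet_cliqueSet (d q n : ℕ) (p : E d) : MeasurableSet (cliqueSet d q n p) := by
  have h1 : MeasurableSet {Y : Fin q → E d | ∀ i j, dH (Y i) (Y j) ≤ radius d n} := by
    simp only [ofPred_forall]
    refine MeasurableSet.iInter fun i => MeasurableSet.iInter fun j => ?_
    exact measurableSet_le (measurable_dH (measurable_pi_apply i) (measurable_pi_apply j))
      measurable_const
  have h2 : MeasurableSet {Y : Fin q → E d | ∀ i, dH (Y i) p ≤ radius d n} := by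
    simp only [ofPred_forall]
    refine MeasurableSet.iInter fun i => ?_
    exact measurableSet_le (measurable_dH (measurable_pi_apply i) measurable_const) measurable_const
  have h3 : MeasurableSet {Y : Fin q → E d | ∀ i, height d n (Y i) ≤ height d n p} := by
    simp only [ofPred_forall]
    refine MeasurableSet.iInter fun i => ?_
    exact measurableSet_le ((measurable_height d n).comp (measurable_pi_apply i)) measurable_const
  exact h1.inter (h2.inter ((measurableSet_monotone (measurable_height d n)).inter h3))

/-- The probability that uniform directions connect points with radial coordinates `t` to each
other and to the point `(u, θ)`. -/
noncomputable def angularProb {k r : ℕ} (R u : ℝ) (θ : Sph (k + 1)) (t : Fin r → ℝ) : ℝ≥0∞ :=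
  Measure.pi (fun _ : Fin r => angularLaw (k + 1))
    {φ | (fun i => (φ i : E (k + 1))) ∈ starSet (θ : E (k + 1))
      (fun i => chord R (t i) u) fun i j => chord R (t i) (t j)}

theorem point_mem_cliqueSet_iff {k q n : ℕ} {u : ℝ} (hu : u ∈ Ioo 0 (radius (k + 1) n))
    (θ : Sph (k + 1)) {t : Fin q → ℝ} (ht : ∀ i, t i ∈ Icc 0 (radius (k + 1) n))
    (φ : Fin q → Sph (k + 1)) :
    (fun i => point (k + 1) n (t i) (φ i)) ∈ cliqueSet (k + 1) q n (point (k + 1) n u θ) ↔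
      (Monotone t ∧ ∀ i, t i ∈ Icc 0 u) ∧ (fun i => (φ i : E (k + 1))) ∈
        starSet (θ : E (k + 1)) (fun i => chord (radius (k + 1) n) (t i) u)
          fun i j => chord (radius (k + 1) n) (t i) (t j) := by
  simp only [cliqueSet, mem_ofPred_eq, height_point (ht _).2, height_point hu.2.le]
  constructor
  · rintro ⟨h1, h2, h3, h4⟩
    have ht' : ∀ i, t i ∈ Ico 0 (radius (k + 1) n) := fun i =>
      ⟨(ht i).1, (h4 i).trans_lt hu.2⟩
    exact ⟨⟨h3, fun i => ⟨(ht i).1, h4 i⟩⟩,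
      fun i => (dH_point_le_iff (ht' i) ⟨hu.1.le, hu.2⟩ _ _).1 (h2 i),
      fun i j => (dH_point_le_iff (ht' i) (ht' j) _ _).1 (h1 i j)⟩
  · rintro ⟨⟨h3, h4⟩, h2, h1⟩
    have ht' : ∀ i, t i ∈ Ico 0 (radius (k + 1) n) := fun i =>
      ⟨(ht i).1, (h4 i).2.trans_lt hu.2⟩
    exact ⟨fun i j => (dH_point_le_iff (ht' i) (ht' j) _ _).2 (h1 i j),
      fun i => (dH_point_le_iff (ht' i) ⟨hu.1.le, hu.2⟩ _ _).2 (h2 i), h3, fun i => (h4 i).2⟩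

theorem pi_radialLaw {k n : ℕ} (hk : 1 ≤ k) {α : ℝ} (hα : 0 < α)
    (hR : 0 < radius (k + 1) n) (q : ℕ) :
    Measure.pi (fun _ : Fin q => radialLaw (k + 1) α n) =
      ((volume : Measure (Fin q → ℝ)).restrict
        (univ.pi fun _ => Icc 0 (radius (k + 1) n))).withDensity fun t =>
        ∏ i, ENNReal.ofReal (radialDensity (k + 1) α n (t i)) := by
  have h1 := isProbabilityMeasure_radialLaw hk hα hR
  have h2 : SigmaFinite ((volume.restrict (Icc 0 (radius (k + 1) n))).withDensity
      fun t => ENNReal.ofReal (radialDensity (k + 1) α n t)) := by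
    have : IsProbabilityMeasure ((volume.restrict (Icc 0 (radius (k + 1) n))).withDensity
      fun t => ENNReal.ofReal (radialDensity (k + 1) α n t)) := h1
    infer_instance
  unfold radialLaw
  rw [pi_withDensity_fin q _ _ (measurable_radialDensity _ _ _).ennreal_ofReal,
    ← Measure.restrict_pi_pi]
  rfl

theorem measurable_prod_radialDensity (d : ℕ) (α : ℝ) (n q : ℕ) :
    Measurable fun t : Fin q → ℝ => ∏ i, ENNReal.ofReal (radialDensity d α n (t i)) :=
  Finset.measurable_fun_prod _ fun i _ =>
    (measurable_radialDensity d α n).ennreal_ofReal.comp (measurable_pi_apply i)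

theorem nu_eq_pi {k r n : ℕ} (hk : 1 ≤ k) {α : ℝ} (hα : 0 < α) (hR : 0 < radius (k + 1) n)
    (u : ℝ) (θ : Sph (k + 1)) :
    nu (k + 1) (r + 2) α n u θ = (n : ℝ≥0∞) ^ (r + 1) *
      Measure.pi (fun _ => pointLaw (k + 1) α n)
        (cliqueSet (k + 1) (r + 1) n (point (k + 1) n u θ)) := by
  have hp1 := isProbabilityMeasure_pointLaw hk hα hR
  have hp2 := nullSingletonClass_pointLaw hk hα hR
  have h := lintegral_poisson_encard (pointLaw (k + 1) α n) n (r + 1) _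
    (measurableSet_cliqueSet (k + 1) (r + 1) n (point (k + 1) n u θ))
  rw [ENNReal.coe_natCast] at h
  exact h

theorem pi_pointLaw_apply {k q n : ℕ} (hk : 1 ≤ k) {α : ℝ} (hα : 0 < α)
    (hR : 0 < radius (k + 1) n) {A : Set (Fin q → E (k + 1))} (hA : MeasurableSet A) :
    Measure.pi (fun _ : Fin q => pointLaw (k + 1) α n) A =
      ∫⁻ t in univ.pi fun _ => Icc 0 (radius (k + 1) n),
        (∏ i, ENNReal.ofReal (radialDensity (k + 1) α n (t i))) *
        Measure.pi (fun _ : Fin q => angularLaw (k + 1))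
          {φ | (fun i => point (k + 1) n (t i) (φ i)) ∈ A} := by
  have hp3 := isProbabilityMeasure_radialLaw hk hα hR
  obtain ⟨h1, h2⟩ := pi_map_prod_apply (radialLaw (k + 1) α n) (angularLaw (k + 1))
    (measurable_point (k + 1) n) hA
  unfold pointLaw
  rw [h1, pi_radialLaw hk hα hR, lintegral_withDensity_eq_lintegral_mul _
    (measurable_prod_radialDensity _ _ _ _) h2]
  rfl

theorem pi_pointLaw_cliqueSet {k r n : ℕ} (hk : 1 ≤ k) {α : ℝ} (hα : 0 < α)
    (hR : 0 < radius (k + 1) n) {u : ℝ} (hu : u ∈ Ioo 0 (radius (k + 1) n)) (θ : Sph (k + 1)) :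
    Measure.pi (fun _ => pointLaw (k + 1) α n)
        (cliqueSet (k + 1) (r + 1) n (point (k + 1) n u θ)) =
      ∫⁻ t in simplex r u, (∏ i, ENNReal.ofReal (radialDensity (k + 1) α n (t i))) *
        angularProb (radius (k + 1) n) u θ t := by
  rw [pi_pointLaw_apply hk hα hR (measurableSet_cliqueSet _ _ _ _),
    ← lintegral_indicator (measurableSet_simplex r u),
    ← lintegral_indicator (MeasurableSet.univ_pi fun _ => measurableSet_Icc)]
  refine lintegral_congr fun t => ?_
  by_cases ht : t ∈ univ.pi fun _ : Fin (r + 1) => Icc 0 (radius (k + 1) n)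
  · rw [indicator_of_mem ht]
    have ht' : ∀ i, t i ∈ Icc 0 (radius (k + 1) n) := fun i => ht i (mem_univ i)
    by_cases hs : t ∈ simplex r u
    · rw [indicator_of_mem hs, angularProb]
      congr 2
      ext φ
      exact (point_mem_cliqueSet_iff hu θ ht' φ).trans (and_iff_right hs)
    · rw [indicator_of_notMem hs]
      have : {φ : Fin (r + 1) → Sph (k + 1) | (fun i => point (k + 1) n (t i) (φ i)) ∈
          cliqueSet (k + 1) (r + 1) n (point (k + 1) n u θ)} = ∅ := by
        ext φ
        simp only [mem_empty_iff_false, iff_false]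
        exact fun hφ => hs ((point_mem_cliqueSet_iff hu θ ht' φ).1 hφ).1
      rw [this, measure_empty, mul_zero]
  · rw [indicator_of_notMem ht, indicator_of_notMem fun hs => ht fun i _ =>
      ⟨(hs.2 i).1, (hs.2 i).2.trans hu.2.le⟩]

theorem nu_eq {k r n : ℕ} (hk : 1 ≤ k) {α : ℝ} (hα : 0 < α) (hR : 0 < radius (k + 1) n)
    {u : ℝ} (hu : u ∈ Ioo 0 (radius (k + 1) n)) (θ : Sph (k + 1)) :
    nu (k + 1) (r + 2) α n u θ = (n : ℝ≥0∞) ^ (r + 1) *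
      ∫⁻ t in simplex r u, (∏ i, ENNReal.ofReal (radialDensity (k + 1) α n (t i))) *
        angularProb (radius (k + 1) n) u θ t := by
  rw [nu_eq_pi hk hα hR, pi_pointLaw_cliqueSet hk hα hR hu]

/-! ### Integrals of exponential kernels -/

theorem lintegral_exp_Ici {c : ℝ} (hc : 0 < c) (a : ℝ) :
    ∫⁻ s in Ici a, ENNReal.ofReal (Real.exp (-(c * s))) =
      ENNReal.ofReal (c⁻¹ * Real.exp (-(c * a))) := by
  have h : -c < 0 := by linarith
  rw [Measure.restrict_congr_set Ioi_ae_eq_Ici.symm, ← ofReal_integral_eq_lintegral_ofReal]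
  · congr 1
    have := integral_exp_mul_Ioi h a
    simp only [neg_mul] at this
    rw [this]
    field_simp
  · have := integrableOn_exp_mul_Ioi h a
    simp only [neg_mul] at this
    exact this
  · exact Eventually.of_forall fun s => (Real.exp_pos _).le

theorem lintegral_exp_neg_abs_sub {c : ℝ} (hc : 0 < c) (T : ℝ) :
    ∫⁻ s, ENNReal.ofReal (Real.exp (-(c * |s - T|))) = ENNReal.ofReal (2 * c⁻¹) := by
  rw [lintegral_sub_right_eq_self (fun s => ENNReal.ofReal (Real.exp (-(c * |s|)))) T]
  have h1 : ∫ s : ℝ, Real.exp (-(c * |s|)) = 2 * c⁻¹ := by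
    rw [integral_comp_abs (f := fun s => Real.exp (-(c * s)))]
    have := integral_exp_mul_Ioi (neg_lt_zero.2 hc) 0
    simp only [neg_mul] at this
    rw [this]
    simp
  rw [← h1, ofReal_integral_eq_lintegral_ofReal]
  · by_contra h
    rw [integral_undef h] at h1
    have : 0 < 2 * c⁻¹ := by positivity
    linarith
  · exact Eventually.of_forall fun s => (Real.exp_pos _).le

/-- The kernel obtained, up to a constant factor, from the integrand of `ℓ` by dropping the
constraints between the points other than the first one. -/
noncomputable def starKernel (k r : ℕ) (α : ℝ) (t : Fin (r + 1) → ℝ) : ℝ≥0∞ :=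
  ENNReal.ofReal (Real.exp (k / 2 * ((r + 1 - 2 * α) * t 0)) *
    ∏ i : Fin r, Real.exp (-(k * (2 * α - 1) / 2 * t i.succ)))

/-- The increasing tuples of nonnegative radial coordinates whose last entry is at least `T`. -/
def simplexTail (r : ℕ) (T : ℝ) : Set (Fin (r + 1) → ℝ) :=
  {t | Monotone t ∧ (∀ i, 0 ≤ t i) ∧ T ≤ t (Fin.last r)}

theorem lintegral_fin_succ {r : ℕ} {f : (Fin (r + 1) → ℝ) → ℝ≥0∞} (hf : Measurable f) :
    ∫⁻ t, f t = ∫⁻ x : ℝ, ∫⁻ s : Fin r → ℝ, f (Fin.cons x s) := by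
  have h := (volume_preserving_piFinSuccAbove (fun _ : Fin (r + 1) => ℝ) 0).symm
  rw [← h.lintegral_comp hf, Measure.volume_eq_prod, lintegral_prod]
  · simp only [MeasurableEquiv.piFinSuccAbove_symm_apply, Fin.insertNthEquiv_zero]
    rfl
  · exact (hf.comp (MeasurableEquiv.measurable _)).aemeasurable

/-- Given the first coordinate `x`, the others range over `[x, ∞)`, and the last one over
`[max x T, ∞)`. Integrating them out leaves an exponential function of `x` that, by the bounds on
`α`, decays away from `x = T` on both sides. -/
theorem exists_lintegral_starKernel_le {k r : ℕ} (hk : 1 ≤ k) (hr : 1 ≤ r) {α : ℝ}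
    (hα : (2 * r + 1 : ℝ) / (2 * r + 2) < α) (hα' : α < 1) :
    ∃ C : ℝ, 0 < C ∧ ∀ T : ℝ, 0 ≤ T → ∫⁻ t in simplexTail r T, starKernel k r α t ≤
      ENNReal.ofReal (C * Real.exp (k / 2 * ((2 * r + 1 - (2 * r + 2) * α) * T))) := by
  obtain ⟨q, rfl⟩ : ∃ q, r = q + 1 := ⟨r - 1, by omega⟩
  have hk0 : (0 : ℝ) < k := by exact_mod_cast hk
  have hβ : (2 * ((q + 1 : ℕ) : ℝ) + 1 - (2 * ((q + 1 : ℕ) : ℝ) + 2) * α) < 0 := by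
    rw [div_lt_iff₀ (by positivity)] at hα
    linarith
  set r : ℝ := ((q + 1 : ℕ) : ℝ) with hr'
  have hr0 : 1 ≤ r := by rw [hr']; exact_mod_cast hr
  have hα2 : 0 < 2 * α - 1 := by nlinarith
  set β := 2 * r + 1 - (2 * r + 2) * α with hβdef
  set c := k * (2 * α - 1) / 2 with hc
  have hc0 : 0 < c := by positivity
  set μ := k / 2 * min (2 * r * (1 - α)) (-β) with hμ
  have hμ0 : 0 < μ := by
    have h1 : 0 < 2 * r * (1 - α) := mul_pos (by linarith) (by linarith)
    have h2 : 0 < -β := by linarith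
    have := lt_min h1 h2
    positivity
  refine ⟨(c⁻¹) ^ (q + 1) * (2 * μ⁻¹), by positivity, fun T hT => ?_⟩
  -- Given the first coordinate `x`, the lower end of the range of the `i`-th of the others.
  set low : ℝ → Fin (q + 1) → ℝ := fun x i => if i = Fin.last q then max x T else x with hlow
  set g : (Fin (q + 2) → ℝ) → ℝ≥0∞ := fun t =>
    ENNReal.ofReal (Real.exp (k / 2 * ((r + 1 - 2 * α) * t 0))) *
    ∏ i : Fin (q + 1), {s : ℝ × ℝ | low s.1 i ≤ s.2}.indicator
      (fun s => ENNReal.ofReal (Real.exp (-(c * s.2)))) (t 0, t i.succ) with hg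
  have hlowm : ∀ i, Measurable fun x => low x i := by
    intro i
    simp only [hlow]
    split_ifs
    · exact measurable_id.max measurable_const
    · exact measurable_id
  have hgm : Measurable g := by
    refine Measurable.mul (by fun_prop) (Finset.measurable_fun_prod _ fun i _ => ?_)
    have : Measurable ({s : ℝ × ℝ | low s.1 i ≤ s.2}.indicator
        (fun s => ENNReal.ofReal (Real.exp (-(c * s.2))))) :=
      Measurable.indicator (by fun_prop)
        (measurableSet_le ((hlowm i).comp measurable_fst) measurable_snd)
    exact this.comp ((measurable_pi_apply _).prodMk (measurable_pi_apply _))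
  have hle : ∀ t ∈ simplexTail (q + 1) T, starKernel k (q + 1) α t ≤ g t := by
    rintro t ⟨hmono, h0, hlast⟩
    simp only [hg, starKernel]
    rw [ENNReal.ofReal_mul (Real.exp_pos _).le, ENNReal.ofReal_prod_of_nonneg
      fun i _ => (Real.exp_pos _).le]
    refine mul_le_mul_right (le_of_eq (Finset.prod_congr rfl fun i _ => ?_)) _
    rw [indicator_of_mem]
    simp only [hlow, mem_ofPred_eq]
    split_ifs with hi
    · subst hi
      exact max_le (hmono (Fin.zero_le _)) hlast
    · exact hmono (Fin.zero_le _)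
  have hm : MeasurableSet (simplexTail (q + 1) T) := by
    have h1 : MeasurableSet {t : Fin (q + 2) → ℝ | ∀ i, 0 ≤ t i} := by
      rw [ofPred_forall]
      exact MeasurableSet.iInter fun i => measurableSet_le measurable_const (measurable_pi_apply i)
    exact (measurableSet_monotone (f := id) measurable_id).inter
      (h1.inter (measurableSet_le measurable_const (measurable_pi_apply _)))
  refine (setLIntegral_mono' hm hle).trans ((setLIntegral_le_lintegral _ _).trans ?_)
  rw [lintegral_fin_succ hgm]
  have hinner : ∀ x : ℝ, ∫⁻ s : Fin (q + 1) → ℝ, g (Fin.cons x s) =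
      ENNReal.ofReal (Real.exp (k / 2 * ((r + 1 - 2 * α) * x))) *
        ∏ i : Fin (q + 1), ENNReal.ofReal (c⁻¹ * Real.exp (-(c * low x i))) := by
    intro x
    simp only [hg, Fin.cons_zero, Fin.cons_succ]
    have hmi : ∀ i : Fin (q + 1), Measurable fun y => {s : ℝ × ℝ | low s.1 i ≤ s.2}.indicator
        (fun s => ENNReal.ofReal (Real.exp (-(c * s.2)))) (x, y) := by
      intro i
      have : Measurable ({s : ℝ × ℝ | low s.1 i ≤ s.2}.indicator
          (fun s => ENNReal.ofReal (Real.exp (-(c * s.2))))) :=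
        Measurable.indicator (by fun_prop)
          (measurableSet_le ((hlowm i).comp measurable_fst) measurable_snd)
      exact this.comp (measurable_const.prodMk measurable_id)
    rw [lintegral_const_mul']
    · congr 1
      have := lintegral_pi_fin_prod (q + 1) (fun _ => (volume : Measure ℝ))
        (fun i y => {s : ℝ × ℝ | low s.1 i ≤ s.2}.indicator
          (fun s => ENNReal.ofReal (Real.exp (-(c * s.2)))) (x, y)) hmi
      refine this.trans (Finset.prod_congr rfl fun i _ => ?_)
      rw [← lintegral_exp_Ici hc0 (low x i), ← lintegral_indicator measurableSet_Ici]
      rfl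
    · exact ENNReal.ofReal_ne_top
  simp only [hinner]
  have hprod : ∀ x : ℝ, ENNReal.ofReal (Real.exp (k / 2 * ((r + 1 - 2 * α) * x))) *
        ∏ i : Fin (q + 1), ENNReal.ofReal (c⁻¹ * Real.exp (-(c * low x i))) ≤
      ENNReal.ofReal ((c⁻¹) ^ (q + 1) * Real.exp (k / 2 * (β * T))) *
        ENNReal.ofReal (Real.exp (-(μ * |x - T|))) := by
    intro x
    rw [← ENNReal.ofReal_prod_of_nonneg fun i _ => by positivity,
      ← ENNReal.ofReal_mul (Real.exp_pos _).le, ← ENNReal.ofReal_mul (by positivity)]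
    refine ENNReal.ofReal_le_ofReal ?_
    rw [Finset.prod_mul_distrib, Finset.prod_const, Finset.card_univ, Fintype.card_fin,
      ← Real.exp_sum, Finset.sum_neg_distrib, ← Finset.mul_sum, mul_left_comm, mul_assoc,
      ← Real.exp_add, ← Real.exp_add]
    refine mul_le_mul_of_nonneg_left (Real.exp_le_exp.2 ?_) (by positivity)
    have hsum : ∑ i, low x i = q * x + max x T := by
      rw [Fin.sum_univ_castSucc]
      simp only [hlow, if_true]
      congr 1
      rw [Finset.sum_congr rfl fun i _ => if_neg (Fin.castSucc_lt_last i).ne]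
      simp
    rw [hsum, hμ, hc]
    have hq : (q : ℝ) = r - 1 := by rw [hr']; push_cast; ring
    rw [hq]
    have hm1 := min_le_left (2 * r * (1 - α)) (-β)
    have hm2 := min_le_right (2 * r * (1 - α)) (-β)
    set m := min (2 * r * (1 - α)) (-β)
    suffices h : (r + 1 - 2 * α) * x - (2 * α - 1) * ((r - 1) * x + max x T) ≤
        β * T - m * |x - T| by nlinarith
    rcases le_total x T with hx | hx
    · rw [max_eq_right hx, abs_of_nonpos (sub_nonpos.2 hx)]
      have := mul_le_mul_of_nonneg_right hm1 (sub_nonneg.2 hx)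
      rw [hβdef]
      nlinarith
    · rw [max_eq_left hx, abs_of_nonneg (sub_nonneg.2 hx)]
      have := mul_le_mul_of_nonneg_right hm2 (sub_nonneg.2 hx)
      rw [hβdef] at this ⊢
      nlinarith
  refine (lintegral_mono hprod).trans ?_
  rw [lintegral_const_mul' _ _ ENNReal.ofReal_ne_top, lintegral_exp_neg_abs_sub hμ0,
    ← ENNReal.ofReal_mul (by positivity)]
  exact le_of_eq (by congr 1; ring)

/-! ### The function `ℓ` -/

/-- The set of admissible relative positions in the definition of `ℓ`. -/
def flatSet (k r : ℕ) (t : Fin (r + 1) → ℝ) : Set (Fin r → E k) :=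
  starSet (0 : E k) (fun i => 2 * Real.exp ((t 0 + t i.succ) / 2))
    fun i j => 2 * Real.exp ((t i.succ + t j.succ) / 2)

theorem ellIntegrand_eq (k r : ℕ) (α : ℝ) (t : Fin (r + 1) → ℝ) :
    ellIntegrand (k + 1) (r + 2) α t =
      ENNReal.ofReal (Real.exp (k * (1 - 2 * α) * t 0 / 2) *
        ∏ i : Fin r, Real.exp (-(α * k * t i.succ))) * volume (flatSet k r t) := by
  have h : ((k + 1 : ℕ) : ℝ) - 1 = k := by push_cast; ring
  have h2 : flatSet k r t = {w | (∀ i, ‖w i‖ ≤ 2 * Real.exp ((t 0 + t i.succ) / 2)) ∧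
        ∀ i j, ‖w i - w j‖ ≤ 2 * Real.exp ((t i.succ + t j.succ) / 2)} := by
    simp only [flatSet, starSet, sub_zero]
  rw [h2, ← h]
  rfl

theorem volume_flatSet_le (k r : ℕ) (t : Fin (r + 1) → ℝ) :
    volume (flatSet k r t) ≤
      ENNReal.ofReal (∏ i : Fin r, (xi (k + 1) * (2 * Real.exp ((t 0 + t i.succ) / 2)) ^ k)) := by
  have h0 := xi_pos k
  have hsub : flatSet k r t ⊆
      univ.pi fun i => Metric.closedBall (0 : E k) (2 * Real.exp ((t 0 + t i.succ) / 2)) := by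
    intro w hw i _
    have := hw.1 i
    rw [sub_zero] at this
    exact mem_closedBall_zero_iff.2 this
  refine (measure_mono hsub).trans ?_
  rw [volume_pi_pi, ENNReal.ofReal_prod_of_nonneg fun i _ => by positivity]
  exact le_of_eq (Finset.prod_congr rfl fun i _ => volume_closedBall_eq k 0 (by positivity))

theorem ellIntegrand_le (k r : ℕ) (α : ℝ) (t : Fin (r + 1) → ℝ) :
    ellIntegrand (k + 1) (r + 2) α t ≤
      ENNReal.ofReal ((xi (k + 1) * 2 ^ k) ^ r) * starKernel k r α t := by
  have h0 := xi_pos k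
  rw [ellIntegrand_eq, starKernel]
  refine (mul_le_mul_right (volume_flatSet_le k r t) _).trans ?_
  rw [← ENNReal.ofReal_mul (by positivity), ← ENNReal.ofReal_mul (by positivity)]
  refine le_of_eq (congrArg _ ?_)
  have h1 : ∀ i : Fin r, xi (k + 1) * (2 * Real.exp ((t 0 + t i.succ) / 2)) ^ k =
      xi (k + 1) * 2 ^ k * Real.exp (k * t 0 / 2) * Real.exp (k * t i.succ / 2) := by
    intro i
    rw [mul_pow, ← Real.exp_nat_mul, mul_assoc _ (Real.exp _), ← Real.exp_add]
    rw [show (k : ℝ) * ((t 0 + t i.succ) / 2) = k * t 0 / 2 + k * t i.succ / 2 by ring]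
    ring
  simp only [h1, Finset.prod_mul_distrib, Finset.prod_const, Finset.card_univ, Fintype.card_fin]
  have h2 : Real.exp (k / 2 * ((r + 1 - 2 * α) * t 0)) =
      Real.exp (k * (1 - 2 * α) * t 0 / 2) * Real.exp (k * t 0 / 2) ^ r := by
    rw [← Real.exp_nat_mul, ← Real.exp_add]; congr 1; ring
  have h3 : ∏ i : Fin r, Real.exp (-(k * (2 * α - 1) / 2 * t i.succ)) =
      (∏ i : Fin r, Real.exp (-(α * k * t i.succ))) * ∏ i : Fin r, Real.exp (k * t i.succ / 2) := by
    rw [← Finset.prod_mul_distrib]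
    refine Finset.prod_congr rfl fun i _ => ?_
    rw [← Real.exp_add]; congr 1; ring
  rw [h2, h3]
  ring

theorem ell_eq (k r : ℕ) (α u : ℝ) :
    ell (k + 1) (r + 2) α u = ∫⁻ t in simplex r u, ellIntegrand (k + 1) (r + 2) α t := rfl

theorem ell_mono (d m : ℕ) (α : ℝ) : Monotone (ell d m α) := fun _ _ huv =>
  lintegral_mono_set fun _ ht => ⟨ht.1, fun i => ⟨(ht.2 i).1, (ht.2 i).2.trans huv⟩⟩

theorem simplex_subset (r : ℕ) (u v : ℝ) : simplex r u ⊆ simplex r (min u v) ∪ simplexTail r v := by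
  intro t ht
  rcases le_total (t (Fin.last r)) v with h | h
  · exact Or.inl ⟨ht.1, fun i => ⟨(ht.2 i).1, le_min (ht.2 i).2 ((ht.1 (Fin.le_last i)).trans h)⟩⟩
  · exact Or.inr ⟨ht.1, fun i => (ht.2 i).1, h⟩

theorem lintegral_simplex_le (r : ℕ) (u v : ℝ) (f : (Fin (r + 1) → ℝ) → ℝ≥0∞) :
    ∫⁻ t in simplex r u, f t ≤
      (∫⁻ t in simplex r (min u v), f t) + ∫⁻ t in simplexTail r v, f t :=
  (lintegral_mono_set (simplex_subset r u v)).trans (lintegral_union_le _ _ _)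

theorem exists_ell_le {k r : ℕ} (hk : 1 ≤ k) (hr : 1 ≤ r) {α : ℝ}
    (hα : (2 * r + 1 : ℝ) / (2 * r + 2) < α) (hα' : α < 1) :
    ∃ C : ℝ, 0 < C ∧ ∀ u v : ℝ, 0 ≤ v → ell (k + 1) (r + 2) α u ≤
      ell (k + 1) (r + 2) α (min u v) +
        ENNReal.ofReal (C * Real.exp (k / 2 * ((2 * r + 1 - (2 * r + 2) * α) * v))) := by
  obtain ⟨C, hC, h⟩ := exists_lintegral_starKernel_le hk hr hα hα'
  have h0 := xi_pos k
  refine ⟨(xi (k + 1) * 2 ^ k) ^ r * C, by positivity, fun u v hv => ?_⟩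
  rw [ell_eq, ell_eq]
  refine (lintegral_simplex_le r u v _).trans (add_le_add le_rfl ?_)
  refine (lintegral_mono fun t => ellIntegrand_le k r α t).trans ?_
  rw [lintegral_const_mul' _ _ ENNReal.ofReal_ne_top, mul_assoc,
    ENNReal.ofReal_mul (p := (xi (k + 1) * 2 ^ k) ^ r) (by positivity)]
  exact mul_le_mul_right (h v hv) _

theorem volume_simplex_zero (r : ℕ) : volume (simplex r 0) = 0 := by
  refine measure_mono_null (t := {0}) ?_ (measure_singleton _)
  intro t ht
  refine funext fun i => le_antisymm (ht.2 i).2 (ht.2 i).1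

theorem ellInf_lt_top {k r : ℕ} (hk : 1 ≤ k) (hr : 1 ≤ r) {α : ℝ}
    (hα : (2 * r + 1 : ℝ) / (2 * r + 2) < α) (hα' : α < 1) :
    ellInf (k + 1) (r + 2) α < ∞ := by
  obtain ⟨C, hC, h⟩ := exists_ell_le hk hr hα hα'
  refine lt_of_le_of_lt (iSup_le fun u => ?_) (ENNReal.ofReal_lt_top (r := C))
  have h1 := h u 0 le_rfl
  have h2 : ell (k + 1) (r + 2) α (min u 0) = 0 := by
    rw [ell_eq]
    refine setLIntegral_measure_zero _ _ (measure_mono_null ?_ (volume_simplex_zero r))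
    exact fun t ht => ⟨ht.1, fun i => ⟨(ht.2 i).1, (ht.2 i).2.trans (min_le_right _ _)⟩⟩
  rw [h2, zero_add, mul_zero, mul_zero, Real.exp_zero, mul_one] at h1
  exact h1

theorem ell_le_ellInf (d m : ℕ) (α u : ℝ) : ell d m α u ≤ ellInf d m α :=
  le_iSup (fun u => ell d m α u) u

theorem le_volume_flatSet (k r : ℕ) {t : Fin (r + 1) → ℝ} (ht : ∀ i, 0 ≤ t i) :
    volume (Metric.ball (0 : E k) 1) ^ r ≤ volume (flatSet k r t) := by
  have hsub : (univ.pi fun _ : Fin r => Metric.ball (0 : E k) 1) ⊆ flatSet k r t := by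
    intro w hw
    have hw' : ∀ i, ‖w i‖ < 1 := fun i => mem_ball_zero_iff.1 (hw i (mem_univ i))
    have h1 : ∀ x : ℝ, 0 ≤ x → 1 ≤ Real.exp x := fun x hx => Real.one_le_exp hx
    constructor
    · intro i
      have := h1 ((t 0 + t i.succ) / 2) (by linarith [ht 0, ht i.succ])
      rw [sub_zero]
      linarith [hw' i]
    · intro i j
      have := h1 ((t i.succ + t j.succ) / 2) (by linarith [ht j.succ, ht i.succ])
      have := norm_sub_le (w i) (w j)
      linarith [hw' i, hw' j]
  refine le_trans (le_of_eq ?_) (measure_mono hsub)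
  rw [volume_pi_pi, Finset.prod_const, Finset.card_univ, Fintype.card_fin]

theorem ellInf_pos (k r : ℕ) (α : ℝ) : 0 < ellInf (k + 1) (r + 2) α := by
  set U : Set (Fin (r + 1) → ℝ) := univ.pi fun i => Ioo ((i : ℕ) : ℝ) ((i : ℕ) + 1) with hU
  have hUs : U ⊆ simplex r (r + 1) := by
    intro t ht
    have ht' : ∀ i : Fin (r + 1), ((i : ℕ) : ℝ) < t i ∧ t i < (i : ℕ) + 1 :=
      fun i => ht i (mem_univ i)
    refine ⟨fun i j hij => ?_, fun i => ⟨?_, ?_⟩⟩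
    · rcases eq_or_lt_of_le hij with h | h
      · rw [h]
      · have : ((i : ℕ) : ℝ) + 1 ≤ (j : ℕ) := by exact_mod_cast h
        linarith [(ht' i).2, (ht' j).1]
    · exact (Nat.cast_nonneg _).trans (ht' i).1.le
    · have : ((i : ℕ) : ℝ) ≤ r := by exact_mod_cast Nat.lt_succ_iff.1 i.2
      linarith [(ht' i).2]
  have hUm : MeasurableSet U := MeasurableSet.univ_pi fun _ => measurableSet_Ioo
  have hUpos : 0 < volume U := by
    rw [hU, volume_pi_pi]
    refine CanonicallyOrderedAdd.prod_pos.2 fun i _ => ?_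
    simp
  set v := volume (Metric.ball (0 : E k) 1) ^ r with hv
  have hv0 : v ≠ 0 := pow_ne_zero _ (Metric.measure_ball_pos _ _ one_pos).ne'
  refine lt_of_lt_of_le ?_ (ell_le_ellInf _ _ α (r + 1))
  rw [ell_eq]
  refine lt_of_lt_of_le ?_ (lintegral_mono_set hUs)
  have hle : ∀ t ∈ U, ENNReal.ofReal (Real.exp (k * (1 - 2 * α) * t 0 / 2) *
      ∏ i : Fin r, Real.exp (-(α * k * t i.succ))) * v ≤ ellIntegrand (k + 1) (r + 2) α t := by
    intro t ht
    rw [ellIntegrand_eq]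
    exact mul_le_mul_right (le_volume_flatSet k r fun i => ((hUs ht).2 i).1) _
  refine lt_of_lt_of_le ?_ (setLIntegral_mono' hUm hle)
  rw [setLIntegral_pos_iff (by fun_prop)]
  convert hUpos using 2
  rw [inter_eq_right]
  intro t _
  rw [Function.mem_support]
  refine mul_ne_zero ?_ hv0
  rw [ENNReal.ofReal_ne_zero_iff]
  positivity

/-! ### Bounds on the integrand of the expected clique count -/

/-- The probability that uniform directions lie within distances `a i` of `e` and within
distances `b i j` of each other. -/
noncomputable def starProb {k r : ℕ} (e : Sph (k + 1)) (a : Fin r → ℝ) (b : Fin r → Fin r → ℝ) :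
    ℝ≥0∞ :=
  Measure.pi (fun _ : Fin r => angularLaw (k + 1))
    {φ | (fun i => (φ i : E (k + 1))) ∈ starSet (e : E (k + 1)) a b}

theorem pi_angularLaw_succ {k r : ℕ} {S : Set (Sph (k + 1))} (hS : MeasurableSet S)
    (a : Fin r → ℝ) (b : Fin r → Fin r → ℝ) :
    Measure.pi (fun _ : Fin (r + 1) => angularLaw (k + 1))
      {φ | φ 0 ∈ S ∧ (fun i : Fin r => (φ i.succ : E (k + 1))) ∈
        starSet (φ 0 : E (k + 1)) a b} =
      ∫⁻ e in S, starProb e a b ∂(angularLaw (k + 1)) := by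
  set A : Set (Sph (k + 1) × (Fin r → Sph (k + 1))) :=
    {z | z.1 ∈ S ∧ (fun i : Fin r => (z.2 i : E (k + 1))) ∈ starSet (z.1 : E (k + 1)) a b}
  have hA : MeasurableSet A := by
    have h1 : MeasurableSet {z : Sph (k + 1) × (Fin r → Sph (k + 1)) |
        (fun i : Fin r => (z.2 i : E (k + 1))) ∈ starSet (z.1 : E (k + 1)) a b} := by
      have h2 : {z : Sph (k + 1) × (Fin r → Sph (k + 1)) |
          (fun i : Fin r => (z.2 i : E (k + 1))) ∈ starSet (z.1 : E (k + 1)) a b} =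
          (⋂ i, {z | ‖(z.2 i : E (k + 1)) - z.1‖ ≤ a i}) ∩
            ⋂ i, ⋂ j, {z | ‖(z.2 i : E (k + 1)) - z.2 j‖ ≤ b i j} := by
        ext z; simp [starSet]
      rw [h2]
      refine IsClosed.measurableSet ((isClosed_iInter fun i => ?_).inter
        (isClosed_iInter fun i => isClosed_iInter fun j => ?_))
      · exact isClosed_le (by fun_prop) continuous_const
      · exact isClosed_le (by fun_prop) continuous_const
    exact (measurable_fst hS).inter h1
  refine (pi_succ_apply (angularLaw (k + 1)) hA).trans ?_
  · rw [← lintegral_indicator hS]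
    refine lintegral_congr fun e => ?_
    by_cases he : e ∈ S
    · rw [indicator_of_mem he]
      have : Prod.mk e ⁻¹' A =
          {φ | (fun i => (φ i : E (k + 1))) ∈ starSet (e : E (k + 1)) a b} := by
        ext φ
        exact and_iff_right he
      rw [this]
      rfl
    · rw [indicator_of_notMem he]
      have : Prod.mk e ⁻¹' A = ∅ := by
        ext φ
        simp only [mem_empty_iff_false, iff_false]
        exact fun h => he h.1
      rw [this, measure_empty]

/-- The chord bounds between the points after the first one and the first one. -/
noncomputable def chordFirst {r : ℕ} (R : ℝ) (t : Fin (r + 1) → ℝ) (i : Fin r) : ℝ :=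
  chord R (t i.succ) (t 0)

/-- The chord bounds between the points after the first one. -/
noncomputable def chordRest {r : ℕ} (R : ℝ) (t : Fin (r + 1) → ℝ) (i j : Fin r) : ℝ :=
  chord R (t i.succ) (t j.succ)

theorem angularProb_le {k r : ℕ} (R u : ℝ) (θ : Sph (k + 1)) (t : Fin (r + 1) → ℝ) {c : ℝ≥0∞}
    (hc : ∀ e : Sph (k + 1), starProb e (chordFirst R t) (chordRest R t) ≤ c) :
    angularProb R u θ t ≤ c * angularLaw (k + 1) (cap θ (chord R (t 0) u)) := by
  calc angularProb R u θ t
      ≤ Measure.pi (fun _ : Fin (r + 1) => angularLaw (k + 1))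
        {φ | φ 0 ∈ cap θ (chord R (t 0) u) ∧ (fun i : Fin r => (φ i.succ : E (k + 1))) ∈
          starSet (φ 0 : E (k + 1)) (chordFirst R t) (chordRest R t)} :=
        measure_mono fun φ hφ =>
          ⟨hφ.1 0, fun i => hφ.2 i.succ 0, fun i j => hφ.2 i.succ j.succ⟩
    _ = ∫⁻ e in cap θ (chord R (t 0) u), starProb e (chordFirst R t) (chordRest R t)
          ∂(angularLaw (k + 1)) := pi_angularLaw_succ (measurableSet_cap _ _) _ _
    _ ≤ ∫⁻ _ in cap θ (chord R (t 0) u), c ∂(angularLaw (k + 1)) := lintegral_mono hc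
    _ = _ := by rw [lintegral_const, Measure.restrict_apply_univ]

/-- If the first direction lies in a slightly smaller cap around `θ`, the constraints between the
other points and `θ` follow from the triangle inequality. -/
theorem le_angularProb {k r : ℕ} {R u ρ : ℝ} (θ : Sph (k + 1)) (t : Fin (r + 1) → ℝ)
    {c : ℝ≥0∞} (hρ : ρ ≤ chord R (t 0) u)
    (hρ' : ∀ i, ρ + chordFirst R t i ≤ chord R (t (Fin.succ i)) u)
    (hc : ∀ e : Sph (k + 1), c ≤ starProb e (chordFirst R t) (chordRest R t)) :
    c * angularLaw (k + 1) (cap θ ρ) ≤ angularProb R u θ t := by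
  calc c * angularLaw (k + 1) (cap θ ρ) = ∫⁻ _ in cap θ ρ, c ∂(angularLaw (k + 1)) := by
        rw [lintegral_const, Measure.restrict_apply_univ]
    _ ≤ ∫⁻ e in cap θ ρ, starProb e (chordFirst R t) (chordRest R t) ∂(angularLaw (k + 1)) :=
        lintegral_mono hc
    _ = Measure.pi (fun _ : Fin (r + 1) => angularLaw (k + 1))
        {φ | φ 0 ∈ cap θ ρ ∧ (fun i : Fin r => (φ i.succ : E (k + 1))) ∈
          starSet (φ 0 : E (k + 1)) (chordFirst R t) (chordRest R t)} :=
        (pi_angularLaw_succ (measurableSet_cap _ _) _ _).symm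
    _ ≤ _ := by
        refine measure_mono ?_
        rintro φ ⟨h0, h1, h2⟩
        have h0' : ‖(φ 0 : E (k + 1)) - θ‖ ≤ ρ := h0
        constructor
        · refine Fin.cases (h0'.trans hρ) fun i => ?_
          have := norm_sub_le_norm_sub_add_norm_sub (φ i.succ : E (k + 1)) (φ 0) θ
          have := h1 i
          have := hρ' i
          simp only at *
          linarith
        · refine Fin.cases (Fin.cases ?_ fun j => ?_) fun i => Fin.cases (h1 i) fun j => h2 i j
          · rw [sub_self, norm_zero]
            exact chord_nonneg _ _ _
          · change ‖(φ 0 : E (k + 1)) - φ j.succ‖ ≤ chord R (t 0) (t j.succ)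
            rw [norm_sub_rev, chord_comm]
            exact h1 j

theorem exp_radius {k n : ℕ} (hk : 1 ≤ k) (hn : 1 ≤ n) :
    Real.exp (radius (k + 1) n / 2) ^ k = n := by
  have hk0 : (k : ℝ) ≠ 0 := by exact_mod_cast (by omega : k ≠ 0)
  have hn0 : (0 : ℝ) < n := by exact_mod_cast hn
  rw [← Real.exp_nat_mul, radius]
  push_cast
  rw [show (k : ℝ) * (2 / ((k : ℝ) + 1 - 1) * Real.log n / 2) = Real.log n by
    rw [add_sub_cancel_right]; field_simp]
  exact Real.exp_log hn0

theorem radius_pos {k n : ℕ} (hk : 1 ≤ k) (hn : 2 ≤ n) : 0 < radius (k + 1) n := by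
  have hk0 : (0 : ℝ) < k := by exact_mod_cast hk
  rw [radius]
  push_cast
  rw [add_sub_cancel_right]
  have : 0 < Real.log n := Real.log_pos (by exact_mod_cast hn)
  positivity

theorem radius_mono {k n n' : ℕ} (hn : 1 ≤ n) (h : n ≤ n') :
    radius (k + 1) n ≤ radius (k + 1) n' := by
  rw [radius, radius]
  push_cast
  rw [add_sub_cancel_right]
  have h1 : (0 : ℝ) < n := by exact_mod_cast hn
  have h2 : (n : ℝ) ≤ n' := by exact_mod_cast h
  gcongr

theorem tendsto_radius {k : ℕ} (hk : 1 ≤ k) : Tendsto (radius (k + 1)) atTop atTop := by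
  have hk0 : (0 : ℝ) < k := by exact_mod_cast hk
  have h : (0 : ℝ) < 2 / (((k + 1 : ℕ) : ℝ) - 1) := by
    push_cast
    rw [add_sub_cancel_right]
    positivity
  exact (Real.tendsto_log_atTop.comp tendsto_natCast_atTop_atTop).const_mul_atTop h

/-- As `e^{kR/2} = n`, the factor `e^{-R/2}` in the leading term of a chord contributes a factor
`1/n` to the area of a cap. -/
theorem mul_exp_sub_pow {k n : ℕ} (hk : 1 ≤ k) (hn : 1 ≤ n) (c x : ℝ) :
    (c * Real.exp ((x - radius (k + 1) n) / 2)) ^ k = c ^ k * Real.exp (k * x / 2) / n := by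
  have h : Real.exp ((x - radius (k + 1) n) / 2) =
      Real.exp (x / 2) / Real.exp (radius (k + 1) n / 2) := by
    rw [← Real.exp_sub]; congr 1; ring
  rw [h, mul_pow, div_pow, exp_radius hk hn, ← Real.exp_nat_mul]
  rw [show (k : ℝ) * (x / 2) = k * x / 2 by ring]
  ring

/-- The exponential factors of the integrand of `ℓ`. -/
noncomputable def expFactor (k r : ℕ) (α : ℝ) (t : Fin (r + 1) → ℝ) : ℝ :=
  Real.exp (k * (1 - 2 * α) * t 0 / 2) * ∏ i : Fin r, Real.exp (-(α * k * t i.succ))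

theorem expFactor_pos (k r : ℕ) (α : ℝ) (t : Fin (r + 1) → ℝ) : 0 < expFactor k r α t := by
  unfold expFactor
  positivity

/-- The bookkeeping of the powers of `n`: they cancel. -/
theorem mul_density_mul_eq {k r n : ℕ} (hn : 1 ≤ n) {α A B D u : ℝ} (hα : 0 < α) (hA : 0 ≤ A)
    (hB : 0 ≤ B) (hD : 0 ≤ D) (t : Fin (r + 1) → ℝ) (V : ℝ≥0∞) :
    (n : ℝ≥0∞) ^ (r + 1) * ((∏ i, ENNReal.ofReal (A * (α * k * Real.exp (-(α * k * t i))))) *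
      (ENNReal.ofReal (D / n ^ r) * V * ENNReal.ofReal (B * Real.exp (k * (t 0 + u) / 2) / n))) =
      ENNReal.ofReal ((A * (α * k)) ^ (r + 1) * B * D * Real.exp (k * u / 2)) *
        (ENNReal.ofReal (expFactor k r α t) * V) := by
  have hn0 : (0 : ℝ) < n := by exact_mod_cast hn
  have h1 := expFactor_pos k r α t
  rw [← ENNReal.ofReal_prod_of_nonneg fun i _ => by positivity, ← ENNReal.ofReal_natCast,
    ← ENNReal.ofReal_pow hn0.le]
  rw [show ∀ a b c d : ℝ≥0∞, a * (b * (c * V * d)) = a * b * c * d * V by intros; ring,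
    ← mul_assoc, ← ENNReal.ofReal_mul (by positivity), ← ENNReal.ofReal_mul (by positivity),
    ← ENNReal.ofReal_mul (by positivity), ← ENNReal.ofReal_mul (by positivity)]
  congr 2
  rw [Fin.prod_univ_succ, Finset.prod_mul_distrib, Finset.prod_mul_distrib, Finset.prod_const,
    Finset.prod_const, Finset.card_univ, Fintype.card_fin, expFactor]
  have h2 : Real.exp (-(α * k * t 0)) * Real.exp (k * (t 0 + u) / 2) =
      Real.exp (k * (1 - 2 * α) * t 0 / 2) * Real.exp (k * u / 2) := by
    rw [← Real.exp_add, ← Real.exp_add]; congr 1; ring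
  calc _ = ((n : ℝ) ^ r / n ^ r) * (n / n) * ((A * (α * k)) ^ (r + 1) * B * D *
        (∏ i : Fin r, Real.exp (-(α * k * t i.succ))) *
        (Real.exp (-(α * k * t 0)) * Real.exp (k * (t 0 + u) / 2))) := by ring
    _ = _ := by
      rw [h2, div_self (by positivity), div_self (by positivity)]
      ring

theorem starKernel_eq (k r : ℕ) (α : ℝ) (t : Fin (r + 1) → ℝ) :
    starKernel k r α t = ENNReal.ofReal (expFactor k r α t) *
      ENNReal.ofReal (∏ i : Fin r, Real.exp (k * (t 0 + t i.succ) / 2)) := by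
  rw [starKernel, expFactor, ← ENNReal.ofReal_mul (by positivity)]
  congr 1
  rw [mul_assoc, ← Finset.prod_mul_distrib, ← Real.exp_sum, ← Real.exp_add]
  simp only [← Real.exp_add]
  rw [← Real.exp_sum, ← Real.exp_add]
  congr 1
  have : ∑ i : Fin r, (-(α * k * t i.succ) + k * (t 0 + t i.succ) / 2) =
      r * (k * t 0 / 2) + ∑ i : Fin r, -(k * (2 * α - 1) / 2 * t i.succ) := by
    rw [show (r : ℝ) * (k * t 0 / 2) = ∑ _i : Fin r, k * t 0 / 2 by simp,
      ← Finset.sum_add_distrib]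
    exact Finset.sum_congr rfl fun i _ => by ring
  rw [this]
  ring

theorem cap_chord_subset {k : ℕ} {R s t : ℝ} (hs : s ∈ Ico 0 R) (ht : t ∈ Ico 0 R)
    (e : Sph (k + 1)) : cap e (chord R s t) ⊆ cap e (4 * Real.exp ((s + t - R) / 2)) := by
  intro θ hθ
  have h1 : ‖(θ : E (k + 1)) - e‖ ≤ chord R s t := hθ
  have h2 : ‖(θ : E (k + 1)) - e‖ ≤ 2 := by
    have := norm_sub_le (θ : E (k + 1)) e
    have h3 : ‖(θ : E (k + 1))‖ = 1 := by simp
    have h4 : ‖(e : E (k + 1))‖ = 1 := by simp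
    linarith
  exact (le_min h1 h2).trans (min_chord_two_le hs ht)

/-- A bound on the integrand of the expected clique count that is uniform in the whole range of
the parameters. -/
theorem exists_integrand_le_starKernel {k r : ℕ} (hk : 1 ≤ k) {α : ℝ} (hα : 0 < α) :
    ∃ C : ℝ, 0 < C ∧ ∀ n : ℕ, 2 ≤ n → ∀ u ∈ Ioo 0 (radius (k + 1) n), ∀ θ : Sph (k + 1),
      ∀ t ∈ simplex r u, (n : ℝ≥0∞) ^ (r + 1) *
        ((∏ i, ENNReal.ofReal (radialDensity (k + 1) α n (t i))) *
          angularProb (radius (k + 1) n) u θ t) ≤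
        ENNReal.ofReal (C * Real.exp (k * u / 2)) * starKernel k r α t := by
  have hk0 : (0 : ℝ) < k := by exact_mod_cast hk
  obtain ⟨c, hc, hcap⟩ := exists_angularLaw_cap_le k
  set N := normFactor k α (radius (k + 1) 2)
  have hN : 0 < N := normFactor_pos hk hα (radius_pos hk le_rfl)
  refine ⟨(N⁻¹ * (α * k)) ^ (r + 1) * (c * 4 ^ k) * (c * 4 ^ k) ^ r, by positivity,
    fun n hn u hu θ t ht => ?_⟩
  have hn1 : 1 ≤ n := by omega
  have hn0 : (0 : ℝ) < n := by exact_mod_cast hn1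
  have ht' : ∀ i, t i ∈ Ico 0 (radius (k + 1) n) := fun i =>
    ⟨(ht.2 i).1, (ht.2 i).2.trans_lt hu.2⟩
  have hR := radius_pos hk hn
  have hcap' : ∀ (e : Sph (k + 1)) (x y : ℝ), x ∈ Ico 0 (radius (k + 1) n) →
      y ∈ Ico 0 (radius (k + 1) n) → angularLaw (k + 1) (cap e (chord (radius (k + 1) n) x y)) ≤
        ENNReal.ofReal (c * 4 ^ k * Real.exp (k * (x + y) / 2) / n) := by
    intro e x y hx hy
    refine (measure_mono (cap_chord_subset hx hy e)).trans ((hcap e _ (by positivity)).trans ?_)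
    rw [mul_exp_sub_pow hk hn1]
    exact ENNReal.ofReal_le_ofReal (le_of_eq (by ring))
  have hdens : ∀ i, ENNReal.ofReal (radialDensity (k + 1) α n (t i)) ≤
      ENNReal.ofReal (N⁻¹ * (α * k * Real.exp (-(α * k * t i)))) := by
    intro i
    refine ENNReal.ofReal_le_ofReal ((radialDensity_le hk hα hR (ht' i).2.le).trans ?_)
    refine mul_le_mul_of_nonneg_right (inv_anti₀ hN ?_) (by positivity)
    exact normFactor_mono hα (radius_pos hk le_rfl).le (radius_mono (by norm_num) hn)
  have hstar : ∀ e : Sph (k + 1), starProb e (chordFirst (radius (k + 1) n) t)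
      (chordRest (radius (k + 1) n) t) ≤ ENNReal.ofReal ((c * 4 ^ k) ^ r / n ^ r) *
        ENNReal.ofReal (∏ i : Fin r, Real.exp (k * (t 0 + t i.succ) / 2)) := by
    intro e
    calc starProb e (chordFirst (radius (k + 1) n) t) (chordRest (radius (k + 1) n) t)
        ≤ Measure.pi (fun _ : Fin r => angularLaw (k + 1))
            (univ.pi fun i => cap e (chord (radius (k + 1) n) (t (Fin.succ i)) (t 0))) :=
          measure_mono fun φ hφ i _ => hφ.1 i
      _ ≤ ∏ i : Fin r, ENNReal.ofReal
            (c * 4 ^ k * Real.exp (k * (t (Fin.succ i) + t 0) / 2) / n) := by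
          rw [Measure.pi_pi]
          exact Finset.prod_le_prod' fun i _ => hcap' e _ _ (ht' _) (ht' _)
      _ = _ := by
          rw [← ENNReal.ofReal_prod_of_nonneg fun i _ => by positivity,
            ← ENNReal.ofReal_mul (by positivity)]
          congr 1
          have : (c * 4 ^ k) ^ r / (n : ℝ) ^ r = ∏ _i : Fin r, c * 4 ^ k / n := by
            rw [Finset.prod_const, Finset.card_univ, Fintype.card_fin, div_pow]
          rw [this, ← Finset.prod_mul_distrib]
          exact Finset.prod_congr rfl fun i _ => by rw [add_comm (t 0)]; ring
  rw [starKernel_eq, ← mul_density_mul_eq hn1 hα (inv_nonneg.2 hN.le) (by positivity)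
    (by positivity)]
  refine mul_le_mul_right (mul_le_mul' (Finset.prod_le_prod' fun i _ => hdens i) ?_) _
  refine (angularProb_le _ u θ t hstar).trans (mul_le_mul_right ?_ _)
  exact hcap' θ _ _ (ht' 0) ⟨hu.1.le, hu.2⟩

/-! ### Sharp bounds for bounded radial coordinates -/

theorem volume_starSet_mul {k r : ℕ} {c : ℝ} (hc : 0 < c) (a : Fin r → ℝ)
    (b : Fin r → Fin r → ℝ) :
    volume (starSet (0 : E k) (fun i => c * a i) fun i j => c * b i j) =
      ENNReal.ofReal ((c ^ k) ^ r) * volume (starSet (0 : E k) a b) := by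
  have h : starSet (0 : E k) (fun i => c * a i) (fun i j => c * b i j) =
      (fun w : Fin r → E k => c⁻¹ • w) ⁻¹' starSet (0 : E k) a b := by
    ext w
    simp only [starSet, mem_ofPred_eq, mem_preimage, Pi.smul_apply, sub_zero, ← smul_sub,
      norm_smul, norm_inv, Real.norm_of_nonneg hc.le, inv_mul_le_iff₀ hc]
  rw [h, Measure.addHaar_preimage_smul _ (inv_ne_zero hc.ne')]
  congr 2
  rw [Module.finrank_pi_fintype]
  simp only [finrank_euclideanSpace_fin, Finset.sum_const, Finset.card_univ, Fintype.card_fin,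
    smul_eq_mul]
  rw [inv_pow, inv_inv, abs_of_pos (pow_pos hc _), ← pow_mul, mul_comm]

theorem K_eq (k r : ℕ) (α : ℝ) : K (k + 1) (r + 2) α =
    2 ^ k * xi (k + 1) * ((sphereArea (k + 1))⁻¹ * α * k) ^ (r + 1) := by
  have h : ((k + 1 : ℕ) : ℝ) - 1 = k := by push_cast; ring
  rw [K, h]
  rfl

theorem K_pos {k : ℕ} (hk : 1 ≤ k) (r : ℕ) {α : ℝ} (hα : 0 < α) : 0 < K (k + 1) (r + 2) α := by
  have hk0 : (0 : ℝ) < k := by exact_mod_cast hk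
  have := xi_pos k
  have := sphereArea_pos k
  rw [K_eq]
  positivity

/-- The hyperbolic quantities at a radius `R` agree with their limits up to a relative error `ε`,
as long as the radial coordinates are at most `γ R`, and one of them at most `T`. -/
structure Approx (k : ℕ) (α γ T ε R : ℝ) : Prop where
  pos : 0 < R
  T_le : T ≤ γ * R
  le_chord : ∀ s ∈ Icc 0 (γ * R), ∀ t ∈ Icc 0 (γ * R),
    (1 - ε) * (2 * Real.exp ((s + t - R) / 2)) ≤ chord R s t
  chord_le : ∀ s ∈ Icc 0 (γ * R), ∀ t ∈ Icc 0 (γ * R),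
    chord R s t ≤ (1 + ε) * (2 * Real.exp ((s + t - R) / 2))
  chord_small : ∀ s ∈ Icc 0 (γ * R), ∀ t ∈ Icc 0 (γ * R), s ≤ T → chord R s t ≤ ε
  norm_le : (normFactor k α R)⁻¹ ≤ 1 + ε
  le_pow : ∀ t ∈ Icc 0 T, 1 - ε ≤ (1 - Real.exp (-(2 * (α * (R - t))))) ^ k

theorem eventually_approx {k : ℕ} (hk : 1 ≤ k) {α γ T ε : ℝ} (hα : 0 < α) (hγ0 : 0 < γ)
    (hγ : γ < 1) (hε : 0 < ε) : ∀ᶠ R in atTop, Approx k α γ T ε R := by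
  have hexp : ∀ c : ℝ, 0 < c → ∀ b : ℝ,
      Tendsto (fun R : ℝ => Real.exp (b - c * R)) atTop (𝓝 0) := by
    intro c hc b
    refine Real.tendsto_exp_atBot.comp ?_
    exact tendsto_atBot_add_const_left _ b
      (tendsto_neg_atTop_atBot.comp (tendsto_id.const_mul_atTop hc))
  have hγ1 : 0 < 1 - γ := by linarith
  -- The lower bound on chords.
  have e1 : ∀ᶠ R in atTop, 2 * Real.exp (0 - (1 - γ) * R) < ε := by
    have := (hexp (1 - γ) hγ1 0).const_mul 2
    rw [mul_zero] at this
    exact this.eventually_lt_const hε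
  -- The upper bound on chords.
  have e2 : ∀ᶠ R in atTop, (1 - Real.exp (0 - 2 * (1 - γ) * R))⁻¹ < 1 + ε := by
    have := ((hexp (2 * (1 - γ)) (by linarith) 0).const_sub 1).inv₀ (by norm_num)
    rw [sub_zero, inv_one] at this
    exact this.eventually_lt_const (by linarith)
  have e3 : ∀ᶠ R in atTop, (1 + ε) * (2 * Real.exp (T / 2 - (1 - γ) / 2 * R)) < ε := by
    have := ((hexp ((1 - γ) / 2) (by linarith) (T / 2)).const_mul 2).const_mul (1 + ε)
    rw [mul_zero, mul_zero] at this
    exact this.eventually_lt_const hε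
  have e4 : ∀ᶠ R in atTop, (normFactor k α R)⁻¹ < 1 + ε := by
    have := (tendsto_normFactor hk hα).inv₀ one_ne_zero
    rw [inv_one] at this
    exact this.eventually_lt_const (by linarith)
  have e5 : ∀ᶠ R in atTop, 1 - ε < (1 - Real.exp (2 * α * T - 2 * α * R)) ^ k := by
    have := ((hexp (2 * α) (by linarith) (2 * α * T)).const_sub 1).pow k
    rw [sub_zero, one_pow] at this
    exact this.eventually_const_lt (by linarith)
  have e6 : ∀ᶠ R in atTop, T ≤ γ * R :=
    (tendsto_id.const_mul_atTop hγ0).eventually_ge_atTop T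
  filter_upwards [e1, e2, e3, e4, e5, e6, eventually_gt_atTop 0, eventually_ge_atTop T]
    with R h1 h2 h3 h4 h5 h6 h7 h8
  have hγR : γ * R < R := by nlinarith
  have hup : ∀ s ∈ Icc 0 (γ * R), ∀ t ∈ Icc 0 (γ * R),
      chord R s t ≤ (1 + ε) * (2 * Real.exp ((s + t - R) / 2)) := by
    intro s hs t ht
    set D := 1 - Real.exp (0 - 2 * (1 - γ) * R)
    have hD : 0 < D := by
      have : Real.exp (0 - 2 * (1 - γ) * R) < 1 := Real.exp_lt_one_iff.2 (by nlinarith)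
      simp only [D]
      linarith
    have hD' : ∀ x ∈ Icc 0 (γ * R), D ≤ 1 - Real.exp (-(2 * (R - x))) := by
      intro x hx
      have : Real.exp (-(2 * (R - x))) ≤ Real.exp (0 - 2 * (1 - γ) * R) :=
        Real.exp_le_exp.2 (by linarith [hx.2])
      simp only [D]
      linarith
    refine (chord_le_of_le hD ⟨hs.1, hs.2.trans hγR.le⟩ ⟨ht.1, ht.2.trans hγR.le⟩ (hD' s hs)
      (hD' t ht)).trans ?_
    rw [div_eq_inv_mul]
    exact mul_le_mul_of_nonneg_right h2.le (by positivity)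
  refine ⟨h7, h6, fun s hs t ht => ?_, hup, fun s hs t ht hsT => ?_, h4.le, fun t ht => ?_⟩
  · refine le_trans ?_ (le_chord (c := (1 - γ) * R) ⟨hs.1, hs.2.trans_lt hγR⟩
      ⟨ht.1, ht.2.trans_lt hγR⟩ (by linarith [hs.2, ht.1]) (by linarith [ht.2, hs.1]))
    refine mul_le_mul_of_nonneg_right ?_ (by positivity)
    rw [zero_sub] at h1
    linarith
  · refine (hup s hs t ht).trans (le_trans ?_ h3.le)
    gcongr
    linarith [ht.2]
  · refine h5.le.trans (pow_le_pow_left₀ ?_ ?_ k)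
    · have : Real.exp (2 * α * T - 2 * α * R) ≤ 1 := Real.exp_le_one_iff.2 (by nlinarith)
      linarith
    · have : Real.exp (-(2 * (α * (R - t)))) ≤ Real.exp (2 * α * T - 2 * α * R) :=
        Real.exp_le_exp.2 (by nlinarith [ht.2])
      linarith

/-- The relative error of the upper bound for the integrand. -/
noncomputable def upperFactor (k r : ℕ) (ε : ℝ) : ℝ :=
  (1 + ε) ^ (r + 1) * ((((1 - ε) ^ 2)⁻¹ * (1 + ε)) ^ k) ^ (r + 1)

/-- The relative error of the lower bound for the integrand, apart from the error that comes from
the constraints between the root and the points after the first one. -/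
noncomputable def lowerFactor (k r : ℕ) (ε : ℝ) : ℝ :=
  (1 - ε) ^ (r + 1) * (((1 + ε)⁻¹) ^ (k + 1)) ^ (r + 1) * ((1 - ε) ^ k) ^ r

theorem two_exp_div {R : ℝ} (c x : ℝ) :
    c * Real.exp (-(R / 2)) * (2 * Real.exp (x / 2)) = c * (2 * Real.exp ((x - R) / 2)) := by
  have : Real.exp ((x - R) / 2) = Real.exp (-(R / 2)) * Real.exp (x / 2) := by
    rw [← Real.exp_add]; congr 1; ring
  rw [this]
  ring

theorem mul_exp_neg_radius_pow {k r n : ℕ} (hk : 1 ≤ k) (hn : 1 ≤ n) (c : ℝ) :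
    ((c * Real.exp (-(radius (k + 1) n / 2))) ^ k) ^ r = (c ^ k) ^ r / n ^ r := by
  rw [Real.exp_neg, mul_pow, inv_pow, exp_radius hk hn, ← div_eq_mul_inv, div_pow]

theorem integrand_le {k r n : ℕ} (hk : 1 ≤ k) (hn : 1 ≤ n) {α γ T ε u : ℝ} (hα : 0 < α)
    (hε : 0 < ε) (hε1 : ε < 1) (hR : Approx k α γ T ε (radius (k + 1) n))
    (hu : u ∈ Ioo 0 (γ * radius (k + 1) n)) (θ : Sph (k + 1))
    (huR : u < radius (k + 1) n) {t : Fin (r + 1) → ℝ} (ht : t ∈ simplex r (min u T)) :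
    (n : ℝ≥0∞) ^ (r + 1) * ((∏ i, ENNReal.ofReal (radialDensity (k + 1) α n (t i))) *
        angularProb (radius (k + 1) n) u θ t) ≤
      ENNReal.ofReal (upperFactor k r ε * K (k + 1) (r + 2) α * Real.exp (k * u / 2)) *
        ellIntegrand (k + 1) (r + 2) α t := by
  have hs := sphereArea_pos k
  have hξ := xi_pos k
  have hn0 : (0 : ℝ) < n := by exact_mod_cast hn
  have ht' : ∀ i, t i ∈ Icc 0 (γ * radius (k + 1) n) := fun i =>
    ⟨(ht.2 i).1, ((ht.2 i).2.trans (min_le_left _ _)).trans hu.2.le⟩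
  have htT : ∀ i, t i ≤ T := fun i => (ht.2 i).2.trans (min_le_right _ _)
  have hu' : u ∈ Icc 0 (γ * radius (k + 1) n) := ⟨hu.1.le, hu.2.le⟩
  set κ := ((1 - ε) ^ 2)⁻¹ with hκ
  have hκ0 : 0 < κ := inv_pos.2 (pow_pos (by linarith) 2)
  set R := radius (k + 1) n with hRdef
  set c := κ * (1 + ε) * Real.exp (-(R / 2)) with hc
  have hc0 : 0 < c := by positivity
  have hdens : ∀ i, ENNReal.ofReal (radialDensity (k + 1) α n (t i)) ≤
      ENNReal.ofReal ((1 + ε) * (α * k * Real.exp (-(α * k * t i)))) := by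
    intro i
    refine ENNReal.ofReal_le_ofReal ((radialDensity_le hk hα hR.pos ?_).trans ?_)
    · exact ((ht.2 i).2.trans (min_le_left _ _)).trans huR.le
    · exact mul_le_mul_of_nonneg_right hR.norm_le (by positivity)
  have hsc : ∀ x y : ℝ, x ∈ Icc 0 (γ * R) → y ∈ Icc 0 (γ * R) →
      κ * chord R x y ≤ c * (2 * Real.exp ((x + y) / 2)) := by
    intro x y hx hy
    rw [hc, two_exp_div, mul_assoc]
    exact mul_le_mul_of_nonneg_left (hR.chord_le x hx y hy) hκ0.le
  have hstar : ∀ e : Sph (k + 1), starProb e (chordFirst R t) (chordRest R t) ≤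
      ENNReal.ofReal (((sphereArea (k + 1))⁻¹) ^ r * ((κ * (1 + ε)) ^ k) ^ r / n ^ r) *
        volume (flatSet k r t) := by
    intro e
    refine (pi_angularLaw_starSet_le e hε.le hε1 _ _ fun i =>
      hR.chord_small _ (ht' _) _ (ht' _) (htT _)).trans ?_
    have hsub : volume (starSet (0 : E k) (fun i => κ * chordFirst R t i)
        fun i j => κ * chordRest R t i j) ≤
        volume (starSet (0 : E k) (fun i => c * (2 * Real.exp ((t 0 + t (Fin.succ i)) / 2)))
          fun i j => c * (2 * Real.exp ((t (Fin.succ i) + t (Fin.succ j)) / 2))) := by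
      refine measure_mono fun w hw => ⟨fun i => (hw.1 i).trans ?_, fun i j => (hw.2 i j).trans ?_⟩
      · have := hsc (t i.succ) (t 0) (ht' _) (ht' _)
        rwa [add_comm (t i.succ)] at this
      · exact hsc _ _ (ht' _) (ht' _)
    refine (mul_le_mul_right hsub _).trans (le_of_eq ?_)
    rw [volume_starSet_mul hc0, ← ENNReal.ofReal_pow (by positivity), ← mul_assoc,
      ← ENNReal.ofReal_mul (by positivity), hc, mul_exp_neg_radius_pow hk hn, mul_div_assoc]
    rfl
  have hcap : angularLaw (k + 1) (cap θ (chord R (t 0) u)) ≤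
      ENNReal.ofReal ((sphereArea (k + 1))⁻¹ * (xi (k + 1) * (2 ^ k * (κ * (1 + ε)) ^ k)) *
        Real.exp (k * (t 0 + u) / 2) / n) := by
    refine (angularLaw_cap_le θ (chord_nonneg _ _ _)
      (hR.chord_small _ (ht' 0) _ hu' (htT 0)) hε1).trans (ENNReal.ofReal_le_ofReal ?_)
    have h1 : (κ * chord R (t 0) u) ^ k ≤
        (κ * (1 + ε)) ^ k * 2 ^ k * Real.exp (k * (t 0 + u) / 2) / n := by
      have h2 : κ * chord R (t 0) u ≤ (κ * (1 + ε) * 2) * Real.exp ((t 0 + u - R) / 2) := by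
        have := mul_le_mul_of_nonneg_left (hR.chord_le _ (ht' 0) _ hu') hκ0.le
        linarith
      refine (pow_le_pow_left₀ (mul_nonneg hκ0.le (chord_nonneg _ _ _)) h2 k).trans (le_of_eq ?_)
      rw [hRdef, mul_exp_sub_pow hk hn, mul_pow _ 2]
    calc (sphereArea (k + 1))⁻¹ * (xi (k + 1) * (κ * chord R (t 0) u) ^ k)
        ≤ (sphereArea (k + 1))⁻¹ * (xi (k + 1) *
          ((κ * (1 + ε)) ^ k * 2 ^ k * Real.exp (k * (t 0 + u) / 2) / n)) := by gcongr
      _ = _ := by ring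
  refine (mul_le_mul_right (mul_le_mul' (Finset.prod_le_prod' fun i _ => hdens i)
    ((angularProb_le R u θ t hstar).trans (mul_le_mul_right hcap _))) _).trans ?_
  rw [mul_density_mul_eq hn hα (by positivity) (by positivity) (by positivity), ellIntegrand_eq,
    expFactor]
  refine le_of_eq ?_
  congr 2
  rw [K_eq, upperFactor, ← hκ]
  generalize 1 + ε = A
  generalize κ * A = B
  ring

theorem le_integrand {k r n : ℕ} (hk : 1 ≤ k) (hn : 1 ≤ n) {α γ T ε δ u : ℝ} (hα : 0 < α)
    (hε : 0 < ε) (hε1 : ε < 1) (hδ : 0 < δ) (hR : Approx k α γ T ε (radius (k + 1) n))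
    (hu : u ∈ Ioo 0 (γ * radius (k + 1) n)) (θ : Sph (k + 1))
    (huR : u < radius (k + 1) n) (hx : 0 ≤ 1 - ε - 2 * Real.exp (-(δ * u / 2)))
    {t : Fin (r + 1) → ℝ} (ht : t ∈ simplex r (min ((1 - δ) * u) T)) :
    ENNReal.ofReal (lowerFactor k r ε * (1 - ε - 2 * Real.exp (-(δ * u / 2))) ^ k *
        K (k + 1) (r + 2) α * Real.exp (k * u / 2)) * ellIntegrand (k + 1) (r + 2) α t ≤
      (n : ℝ≥0∞) ^ (r + 1) * ((∏ i, ENNReal.ofReal (radialDensity (k + 1) α n (t i))) *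
        angularProb (radius (k + 1) n) u θ t) := by
  have hs := sphereArea_pos k
  have hξ := xi_pos k
  have hn0 : (0 : ℝ) < n := by exact_mod_cast hn
  have htv : ∀ i, t i ≤ (1 - δ) * u := fun i => (ht.2 i).2.trans (min_le_left _ _)
  have hvu : (1 - δ) * u ≤ u := by nlinarith [hu.1]
  have ht' : ∀ i, t i ∈ Icc 0 (γ * radius (k + 1) n) := fun i =>
    ⟨(ht.2 i).1, ((htv i).trans hvu).trans hu.2.le⟩
  have htT : ∀ i, t i ≤ T := fun i => (ht.2 i).2.trans (min_le_right _ _)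
  have hu' : u ∈ Icc 0 (γ * radius (k + 1) n) := ⟨hu.1.le, hu.2.le⟩
  set x := 1 - ε - 2 * Real.exp (-(δ * u / 2)) with hxdef
  set R := radius (k + 1) n with hRdef
  have hε2 : 0 < 1 - ε := by linarith
  set c := (1 - ε) * Real.exp (-(R / 2)) with hc
  have hc0 : 0 < c := by positivity
  have hdens : ∀ i, ENNReal.ofReal ((1 - ε) * (α * k * Real.exp (-(α * k * t i)))) ≤
      ENNReal.ofReal (radialDensity (k + 1) α n (t i)) := by
    intro i
    refine ENNReal.ofReal_le_ofReal (le_trans ?_ (le_radialDensity hk hα hR.pos ?_))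
    · exact mul_le_mul_of_nonneg_right (hR.le_pow _ ⟨(ht' i).1, htT i⟩) (by positivity)
    · exact ((htv i).trans hvu).trans huR.le
  have hsc : ∀ x y : ℝ, x ∈ Icc 0 (γ * R) → y ∈ Icc 0 (γ * R) →
      c * (2 * Real.exp ((x + y) / 2)) ≤ chord R x y := by
    intro x y hx hy
    rw [hc, two_exp_div]
    exact hR.le_chord x hx y hy
  have hstar : ∀ e : Sph (k + 1),
      ENNReal.ofReal (((sphereArea (k + 1))⁻¹ * ((1 + ε)⁻¹) ^ (k + 1)) ^ r *
        ((1 - ε) ^ k) ^ r / n ^ r) * volume (flatSet k r t) ≤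
      starProb e (chordFirst R t) (chordRest R t) := by
    intro e
    refine le_trans ?_ (le_pi_angularLaw_starSet e hε.le _ _ fun i =>
      hR.chord_small _ (ht' _) _ (ht' _) (htT _))
    have hsub : volume (starSet (0 : E k)
          (fun i => c * (2 * Real.exp ((t 0 + t (Fin.succ i)) / 2)))
          fun i j => c * (2 * Real.exp ((t (Fin.succ i) + t (Fin.succ j)) / 2))) ≤
        volume (starSet (0 : E k) (chordFirst R t) (chordRest R t)) := by
      refine measure_mono fun w hw => ⟨fun i => (hw.1 i).trans ?_, fun i j => (hw.2 i j).trans ?_⟩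
      · have := hsc (t i.succ) (t 0) (ht' _) (ht' _)
        rwa [add_comm (t i.succ)] at this
      · exact hsc _ _ (ht' _) (ht' _)
    refine le_trans (le_of_eq ?_) (mul_le_mul_right hsub _)
    rw [volume_starSet_mul hc0, ← ENNReal.ofReal_pow (by positivity), ← mul_assoc,
      ← ENNReal.ofReal_mul (by positivity), hc, mul_exp_neg_radius_pow hk hn, mul_div_assoc]
    rfl
  set ρ := x * 2 * Real.exp ((t 0 + u - R) / 2) with hρ
  have hρ0 : 0 ≤ ρ := by positivity
  -- The triangle inequality leaves room for the constraints, as the points after the first one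
  -- are much closer to the boundary than the root.
  have hρi : ∀ y ∈ Icc 0 (γ * R), t 0 ≤ y → y ≤ (1 - δ) * u →
      ρ + (1 + ε) * (2 * Real.exp ((y + t 0 - R) / 2)) ≤ chord R y u := by
    intro y hy h0y hyv
    refine le_trans ?_ (hR.le_chord y hy u hu')
    have h1 : Real.exp (-(δ * u / 2)) * Real.exp ((t 0 + u - R) / 2) =
        Real.exp ((t 0 + (1 - δ) * u - R) / 2) := by
      rw [← Real.exp_add]; congr 1; ring
    have h2 : Real.exp ((y + t 0 - R) / 2) ≤ Real.exp ((t 0 + (1 - δ) * u - R) / 2) :=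
      Real.exp_le_exp.2 (by linarith)
    have h3 : Real.exp ((t 0 + u - R) / 2) ≤ Real.exp ((y + u - R) / 2) :=
      Real.exp_le_exp.2 (by linarith)
    have h4 : ρ = (1 - ε) * (2 * Real.exp ((t 0 + u - R) / 2)) -
        4 * Real.exp ((t 0 + (1 - δ) * u - R) / 2) := by
      rw [← h1, hρ, hxdef]; ring
    have h5 := mul_le_mul_of_nonneg_left h3 hε2.le
    have h6 := Real.exp_pos ((y + t 0 - R) / 2)
    have h7 : (1 + ε) * (2 * Real.exp ((y + t 0 - R) / 2)) ≤
        4 * Real.exp ((y + t 0 - R) / 2) := by nlinarith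
    rw [h4]
    linarith
  have hρ1 : ρ ≤ chord R (t 0) u := by
    have h := hρi (t 0) (ht' 0) le_rfl (htv 0)
    have : 0 ≤ (1 + ε) * (2 * Real.exp ((t 0 + t 0 - R) / 2)) := by positivity
    linarith
  have hρ2 : ∀ i : Fin r, ρ + chordFirst R t i ≤ chord R (t i.succ) u := by
    intro i
    have h := hρi (t i.succ) (ht' _) (ht.1 (Fin.zero_le _)) (htv _)
    have h' := hR.chord_le (t i.succ) (ht' _) (t 0) (ht' 0)
    rw [chordFirst]
    linarith
  have hcap : ENNReal.ofReal ((sphereArea (k + 1))⁻¹ * (((1 + ε)⁻¹) ^ (k + 1) *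
      (xi (k + 1) * (2 ^ k * x ^ k))) * Real.exp (k * (t 0 + u) / 2) / n) ≤
      angularLaw (k + 1) (cap θ ρ) := by
    refine le_trans (ENNReal.ofReal_le_ofReal (le_of_eq ?_)) (le_angularLaw_cap θ hρ0
      (hρ1.trans (hR.chord_small _ (ht' 0) _ hu' (htT 0))))
    rw [hρ, hRdef, mul_exp_sub_pow hk hn, mul_pow x]
    ring
  refine le_trans ?_ (mul_le_mul_right (mul_le_mul' (Finset.prod_le_prod' fun i _ => hdens i)
    ((mul_le_mul_right hcap _).trans (le_angularProb θ t hρ1 hρ2 hstar))) _)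
  rw [mul_density_mul_eq hn hα hε2.le (by positivity) (by positivity), ellIntegrand_eq,
    expFactor]
  refine le_of_eq ?_
  congr 2
  rw [K_eq, lowerFactor]
  generalize 1 - ε = A
  generalize (1 + ε)⁻¹ = B
  ring

/-! ### Passing to the limit -/

/-- If every `η ∈ (0, 1)` is admissible for all large `n`, then there are admissible errors that
tend to `0`. -/
theorem exists_tendsto_zero {P : ℕ → ℝ → Prop}
    (h : ∀ η : ℝ, 0 < η → η < 1 → ∀ᶠ n in atTop, P n η) (h' : ∀ n, ∃ b : ℝ, 0 ≤ b ∧ P n b) :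
    ∃ ε : ℕ → ℝ, Tendsto ε atTop (𝓝 0) ∧ ∀ n, P n (ε n) := by
  have hbdd : ∀ n, BddBelow {b : ℝ | 0 ≤ b ∧ P n b} := fun n => ⟨0, fun b hb => hb.1⟩
  have hex : ∀ n : ℕ, ∃ b : ℝ, (0 ≤ b ∧ P n b) ∧
      b < sInf {b : ℝ | 0 ≤ b ∧ P n b} + 1 / ((n : ℝ) + 1) := by
    intro n
    obtain ⟨b, hb, hlt⟩ := exists_lt_of_csInf_lt (s := {b : ℝ | 0 ≤ b ∧ P n b}) (h' n)
      (lt_add_of_pos_right _ (by positivity : (0 : ℝ) < 1 / ((n : ℝ) + 1)))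
    exact ⟨b, hb, hlt⟩
  choose ε hε hεlt using hex
  refine ⟨ε, ?_, fun n => (hε n).2⟩
  rw [Metric.tendsto_nhds]
  intro η hη
  have h1 : 0 < min (η / 2) (1 / 2) := by positivity
  have h2 : min (η / 2) (1 / 2) < 1 := (min_le_right _ _).trans_lt (by norm_num)
  filter_upwards [h _ h1 h2,
    (tendsto_one_div_add_atTop_nhds_zero_nat (𝕜 := ℝ)).eventually_lt_const
      (by linarith : 0 < η / 2)] with n hn hn'
  rw [Real.dist_eq, sub_zero, abs_of_nonneg (hε n).1]
  have := csInf_le (hbdd n) ⟨h1.le, hn⟩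
  have := min_le_left (η / 2) (1 / 2)
  linarith [hεlt n]

theorem exists_lt_of_tendsto_zero {f : ℝ → ℝ} {a b : ℝ} (hf : ContinuousAt f 0) (h0 : f 0 = a)
    (hab : a < b) : ∃ ε : ℝ, 0 < ε ∧ ε < 1 ∧ f ε < b := by
  have h : ∀ᶠ x in 𝓝[>] (0 : ℝ), f x < b :=
    (hf.mono_left nhdsWithin_le_nhds).eventually_lt_const (by rwa [h0])
  obtain ⟨ε, h1, h2⟩ := (h.and (Ioo_mem_nhdsGT one_pos)).exists
  exact ⟨ε, h2.1, h2.2, h1⟩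

theorem exists_upperFactor_lt (k r : ℕ) {η : ℝ} (hη : 0 < η) :
    ∃ ε : ℝ, 0 < ε ∧ ε < 1 ∧ upperFactor k r ε < 1 + η := by
  refine exists_lt_of_tendsto_zero (a := 1) ?_ (by simp [upperFactor]) (by linarith)
  unfold upperFactor
  have : ContinuousAt (fun ε : ℝ => ((1 - ε) ^ 2)⁻¹) 0 :=
    ContinuousAt.inv₀ (by fun_prop) (by norm_num)
  fun_prop

theorem exists_lt_lowerFactor_mul (k r : ℕ) {η : ℝ} (hη : 0 < η) :
    ∃ ε : ℝ, 0 < ε ∧ ε < 1 ∧ 1 - η < lowerFactor k r ε * (1 - ε) ^ k := by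
  obtain ⟨ε, h0, h1, h⟩ := exists_lt_of_tendsto_zero
    (f := fun ε => -(lowerFactor k r ε * (1 - ε) ^ k)) (a := -1) (b := -1 + η)
    (by
      unfold lowerFactor
      have : ContinuousAt (fun ε : ℝ => (1 + ε)⁻¹) 0 :=
        ContinuousAt.inv₀ (by fun_prop) (by norm_num)
      fun_prop) (by simp [lowerFactor]) (by linarith)
  exact ⟨ε, h0, h1, by linarith⟩

theorem lowerFactor_nonneg {k r : ℕ} {ε : ℝ} (h0 : 0 < ε) (h1 : ε < 1) :
    0 ≤ lowerFactor k r ε := by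
  have : 0 < 1 - ε := by linarith
  unfold lowerFactor
  positivity

theorem lowerFactor_le_one {k r : ℕ} {ε : ℝ} (h0 : 0 < ε) (h1 : ε < 1) :
    lowerFactor k r ε ≤ 1 := by
  have h2 : 0 ≤ 1 - ε := by linarith
  have h3 : 1 - ε ≤ 1 := by linarith
  have h4 : 0 ≤ (1 + ε)⁻¹ := by positivity
  have h5 : (1 + ε)⁻¹ ≤ 1 := inv_le_one_of_one_le₀ (by linarith)
  unfold lowerFactor
  refine mul_le_one₀ (mul_le_one₀ (pow_le_one₀ h2 h3) (by positivity) ?_) (by positivity) ?_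
  · exact pow_le_one₀ (by positivity) (pow_le_one₀ h4 h5)
  · exact pow_le_one₀ (by positivity) (pow_le_one₀ h2 h3)

theorem pow_sub_le_pow_sub {a c : ℝ} (hc : 0 ≤ c) (hca : c ≤ a) (ha : a ≤ 1) (k : ℕ) :
    a ^ k - k * (a - c) ≤ c ^ k := by
  induction k with
  | zero => simp
  | succ k ih =>
    have h1 : a ^ k ≤ 1 := pow_le_one₀ (hc.trans hca) ha
    have h2 := mul_le_mul_of_nonneg_left ih hc
    have h3 : 0 ≤ (k : ℝ) * (a - c) := mul_nonneg k.cast_nonneg (by linarith)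
    rw [pow_succ, pow_succ]
    push_cast
    nlinarith

/-- The exponent `2r + 1 - (2r + 2) α` governs the tails; it is negative. -/
theorem tailExponent_neg {r : ℕ} {α : ℝ} (hα : (2 * r + 1 : ℝ) / (2 * r + 2) < α) :
    (2 * r + 1 - (2 * r + 2) * α : ℝ) < 0 := by
  rw [div_lt_iff₀ (by positivity)] at hα
  linarith

theorem pos_of_div_lt {r : ℕ} {α : ℝ} (hα : (2 * r + 1 : ℝ) / (2 * r + 2) < α) : 0 < α :=
  lt_trans (by positivity) hα

/-- The tuples with a coordinate above `T` contribute to `ν` at most an exponentially small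
multiple of its order of magnitude. -/
theorem exists_nu_le_add {k r : ℕ} (hk : 1 ≤ k) (hr : 1 ≤ r) {α : ℝ}
    (hα : (2 * r + 1 : ℝ) / (2 * r + 2) < α) (hα' : α < 1) :
    ∃ C : ℝ, 0 < C ∧ ∀ n : ℕ, 2 ≤ n → ∀ u ∈ Ioo 0 (radius (k + 1) n), ∀ θ : Sph (k + 1),
      ∀ T : ℝ, 0 ≤ T → nu (k + 1) (r + 2) α n u θ ≤
        (∫⁻ t in simplex r (min u T), (n : ℝ≥0∞) ^ (r + 1) *
          ((∏ i, ENNReal.ofReal (radialDensity (k + 1) α n (t i))) *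
            angularProb (radius (k + 1) n) u θ t)) +
        ENNReal.ofReal (C * Real.exp (k / 2 * ((2 * r + 1 - (2 * r + 2) * α) * T)) *
          Real.exp (k * u / 2)) := by
  obtain ⟨C₁, hC₁, h₁⟩ := exists_integrand_le_starKernel (r := r) hk (pos_of_div_lt hα)
  obtain ⟨C₂, hC₂, h₂⟩ := exists_lintegral_starKernel_le hk hr hα hα'
  refine ⟨C₁ * C₂, by positivity, fun n hn u hu θ T hT => ?_⟩
  have hn' : (n : ℝ≥0∞) ^ (r + 1) ≠ ∞ := ENNReal.pow_ne_top (ENNReal.natCast_ne_top n)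
  rw [nu_eq hk (pos_of_div_lt hα) (radius_pos hk hn) hu, ← lintegral_const_mul' _ _ hn']
  set g : (Fin (r + 1) → ℝ) → ℝ≥0∞ := fun t => (n : ℝ≥0∞) ^ (r + 1) *
    ((∏ i, ENNReal.ofReal (radialDensity (k + 1) α n (t i))) *
      angularProb (radius (k + 1) n) u θ t) with hg
  calc ∫⁻ t in simplex r u, g t
      = ∫⁻ t in simplex r u, (simplex r u).indicator g t :=
        setLIntegral_congr_fun (measurableSet_simplex r u) fun t ht =>
          (indicator_of_mem ht g).symm
    _ ≤ (∫⁻ t in simplex r (min u T), (simplex r u).indicator g t) +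
        ∫⁻ t in simplexTail r T, (simplex r u).indicator g t := lintegral_simplex_le r u T _
    _ ≤ (∫⁻ t in simplex r (min u T), g t) +
        ∫⁻ t in simplexTail r T, ENNReal.ofReal (C₁ * Real.exp (k * u / 2)) *
          starKernel k r α t := by
        refine add_le_add (lintegral_mono fun t => indicator_le_self _ _ t)
          (lintegral_mono fun t => indicator_apply_le' (fun ht => ?_) fun _ => zero_le)
        exact h₁ n hn u hu θ t ht
    _ ≤ _ := by
        rw [lintegral_const_mul' _ _ ENNReal.ofReal_ne_top]
        refine add_le_add le_rfl ((mul_le_mul_right (h₂ T hT) _).trans (le_of_eq ?_))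
        rw [← ENNReal.ofReal_mul (by positivity)]
        congr 1
        ring

theorem exists_nu_le {k r : ℕ} (hk : 1 ≤ k) (hr : 1 ≤ r) {α : ℝ}
    (hα : (2 * r + 1 : ℝ) / (2 * r + 2) < α) (hα' : α < 1) :
    ∃ C : ℝ, 0 < C ∧ ∀ n : ℕ, 1 ≤ n → ∀ u ∈ Ioo 0 (radius (k + 1) n), ∀ θ : Sph (k + 1),
      nu (k + 1) (r + 2) α n u θ ≤ ENNReal.ofReal (C * Real.exp (k * u / 2)) := by
  obtain ⟨C, hC, h⟩ := exists_nu_le_add hk hr hα hα'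
  refine ⟨C, hC, fun n hn u hu θ => ?_⟩
  obtain rfl | hn2 := hn.eq_or_lt
  · -- The radius is `0`, and there is no such `u`.
    have h1 := hu.1.trans hu.2
    simp [radius] at h1
  · refine (h n hn2 u hu θ 0 le_rfl).trans ?_
    rw [min_eq_right hu.1.le, setLIntegral_measure_zero _ _ (volume_simplex_zero r), zero_add]
    simp

theorem eventually_nu_le {k r : ℕ} (hk : 1 ≤ k) (hr : 1 ≤ r) {α γ η : ℝ}
    (hα : (2 * r + 1 : ℝ) / (2 * r + 2) < α) (hα' : α < 1) (hγ0 : 0 < γ) (hγ : γ < 1)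
    (hη : 0 < η) :
    ∀ᶠ n : ℕ in atTop, ∀ u ∈ Ioo 0 (γ * radius (k + 1) n), ∀ θ : Sph (k + 1),
      nu (k + 1) (r + 2) α n u θ ≤
        ENNReal.ofReal ((1 + η) * cliqueConst (k + 1) (r + 2) α * Real.exp (k * u / 2)) := by
  have hα0 := pos_of_div_lt hα
  have hK := K_pos hk r hα0
  have hk0 : (0 : ℝ) < k := by exact_mod_cast hk
  have hfin := ellInf_lt_top hk hr hα hα'
  have hL : 0 < (ellInf (k + 1) (r + 2) α).toReal :=
    ENNReal.toReal_pos (ellInf_pos k r α).ne' hfin.ne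
  obtain ⟨C, hC, hle⟩ := exists_nu_le_add hk hr hα hα'
  obtain ⟨ε, hε0, hε1, hεη⟩ := exists_upperFactor_lt k r (half_pos hη)
  have hβ := tailExponent_neg hα
  set β := (2 * r + 1 - (2 * r + 2) * α : ℝ) with hβdef
  obtain ⟨T, hT0, hT⟩ : ∃ T : ℝ, 0 ≤ T ∧
      C * Real.exp (k / 2 * (β * T)) < η / 2 * cliqueConst (k + 1) (r + 2) α := by
    have h1 : Tendsto (fun T : ℝ => C * Real.exp (k / 2 * (β * T))) atTop (𝓝 (C * 0)) := by
      refine Tendsto.const_mul C (Real.tendsto_exp_atBot.comp ?_)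
      exact (tendsto_id.const_mul_atTop_of_neg hβ).const_mul_atBot (by positivity)
    rw [mul_zero] at h1
    have h2 : 0 < η / 2 * cliqueConst (k + 1) (r + 2) α := by
      unfold cliqueConst
      positivity
    obtain ⟨T, h3, h4⟩ := ((eventually_ge_atTop 0).and (h1.eventually_lt_const h2)).exists
    exact ⟨T, h3, h4⟩
  filter_upwards [(tendsto_radius hk).eventually (eventually_approx (T := T) hk hα0 hγ0 hγ hε0),
    eventually_ge_atTop 2] with n hR hn u hu θ
  have huR : u < radius (k + 1) n := hu.2.trans (by nlinarith [hR.pos])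
  refine (hle n hn u ⟨hu.1, huR⟩ θ T hT0).trans ?_
  have hmain : (∫⁻ t in simplex r (min u T), (n : ℝ≥0∞) ^ (r + 1) *
      ((∏ i, ENNReal.ofReal (radialDensity (k + 1) α n (t i))) *
        angularProb (radius (k + 1) n) u θ t)) ≤
      ENNReal.ofReal ((1 + η / 2) * K (k + 1) (r + 2) α * Real.exp (k * u / 2)) *
        ENNReal.ofReal (ellInf (k + 1) (r + 2) α).toReal := by
    refine (setLIntegral_mono' (measurableSet_simplex r _) fun t ht =>
      integrand_le hk (by omega) hα0 hε0 hε1 hR hu θ huR ht).trans ?_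
    rw [lintegral_const_mul' _ _ ENNReal.ofReal_ne_top, ← ell_eq, ENNReal.ofReal_toReal hfin.ne]
    refine mul_le_mul' (ENNReal.ofReal_le_ofReal ?_) (ell_le_ellInf _ _ _ _)
    gcongr
  refine (add_le_add hmain le_rfl).trans ?_
  rw [← ENNReal.ofReal_mul (by positivity), ← ENNReal.ofReal_add (by positivity) (by positivity)]
  refine ENNReal.ofReal_le_ofReal ?_
  have h := mul_le_mul_of_nonneg_right hT.le (Real.exp_pos (k * u / 2)).le
  refine (add_le_add le_rfl h).trans (le_of_eq ?_)
  unfold cliqueConst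
  ring

theorem eventually_le_ell {k r : ℕ} (hk : 1 ≤ k) (hr : 1 ≤ r) {α η : ℝ}
    (hα : (2 * r + 1 : ℝ) / (2 * r + 2) < α) (hα' : α < 1) (hη : 0 < η) :
    ∀ᶠ T in atTop, (1 - η) * (ellInf (k + 1) (r + 2) α).toReal ≤
      (ell (k + 1) (r + 2) α T).toReal := by
  have hfin := ellInf_lt_top hk hr hα hα'
  have hL : 0 < (ellInf (k + 1) (r + 2) α).toReal :=
    ENNReal.toReal_pos (ellInf_pos k r α).ne' hfin.ne
  have h := (ENNReal.tendsto_toReal hfin.ne).comp (tendsto_ell (k + 1) (r + 2) α)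
  exact (h.eventually_const_lt (by nlinarith)).mono fun T hT => hT.le

/-- The numerical part of the lower bound. The factor `lo * x ^ k` is that of `le_integrand`; `a`,
`lv`, `lu` and `L` stand for `ℓ` at `min v T`, `v = (1 - δ) u`, `u` and `∞`, and `y`, `z` for
quantities below the first and the last term of `ℓ'(u)`. -/
theorem lower_arith {k : ℕ} {η lo b x y z a lv lu L C : ℝ} (hη0 : 0 < η) (hη1 : η < 1)
    (hlo0 : 0 ≤ lo) (hlo1 : lo ≤ 1) (hb1 : b ≤ 1) (hx : 0 ≤ x) (hxb : x = b - 2 * y)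
    (hy : 0 ≤ y) (hz : 0 ≤ z) (hlob : 1 - η ≤ lo * b ^ k) (ha : (1 - η) * lv ≤ a)
    (hlv : lu - C * z ≤ lv) (hlu : 0 ≤ lu) (hluL : lu ≤ L) (hC : 0 ≤ C) :
    (1 - 2 * η) * lu - (2 * k * L + C) * (y + z) ≤ lo * x ^ k * a := by
  have hk0 : (0 : ℝ) ≤ k := k.cast_nonneg
  set A := lo * x ^ k with hA
  have hx1 : x ≤ 1 := by linarith
  have hA0 : 0 ≤ A := by positivity
  have hA1 : A ≤ 1 := mul_le_one₀ hlo1 (by positivity) (pow_le_one₀ hx hx1)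
  have hAη : 1 - η - 2 * k * y ≤ A := by
    have h1 := mul_le_mul_of_nonneg_left (pow_sub_le_pow_sub hx (by linarith : x ≤ b) hb1 k) hlo0
    have h2 : lo * (2 * k * y) ≤ 1 * (2 * k * y) :=
      mul_le_mul_of_nonneg_right hlo1 (by positivity)
    rw [hxb] at h1
    rw [hA, hxb]
    linarith
  have hη2 : 0 ≤ 1 - η := by linarith
  have h1 : A * ((1 - η) * (lu - C * z)) ≤ A * a :=
    mul_le_mul_of_nonneg_left ((mul_le_mul_of_nonneg_left hlv hη2).trans ha) hA0
  have h2 : (1 - η - 2 * k * y) * ((1 - η) * lu) ≤ A * ((1 - η) * lu) :=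
    mul_le_mul_of_nonneg_right hAη (by positivity)
  have h3 : A * (1 - η) * (C * z) ≤ 1 * (C * z) :=
    mul_le_mul_of_nonneg_right (mul_le_one₀ hA1 hη2 (by linarith)) (by positivity)
  have h4 : 2 * k * y * ((1 - η) * lu) ≤ 2 * k * y * L := by
    refine mul_le_mul_of_nonneg_left ?_ (by positivity)
    nlinarith
  have h5 : 0 ≤ η ^ 2 * lu := by positivity
  have h6 : 0 ≤ 2 * k * L * z := by
    have : 0 ≤ L := hlu.trans hluL
    positivity
  have h7 : 0 ≤ C * y := by positivity
  nlinarith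

theorem exists_eventually_le_nu {k r : ℕ} (hk : 1 ≤ k) (hr : 1 ≤ r) {α γ δ : ℝ}
    (hα : (2 * r + 1 : ℝ) / (2 * r + 2) < α) (hα' : α < 1) (hγ0 : 0 < γ) (hγ : γ < 1)
    (hδ0 : 0 < δ) (hδ1 : δ < 1) :
    ∃ C : ℝ, 0 < C ∧ ∀ η : ℝ, 0 < η → η < 1 → ∀ᶠ n : ℕ in atTop,
      ∀ u ∈ Ioo 0 (γ * radius (k + 1) n), ∀ θ : Sph (k + 1),
        ENNReal.ofReal (max ((1 - η) * K (k + 1) (r + 2) α * (ell (k + 1) (r + 2) α u).toReal -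
          C * ellPrime (k + 1) (r + 2) α δ u) 0 * Real.exp (k * u / 2)) ≤
          nu (k + 1) (r + 2) α n u θ := by
  have hα0 := pos_of_div_lt hα
  have hK := K_pos hk r hα0
  have hk0 : (1 : ℝ) ≤ k := by exact_mod_cast hk
  have hfin := ellInf_lt_top hk hr hα hα'
  have hell : ∀ u, ell (k + 1) (r + 2) α u ≠ ∞ := fun u =>
    ((ell_le_ellInf _ _ _ u).trans_lt hfin).ne
  have hellmono : ∀ u v, u ≤ v → (ell (k + 1) (r + 2) α u).toReal ≤
      (ell (k + 1) (r + 2) α v).toReal := fun u v huv =>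
    ENNReal.toReal_mono (hell v) (ell_mono _ _ _ huv)
  set L := (ellInf (k + 1) (r + 2) α).toReal with hLdef
  have hL : 0 < L := ENNReal.toReal_pos (ellInf_pos k r α).ne' hfin.ne
  have hellL : ∀ u, (ell (k + 1) (r + 2) α u).toReal ≤ L := fun u =>
    ENNReal.toReal_mono hfin.ne (ell_le_ellInf _ _ _ u)
  obtain ⟨C, hC, hell_le⟩ := exists_ell_le hk hr hα hα'
  refine ⟨K (k + 1) (r + 2) α * (2 * k * L + C), by positivity, fun η hη0 hη1 => ?_⟩
  obtain ⟨ε, hε0, hε1, hεη⟩ := exists_lt_lowerFactor_mul k r (half_pos hη0)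
  obtain ⟨T, hT⟩ := (eventually_le_ell hk hr hα hα' (half_pos hη0)).exists
  filter_upwards [(tendsto_radius hk).eventually (eventually_approx (T := T) hk hα0 hγ0 hγ hε0),
    eventually_ge_atTop 2] with n hR hn u hu θ
  have huR : u < radius (k + 1) n := hu.2.trans (by nlinarith [hR.pos])
  have hv0 : 0 ≤ (1 - δ) * u := mul_nonneg (by linarith) hu.1.le
  have hvu : (1 - δ) * u ≤ u := by nlinarith [hu.1]
  have hlo0 := lowerFactor_nonneg (k := k) (r := r) hε0 hε1
  have hlo1 := lowerFactor_le_one (k := k) (r := r) hε0 hε1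
  set y := Real.exp (-(δ * u / 2)) with hy
  set z := Real.exp (k / 2 * ((2 * r + 1 - (2 * r + 2) * α) * ((1 - δ) * u))) with hz
  have hy0 : 0 < y := Real.exp_pos _
  have hz0 : 0 < z := Real.exp_pos _
  have hprime : y + z ≤ ellPrime (k + 1) (r + 2) α δ u := by
    have h1 : y ≤ Real.exp (-(δ * u / 4)) := Real.exp_le_exp.2 (by nlinarith [mul_pos hδ0 hu.1])
    have h2 : z = Real.exp ((((k + 1 : ℕ) : ℝ) - 1) * (2 * ((r + 2 : ℕ) : ℝ) - 3 -
        (2 * ((r + 2 : ℕ) : ℝ) - 2) * α) * (1 - δ) * u / 2) := by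
      rw [hz]
      congr 1
      push_cast
      ring
    unfold ellPrime
    rw [← h2]
    have h3 := Real.exp_pos (((((k + 1 : ℕ) : ℝ) - 1) * max (((r + 2 : ℕ) : ℝ) - 4 * α) 0 *
      (1 - δ) - δ) * u / 2)
    linarith
  have hCL : 0 ≤ 2 * k * L + C := by positivity
  have hlu := hellL u
  have hlu0 : 0 ≤ (ell (k + 1) (r + 2) α u).toReal := ENNReal.toReal_nonneg
  obtain hx | hx := lt_or_ge (1 - ε - 2 * y) 0
  · -- For small `u` the lower bound is trivial.
    have h1 : 1 - η ≤ 2 * k * y := by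
      have h2 : lowerFactor k r ε * (1 - ε) ^ k ≤ 1 * (1 - ε) ^ 1 :=
        mul_le_mul hlo1 (pow_le_pow_of_le_one (by linarith) (by linarith) hk)
          (pow_nonneg (by linarith) k) zero_le_one
      nlinarith
    have h2 : (1 - η) * (ell (k + 1) (r + 2) α u).toReal ≤ (2 * k * L + C) * (y + z) := by
      have h3 := mul_le_mul h1 hlu hlu0 (by positivity)
      have h4 : 0 ≤ 2 * k * L * z + C * (y + z) := by positivity
      linarith
    rw [max_eq_right]
    · simp
    · have h3 := mul_le_mul_of_nonneg_left (h2.trans (mul_le_mul_of_nonneg_left hprime hCL)) hK.le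
      linarith
  · have hlower : ENNReal.ofReal (lowerFactor k r ε * (1 - ε - 2 * y) ^ k *
          K (k + 1) (r + 2) α * Real.exp (k * u / 2)) *
          ell (k + 1) (r + 2) α (min ((1 - δ) * u) T) ≤ nu (k + 1) (r + 2) α n u θ := by
      rw [nu_eq hk hα0 (radius_pos hk hn) ⟨hu.1, huR⟩,
        ← lintegral_const_mul' _ _ (ENNReal.pow_ne_top (ENNReal.natCast_ne_top n)), ell_eq,
        ← lintegral_const_mul' _ _ ENNReal.ofReal_ne_top]
      refine (setLIntegral_mono' (measurableSet_simplex r _) fun t ht =>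
        le_integrand hk (by omega) hα0 hε0 hε1 hδ0 hR hu θ huR hx ht).trans ?_
      exact lintegral_mono_set fun t ht =>
        ⟨ht.1, fun i => ⟨(ht.2 i).1, ((ht.2 i).2.trans (min_le_left _ _)).trans hvu⟩⟩
    refine le_trans ?_ hlower
    have hx0 : 0 ≤ (1 - ε - 2 * y) ^ k := pow_nonneg hx k
    rw [← ENNReal.ofReal_toReal (hell (min ((1 - δ) * u) T)), ← ENNReal.ofReal_mul (by positivity)]
    refine ENNReal.ofReal_le_ofReal ?_
    have ha : (1 - η / 2) * (ell (k + 1) (r + 2) α ((1 - δ) * u)).toReal ≤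
        (ell (k + 1) (r + 2) α (min ((1 - δ) * u) T)).toReal := by
      obtain h | h := le_total ((1 - δ) * u) T
      · rw [min_eq_left h]
        nlinarith [ENNReal.toReal_nonneg (a := ell (k + 1) (r + 2) α ((1 - δ) * u))]
      · rw [min_eq_right h]
        refine le_trans (mul_le_mul_of_nonneg_left (hellL _) (by linarith)) hT
    have hlv : (ell (k + 1) (r + 2) α u).toReal - C * z ≤
        (ell (k + 1) (r + 2) α ((1 - δ) * u)).toReal := by
      have h1 := hell_le u ((1 - δ) * u) hv0
      rw [min_eq_right hvu] at h1
      have h2 := ENNReal.toReal_mono (ENNReal.add_ne_top.2 ⟨hell _, ENNReal.ofReal_ne_top⟩) h1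
      rw [ENNReal.toReal_add (hell _) ENNReal.ofReal_ne_top, ENNReal.toReal_ofReal
        (by positivity)] at h2
      linarith
    have hmain := lower_arith (k := k) (half_pos hη0) (by linarith : η / 2 < 1) hlo0 hlo1
      (by linarith : 1 - ε ≤ 1) hx rfl hy0.le hz0.le hεη.le ha hlv hlu0 hlu hC.le
    have hKe : 0 ≤ K (k + 1) (r + 2) α := hK.le
    have h0 : 0 ≤ lowerFactor k r ε * (1 - ε - 2 * y) ^ k *
        (ell (k + 1) (r + 2) α (min ((1 - δ) * u) T)).toReal := by positivity
    have hmax : max ((1 - η) * K (k + 1) (r + 2) α * (ell (k + 1) (r + 2) α u).toReal -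
        K (k + 1) (r + 2) α * (2 * k * L + C) * ellPrime (k + 1) (r + 2) α δ u) 0 ≤
        K (k + 1) (r + 2) α * (lowerFactor k r ε * (1 - ε - 2 * y) ^ k *
          (ell (k + 1) (r + 2) α (min ((1 - δ) * u) T)).toReal) := by
      refine max_le ?_ (mul_nonneg hKe h0)
      have h1 := mul_le_mul_of_nonneg_left hprime hCL
      have h2 := mul_le_mul_of_nonneg_left (h1) hKe
      have h3 := mul_le_mul_of_nonneg_left hmain hKe
      linarith
    refine (mul_le_mul_of_nonneg_right hmax (Real.exp_pos _).le).trans (le_of_eq ?_)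
    ring

/-- As `ω_n` tends to infinity, the factor `e^{ω_n}` is bounded below. -/
theorem exists_le_exp_omega {k : ℕ} (hk : 1 ≤ k) :
    ∃ b : ℝ, 0 < b ∧ ∀ n : ℕ, b ≤ Real.exp (omega (k + 1) n) := by
  have h : ∀ᶠ n : ℕ in atTop, 1 ≤ Real.exp (omega (k + 1) n) := by
    filter_upwards [(tendsto_radius hk).eventually_ge_atTop (Real.exp (Real.exp 0))] with n hn
    have h1 : Real.exp 0 ≤ Real.log (radius (k + 1) n) :=
      (Real.le_log_iff_exp_le ((Real.exp_pos _).trans_le hn)).2 hn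
    have h2 : 1 < radius (k + 1) n := lt_of_lt_of_le (by simp) hn
    rw [omega, if_pos h2, Real.one_le_exp_iff]
    exact (Real.le_log_iff_exp_le ((Real.exp_pos _).trans_le h1)).2 h1
  obtain ⟨N, hN⟩ := eventually_atTop.1 h
  obtain ⟨a, -, ha⟩ := (Finset.range (N + 1)).exists_min_image
    (fun n => Real.exp (omega (k + 1) n)) ⟨0, by simp⟩
  refine ⟨min 1 (Real.exp (omega (k + 1) a)), lt_min one_pos (Real.exp_pos _), fun n => ?_⟩
  obtain hn | hn := le_total N n
  · exact (min_le_left _ _).trans (hN n hn)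
  · exact (min_le_right _ _).trans (ha n (by simpa using Nat.lt_succ_of_le hn))

end HRGG

theorem proposition3p2 (d m : ℕ) (hd : 2 ≤ d) (hm : 3 ≤ m) (α γ : ℝ)
    (hα : (2 * (m : ℝ) - 3) / (2 * (m : ℝ) - 2) < α) (hα' : α < 1)
    (hγ : 1 / (2 * α) < γ) (hγ' : γ < 1) :
    -- the limit `ℓ(∞)` is finite, so that `C_{m,α}` is well defined
    HRGG.ellInf d m α < ∞ ∧
    -- (i)
    (∃ ε : ℕ → ℝ, Tendsto ε atTop (𝓝 0) ∧
      ∀ n : ℕ, 1 ≤ n → ∀ u ∈ Ioo 0 (γ * HRGG.radius d n), ∀ θ : HRGG.Sph d,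
        HRGG.nu d m α n u θ ≤ ENNReal.ofReal
          ((1 + ε n) * HRGG.cliqueConst d m α * Real.exp (((d : ℝ) - 1) * u / 2))) ∧
    -- (ii)
    (∀ δ : ℝ,
      ((d : ℝ) - 1) * max ((m : ℝ) - 4 * α) 0 / (((d : ℝ) - 1) * max ((m : ℝ) - 4 * α) 0 + 1) < δ →
      δ < 1 →
      ∃ C : ℝ, 0 < C ∧ ∃ ε : ℕ → ℝ, Tendsto ε atTop (𝓝 0) ∧
        ∀ n : ℕ, 1 ≤ n → ∀ u ∈ Ioo 0 (γ * HRGG.radius d n), ∀ θ : HRGG.Sph d,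
          ENNReal.ofReal
            (max ((1 + ε n) * HRGG.K d m α * (HRGG.ell d m α u).toReal
                - C * HRGG.ellPrime d m α δ u) 0 * Real.exp (((d : ℝ) - 1) * u / 2))
            ≤ HRGG.nu d m α n u θ) ∧
    -- (iii)
    (∃ C c₀ : ℝ, 0 < C ∧ 0 < c₀ ∧
      ∀ n : ℕ, 1 ≤ n → ∀ u ∈ Ioo 0 (HRGG.radius d n), ∀ θ : HRGG.Sph d,
        HRGG.nu d m α n u θ ≤ ENNReal.ofReal
          (C * Real.exp (c₀ * HRGG.omega d n) * Real.exp (((d : ℝ) - 1) * u / 2))) := by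
  obtain ⟨k, rfl⟩ : ∃ k, d = k + 1 := ⟨d - 1, by omega⟩
  obtain ⟨r, rfl⟩ : ∃ r, m = r + 2 := ⟨m - 2, by omega⟩
  have hk : 1 ≤ k := by omega
  have hr : 1 ≤ r := by omega
  have hdk : ((k + 1 : ℕ) : ℝ) - 1 = k := by push_cast; ring
  have hα₁ : (2 * r + 1 : ℝ) / (2 * r + 2) < α := by
    refine lt_of_eq_of_lt ?_ hα
    push_cast
    congr 1 <;> ring
  have hα0 := HRGG.pos_of_div_lt hα₁
  have hγ0 : 0 < γ := lt_trans (by positivity) hγ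
  have hfin := HRGG.ellInf_lt_top hk hr hα₁ hα'
  have hK := HRGG.K_pos hk r hα0
  obtain ⟨C, hC, hcrude⟩ := HRGG.exists_nu_le hk hr hα₁ hα'
  simp only [hdk]
  refine ⟨hfin, ?_, ?_, ?_⟩
  · refine HRGG.exists_tendsto_zero (P := fun n b => 1 ≤ n →
      ∀ u ∈ Ioo 0 (γ * HRGG.radius (k + 1) n), ∀ θ : HRGG.Sph (k + 1),
        HRGG.nu (k + 1) (r + 2) α n u θ ≤ ENNReal.ofReal
          ((1 + b) * HRGG.cliqueConst (k + 1) (r + 2) α * Real.exp (k * u / 2)))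
      (fun η hη _ => ?_) fun n => ?_
    · exact (HRGG.eventually_nu_le hk hr hα₁ hα' hγ0 hγ' hη).mono fun n h _ => h
    · have hc : 0 < HRGG.cliqueConst (k + 1) (r + 2) α :=
        mul_pos hK (ENNReal.toReal_pos (HRGG.ellInf_pos k r α).ne' hfin.ne)
      refine ⟨C / HRGG.cliqueConst (k + 1) (r + 2) α, by positivity, fun hn u hu θ => ?_⟩
      have hR : 0 < HRGG.radius (k + 1) n := by
        have := hu.1.trans hu.2
        exact pos_of_mul_pos_right this hγ0.le
      refine (hcrude n hn u ⟨hu.1, hu.2.trans (by nlinarith)⟩ θ).trans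
        (ENNReal.ofReal_le_ofReal (mul_le_mul_of_nonneg_right ?_ (Real.exp_pos _).le))
      rw [add_mul, div_mul_cancel₀ _ hc.ne']
      linarith
  · intro δ hδ hδ1
    have hδ0 : 0 < δ := lt_of_le_of_lt (by positivity) hδ
    obtain ⟨C', hC', h⟩ := HRGG.exists_eventually_le_nu hk hr hα₁ hα' hγ0 hγ' hδ0 hδ1
    obtain ⟨ε, hε, h'⟩ := HRGG.exists_tendsto_zero (P := fun n b =>
      ∀ u ∈ Ioo 0 (γ * HRGG.radius (k + 1) n), ∀ θ : HRGG.Sph (k + 1),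
        ENNReal.ofReal (max ((1 - b) * HRGG.K (k + 1) (r + 2) α *
          (HRGG.ell (k + 1) (r + 2) α u).toReal - C' * HRGG.ellPrime (k + 1) (r + 2) α δ u) 0 *
          Real.exp (k * u / 2)) ≤ HRGG.nu (k + 1) (r + 2) α n u θ) h fun n => by
        -- With the error `1` the lower bound is `0`.
        refine ⟨1, zero_le_one, fun u _ θ => ?_⟩
        have hp : 0 ≤ C' * HRGG.ellPrime (k + 1) (r + 2) α δ u := by
          unfold HRGG.ellPrime
          positivity
        rw [max_eq_right (by linarith), zero_mul, ENNReal.ofReal_zero]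
        exact zero_le
    exact ⟨C', hC', fun n => -ε n, by simpa using hε.neg, fun n _ u hu θ => by
      have := h' n u hu θ
      rwa [sub_eq_add_neg] at this⟩
  · obtain ⟨b, hb, hω⟩ := HRGG.exists_le_exp_omega hk
    refine ⟨C / b, 1, by positivity, one_pos, fun n hn u hu θ => (hcrude n hn u hu θ).trans
      (ENNReal.ofReal_le_ofReal (mul_le_mul_of_nonneg_right ?_ (Real.exp_pos _).le))⟩
    rw [one_mul, div_mul_eq_mul_div, le_div_iff₀ hb]
    exact mul_le_mul_of_nonneg_left (hω n) hC.le
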